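/- Let $m,d,k\in\mathbb N$, $T>0$, and let $U\subseteq\mathbb R^k$ be equipped with a metric $\mathsf d$ inducing its usual topology. \textbf{Noise.} Let $\alpha>\frac13$, and let $\zeta:[0,T]\to\mathbb R^d$ be $\alpha$-Hölder with $\zeta_0=0$, with a Lévy area $\zeta^2=(\zeta^{2;ij}_{st})_{0\le s\le t\le T}$ such that $|\zeta^{2;ij}_{st}|\lesssim|t-s|^{2\alpha}$, $\zeta^{2;ij}_{st}-\zeta^{2;ij}_{su}-\zeta^{2;ij}_{ut}=(\zeta^i_u-\zeta^i_s)(\zeta^j_t-\zeta^j_u)$ and $\zeta^{2;ij}_{st}+\zeta^{2;ji}_{st}=(\zeta^i_t-\zeta^i_s)(\zeta^j_t-\zeta^j_s)$ for $s\le u\le t$. \textbf{Controls.} Let $\mathcal P_2(U)$ be the set of Borel probability measures on $U$ with finite second moment, with the Wasserstein metric $W_2(\mu,\nu)=\inf_\pi\big(\int \mathsf d(a,a')^2\,\pi(da,da')\big)^{1/2}$, the infimum being over all couplings $\pi$ of $\mu,\nu$. Let $\mathcal K\subset\mathcal P_2(U)$ be compact and non-empty, let $\varepsilon,L>0$, and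 put $\mathcal V^{\varepsilon,L}=\{\gamma:[0,T]\to\mathcal K:\ W_2(\gamma_s,\gamma_t)\le L|t-s|^{\varepsilon}\ \text{for all } s,t\}$. \textbf{Coefficients.} Let $b:[0,T]\times\mathbb R^m\times U\to\mathbb R^m$ be of class $\mathcal C^{0,1,1}_b$ ($b$, $\nabla_xb$, $\nabla_ab$ exist and are continuous and bounded), and let $u\mapsto b(u,x,a)$ be uniformly continuous, uniformly in $a\in U$, for each $x$. Let $\sigma:[0,T]\times\mathbb R^m\to\mathbb R^{m\times d}$ be of class $\mathcal C^{1,3}_b$ ($\sigma$, $\partial_t\sigma$ and $\nabla_x^j\sigma$, $j\le3$, exist and are continuous and bounded). \textbf{Equation.} Fix $\kappa\in(\frac13,\alpha)$ with $\kappa\le\frac12$. For $\gamma\in\mathcal V^{\varepsilon,L}$ and $y\in\mathbb R^m$, consider $$x^\gamma_t-x^\gamma_s=\int_s^t\int_U b(u,x^\gamma_u,a)\,\gamma_u(da)\,du+\int_s^t\sigma(u,x^\gamma_u)\,d\zeta_u,\qquad x^\gamma_0=y .$$ A solution is a $\kappa$-Hölder path $x$ on $[0,T]$ that is weakly controlled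 by $\zeta$ with derivative $x^\zeta=\sigma(\cdot,x)$: $\sigma(\cdot,x)$ is $\kappa$-Hölder and $|x_t-x_s-\sigma(s,x_s)(\zeta_t-\zeta_s)|\lesssim|t-s|^{2\kappa}$. The last integral is the rough integral of the weakly controlled path $w=\sigma(\cdot,x)$ with derivative $w^\zeta=\nabla_x\sigma(\cdot,x)\,\sigma(\cdot,x)$: it equals $w_s(\zeta_t-\zeta_s)+w^\zeta_s\zeta^2_{st}+Q_{st}$, where $Q$ is the unique two-index map with $|Q_{st}|\lesssim|t-s|^{3\kappa}$ that makes this expression additive in $(s,t)$. \textbf{Rewards.} Let $F:[0,T]\times\mathbb R^m\times\mathcal K\to\mathbb R$ be bounded, measurable in $s$ for fixed $(x,\mu)$, and, for each $s$, Lipschitz in $x$ uniformly over $\mu\in\mathcal K$ and (for each $x$) Lipschitz in $\mu\in\mathcal K$ with respect to $W_2$. Let $G:\mathbb R^m\to\mathbb R$ be bounded and continuous. \textbf{Claim.} For every $\gamma\in\mathcal V^{\varepsilon,L}$ the equation has a unique solution $x^\gamma$, and $s\mapsto F(s,x^\gamma_s,\gamma_s)$ is integrable on $[0,T]$, so that $$J_T(\gamma)=\int_0^TF(s,x^\gamma_s,\gamma_s)\,ds+G(x^\gamma_T)$$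 is well defined. Moreover the supremum $$V_0(y)=\sup\{J_T(\gamma):\gamma\in\mathcal V^{\varepsilon,L}\}$$ is finite and is attained: there is $\gamma^*\in\mathcal V^{\varepsilon,L}$ with $J_T(\gamma^*)=V_0(y)$. -/

import Mathlib

open Set MeasureTheory

noncomputable section

namespace RoughControl

/-- `ℝⁿ` with its Euclidean norm. -/
abbrev Vec (n : ℕ) : Type := EuclideanSpace ℝ (Fin n)

/-! ### Increments and Hölder spaces on `[0,T]` -/

section Increments

variable {V : Type*} [NormedAddCommGroup V] [NormedSpace ℝ V]

/-- The increment `δf_{st} = f_t - f_s` of a path. -/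
def delta1 (f : ℝ → V) (s t : ℝ) : V := f t - f s

/-- The increment `δh_{sut} = h_{st} - h_{su} - h_{ut}` of a two-index map. -/
def delta2 (h : ℝ → ℝ → V) (s u t : ℝ) : V := h s t - h s u - h u t

/-- `g ∈ 𝒞₂^μ([0,T]; V)`; for `μ > 0` the bound also contains `g_{tt} = 0`. -/
def Holder2 (T μ : ℝ) (g : ℝ → ℝ → V) : Prop :=
  ∃ C : ℝ, ∀ s t : ℝ, 0 ≤ s → s ≤ t → t ≤ T → ‖g s t‖ ≤ C * (t - s) ^ μ

/-- `f ∈ 𝒞₁^μ([0,T]; V)`. -/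
def Holder1 (T μ : ℝ) (f : ℝ → V) : Prop := Holder2 T μ (delta1 f)

/-- `g = Λ(h)`, where `Λ` is the sewing map on `𝒞₃^μ`, `μ > 1`: the increment `g` is the
(unique) element of `𝒞₂^μ` whose increment is `h`. -/
def IsSewing (T μ : ℝ) (h : ℝ → ℝ → ℝ → V) (g : ℝ → ℝ → V) : Prop :=
  Holder2 T μ g ∧
    ∀ s u t : ℝ, 0 ≤ s → s ≤ u → u ≤ t → t ≤ T → delta2 g s u t = h s u t

/-- The contraction `∑_{i,j} A(eᵢ)(eⱼ) Z^{ij}`. Here `A : ℝᵈ → L(ℝᵈ, V)` is the derivative of an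
`L(ℝᵈ, V)`-valued controlled path, applied first to the direction of that derivative, and the
first index of `Z` is the inner variable of the iterated integral. -/
def contract {d : ℕ} (A : Vec d →L[ℝ] Vec d →L[ℝ] V) (Z : Matrix (Fin d) (Fin d) ℝ) : V :=
  ∑ i : Fin d, ∑ j : Fin d,
    Z i j • A (EuclideanSpace.single i (1 : ℝ)) (EuclideanSpace.single j (1 : ℝ))

end Increments

/-! ### Rough paths, controlled paths and rough integrals -/

/-- `ζ` is an `α`-Hölder path in `ℝᵈ` started at `0`, and `Z` is a Lévy area above it, satisfying
Chen's relation and the geometric (shuffle) relation. -/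
structure IsGeometricRoughPath {d : ℕ} (T α : ℝ) (ζ : ℝ → Vec d)
    (Z : ℝ → ℝ → Matrix (Fin d) (Fin d) ℝ) : Prop where
  zero : ζ 0 = 0
  holder : Holder1 T α ζ
  area_holder : ∀ i j : Fin d, Holder2 T (2 * α) (fun s t => Z s t i j)
  chen : ∀ (i j : Fin d) (s u t : ℝ), 0 ≤ s → s ≤ u → u ≤ t → t ≤ T →
    delta2 (fun s t => Z s t i j) s u t = delta1 ζ s u i * delta1 ζ u t j
  geometric : ∀ (i j : Fin d) (s t : ℝ), 0 ≤ s → s ≤ t → t ≤ T →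
    Z s t i j + Z s t j i = delta1 ζ s t i * delta1 ζ s t j

section Controlled

variable {V : Type*} [NormedAddCommGroup V] [NormedSpace ℝ V] {d : ℕ}

/-- The remainder `ρ_{st} = δz_{st} - z'_s δζ_{st}`. -/
def remainder (ζ : ℝ → Vec d) (z : ℝ → V) (z' : ℝ → Vec d →L[ℝ] V) (s t : ℝ) : V :=
  delta1 z s t - z' s (delta1 ζ s t)

/-- The couple `(z, z')` is a path in `𝒬_ζ^κ([0,T]; V)`, weakly controlled by `ζ`. -/
structure IsControlled (T κ : ℝ) (ζ : ℝ → Vec d) (z : ℝ → V) (z' : ℝ → Vec d →L[ℝ] V) :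
    Prop where
  path : Holder1 T κ z
  deriv : Holder1 T κ z'
  rem : Holder2 T (2 * κ) (remainder ζ z z')

/-- `I_{st} = ∫_s^t μ_u dζ_u` in the sense of rough integration of the weakly controlled path
`(μ, μ')`, that is, with `ρ` the remainder of `(μ, μ')`,
`I = μ δζ + μ' Z + Λ(ρ δζ + δμ' Z)`. -/
def IsRoughIntegral (T κ : ℝ) (ζ : ℝ → Vec d) (Z : ℝ → ℝ → Matrix (Fin d) (Fin d) ℝ)
    (μ : ℝ → Vec d →L[ℝ] V) (μ' : ℝ → Vec d →L[ℝ] Vec d →L[ℝ] V) (I : ℝ → ℝ → V) : Prop :=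
  IsControlled T κ ζ μ μ' ∧
  ∃ Q : ℝ → ℝ → V,
    IsSewing T (3 * κ)
      (fun s u t => remainder ζ μ μ' s u (delta1 ζ u t) + contract (delta1 μ' s u) (Z u t)) Q ∧
    ∀ s t : ℝ, 0 ≤ s → s ≤ t → t ≤ T →
      I s t = μ s (delta1 ζ s t) + contract (μ' s) (Z s t) + Q s t

end Controlled

/-! ### The Wasserstein space `𝒫₂(U)` -/

section Wasserstein

/-- Borel probability measures on `U` with finite second moment. -/
structure P2 (U : Type*) [MetricSpace U] [MeasurableSpace U] where
  measure : Measure U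
  isProb : IsProbabilityMeasure measure
  moment : ∃ a₀ : U, ∫⁻ a, edist a a₀ ^ 2 ∂measure < ⊤

variable {U : Type*} [MetricSpace U] [MeasurableSpace U]

/-- Couplings of `μ` and `ν`. -/
def couplings (μ ν : P2 U) : Set (Measure (U × U)) :=
  {π | π.map Prod.fst = μ.measure ∧ π.map Prod.snd = ν.measure}

/-- The Wasserstein-2 distance. -/
def W2 (μ ν : P2 U) : ℝ :=
  Real.sqrt (⨅ π ∈ couplings μ ν, ∫⁻ p, edist p.1 p.2 ^ 2 ∂π).toReal

/-- The metric topology of `W2`. -/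
instance : TopologicalSpace (P2 U) where
  IsOpen s := ∀ μ ∈ s, ∃ r : ℝ, 0 < r ∧ ∀ ν, W2 μ ν < r → ν ∈ s
  isOpen_univ := fun _ _ => ⟨1, one_pos, fun _ _ => trivial⟩
  isOpen_inter := by
    rintro s t hs ht μ ⟨h1, h2⟩
    obtain ⟨r, hr, h⟩ := hs μ h1
    obtain ⟨r', hr', h'⟩ := ht μ h2
    exact ⟨min r r', lt_min hr hr', fun ν hν =>
      ⟨h ν (hν.trans_le (min_le_left _ _)), h' ν (hν.trans_le (min_le_right _ _))⟩⟩
  isOpen_sUnion := by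
    rintro S hS μ ⟨s, hs, hμ⟩
    obtain ⟨r, hr, h⟩ := hS s hs μ hμ
    exact ⟨r, hr, fun ν hν => ⟨s, hs, h ν hν⟩⟩

/-- `𝒱^{ε,L}`: paths `γ : [0,T] → K` with `W₂(γ_s, γ_t) ≤ L |t - s|^ε`. (Values of `γ` outside
`[0,T]` play no role.) -/
def controls (T ε L : ℝ) (K : Set (P2 U)) : Set (ℝ → P2 U) :=
  {γ | (∀ t ∈ Icc 0 T, γ t ∈ K) ∧
    ∀ s ∈ Icc 0 T, ∀ t ∈ Icc 0 T, W2 (γ s) (γ t) ≤ L * |t - s| ^ ε}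

end Wasserstein

/-! ### Assumptions on the coefficients -/

/-- `σ ∈ 𝒞_b^{1,3}([0,T] × E; W)`: the first derivative in time and the derivatives in space up to
order three exist, and together with `σ` they are continuous and bounded on `[0,T] × E`. -/
structure IsCb13 {E W : Type*} [NormedAddCommGroup E] [NormedSpace ℝ E] [NormedAddCommGroup W]
    [NormedSpace ℝ W] (T : ℝ) (σ : ℝ → E → W) : Prop where
  time_diff : ∀ x, DifferentiableOn ℝ (fun s => σ s x) (Icc 0 T)
  time_cont : ContinuousOn (fun p : ℝ × E => derivWithin (fun s => σ s p.2) (Icc 0 T) p.1)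
    (Icc 0 T ×ˢ univ)
  time_bdd : ∃ M : ℝ, ∀ t ∈ Icc 0 T, ∀ x, ‖derivWithin (fun s => σ s x) (Icc 0 T) t‖ ≤ M
  space_diff : ∀ t ∈ Icc 0 T, ContDiff ℝ 3 (σ t)
  space_cont : ∀ j : ℕ, j ≤ 3 →
    ContinuousOn (fun p : ℝ × E => iteratedFDeriv ℝ j (σ p.1) p.2) (Icc 0 T ×ˢ univ)
  space_bdd : ∀ j : ℕ, j ≤ 3 →
    ∃ M : ℝ, ∀ t ∈ Icc 0 T, ∀ x, ‖iteratedFDeriv ℝ j (σ t) x‖ ≤ M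

/-- `b ∈ 𝒞_b^{0,1,1}([0,T] × E × U; W)`, where `U` is regarded as a subset of the normed space `A`
through `ι`: `b` is bounded and continuous, and so are its derivatives in `x` and in `a`. -/
structure IsCb011 {E A W U : Type*} [NormedAddCommGroup E] [NormedSpace ℝ E]
    [NormedAddCommGroup A] [NormedSpace ℝ A] [NormedAddCommGroup W] [NormedSpace ℝ W]
    [TopologicalSpace U] (T : ℝ) (ι : U → A) (b : ℝ → E → U → W) : Prop where
  cont : ContinuousOn (fun p : ℝ × E × U => b p.1 p.2.1 p.2.2) (Icc 0 T ×ˢ univ)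
  bdd : ∃ M : ℝ, ∀ t ∈ Icc 0 T, ∀ x a, ‖b t x a‖ ≤ M
  space_diff : ∀ t ∈ Icc 0 T, ∀ a, Differentiable ℝ (fun x => b t x a)
  space_cont : ContinuousOn (fun p : ℝ × E × U => fderiv ℝ (fun x => b p.1 x p.2.2) p.2.1)
    (Icc 0 T ×ˢ univ)
  space_bdd : ∃ M : ℝ, ∀ t ∈ Icc 0 T, ∀ x a, ‖fderiv ℝ (fun x => b t x a) x‖ ≤ M
  control_diff : ∃ Db : ℝ → E → U → A →L[ℝ] W,
    (∀ t ∈ Icc 0 T, ∀ x a,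
      (fun a' => b t x a' - b t x a - Db t x a (ι a' - ι a)) =o[nhds a]
        (fun a' => ι a' - ι a)) ∧
    ContinuousOn (fun p : ℝ × E × U => Db p.1 p.2.1 p.2.2) (Icc 0 T ×ˢ univ) ∧
    ∃ M : ℝ, ∀ t ∈ Icc 0 T, ∀ x a, ‖Db t x a‖ ≤ M

/-- `u ↦ b(u,x,a)` is uniformly continuous on `[0,T]`, uniformly in `a`, for every `x`. -/
def UnifContInTime {E W U : Type*} [NormedAddCommGroup W] (T : ℝ) (b : ℝ → E → U → W) : Prop :=
  ∀ x : E, ∀ η : ℝ, 0 < η → ∃ δ : ℝ, 0 < δ ∧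
    ∀ u ∈ Icc 0 T, ∀ v ∈ Icc 0 T, |u - v| < δ → ∀ a : U, ‖b u x a - b v x a‖ < η

/-- The running reward: bounded on `[0,T] × E × K`, Lipschitz in `x` uniformly over `K`,
Lipschitz on `K` for `W₂`, and measurable in time. -/
structure IsRunningReward {E U : Type*} [NormedAddCommGroup E] [MetricSpace U]
    [MeasurableSpace U] (T : ℝ) (K : Set (P2 U)) (F : ℝ → E → P2 U → ℝ) : Prop where
  meas : ∀ x, ∀ μ ∈ K, AEStronglyMeasurable (fun s => F s x μ) (volume.restrict (Icc 0 T))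
  bdd : ∃ M : ℝ, ∀ s ∈ Icc 0 T, ∀ x, ∀ μ ∈ K, |F s x μ| ≤ M
  lip_space : ∀ s ∈ Icc 0 T, ∃ C : ℝ, ∀ μ ∈ K, ∀ x x', |F s x μ - F s x' μ| ≤ C * ‖x - x'‖
  lip_control : ∀ s ∈ Icc 0 T, ∀ x, ∃ C : ℝ, ∀ μ ∈ K, ∀ ν ∈ K,
    |F s x μ - F s x ν| ≤ C * W2 μ ν

/-- The terminal reward: bounded and continuous. -/
structure IsTerminalReward {E : Type*} [NormedAddCommGroup E] (G : E → ℝ) : Prop where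
  cont : Continuous G
  bdd : ∃ M : ℝ, ∀ x, |G x| ≤ M

/-! ### The controlled equation and the control problem -/

section Control

variable {m d : ℕ} {U : Type*} [MetricSpace U] [MeasurableSpace U]

/-- `x ∈ 𝒬_ζ^κ([0,T]; ℝᵐ)`, with derivative `x^ζ = σ(·, x)`, solves
`δx_{st} = ∫_s^t ∫_U b(u,x_u,a) γ_u(da) du + ∫_s^t σ(u,x_u) dζ_u`, `x_0 = y`.
The rough integrand `w = σ(·, x)` is controlled with derivative `w^ζ = ∇σ(·, x) x^ζ`. -/
structure IsSolution (T κ : ℝ) (ζ : ℝ → Vec d) (Z : ℝ → ℝ → Matrix (Fin d) (Fin d) ℝ)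
    (b : ℝ → Vec m → U → Vec m) (σ : ℝ → Vec m → Vec d →L[ℝ] Vec m) (y : Vec m)
    (γ : ℝ → P2 U) (x : ℝ → Vec m) : Prop where
  initial : x 0 = y
  controlled : IsControlled T κ ζ x (fun s => σ s (x s))
  equation : ∃ I : ℝ → ℝ → Vec m,
    IsRoughIntegral T κ ζ Z (fun s => σ s (x s))
      (fun s => (fderiv ℝ (σ s) (x s)).comp (σ s (x s))) I ∧
    ∀ s t : ℝ, 0 ≤ s → s ≤ t → t ≤ T →
      delta1 x s t = (∫ u in s..t, ∫ a, b u (x u) a ∂(γ u).measure) + I s t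

/-- The path `x^γ`: the solution of the equation (unique on `[0,T]`). -/
def solution (T κ : ℝ) (ζ : ℝ → Vec d) (Z : ℝ → ℝ → Matrix (Fin d) (Fin d) ℝ)
    (b : ℝ → Vec m → U → Vec m) (σ : ℝ → Vec m → Vec d →L[ℝ] Vec m) (y : Vec m)
    (γ : ℝ → P2 U) : ℝ → Vec m :=
  Classical.epsilon (IsSolution T κ ζ Z b σ y γ)

/-- `J_T(γ) = ∫_0^T F(s, x^γ_s, γ_s) ds + G(x^γ_T)`. -/
def objective (T κ : ℝ) (ζ : ℝ → Vec d) (Z : ℝ → ℝ → Matrix (Fin d) (Fin d) ℝ)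
    (b : ℝ → Vec m → U → Vec m) (σ : ℝ → Vec m → Vec d →L[ℝ] Vec m)
    (F : ℝ → Vec m → P2 U → ℝ) (G : Vec m → ℝ) (y : Vec m) (γ : ℝ → P2 U) : ℝ :=
  (∫ s in (0 : ℝ)..T, F s (solution T κ ζ Z b σ y γ s) (γ s)) + G (solution T κ ζ Z b σ y γ T)

/-- `V₀(y) = sup {J_T(γ) : γ ∈ 𝒱^{ε,L}}`. -/
def value (T κ : ℝ) (ζ : ℝ → Vec d) (Z : ℝ → ℝ → Matrix (Fin d) (Fin d) ℝ)
    (b : ℝ → Vec m → U → Vec m) (σ : ℝ → Vec m → Vec d →L[ℝ] Vec m)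
    (F : ℝ → Vec m → P2 U → ℝ) (G : Vec m → ℝ) (ε L : ℝ) (K : Set (P2 U)) (y : Vec m) : ℝ :=
  sSup (objective T κ ζ Z b σ F G y '' controls T ε L K)

end Control

end RoughControl

end

/-! The proof is the direct method. The set `controls` is sequentially compact for pointwise
`W2`-convergence, the objective is sequentially continuous for it, and so a maximising sequence
yields a maximiser.

Compactness (`exists_subseq_tendsto_W2`) is of Arzelà–Ascoli type: the values lie in the compact set
K and the modulus L|t - s|^ε is common to all controls. It rests on the triangle inequality for `W2`
(`optCost_triangle`), obtained by gluing couplings approximately along a fine countable partition,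
so that no disintegration is involved.

Continuity reduces to stability of the equation. Averaging b against γ_u gives a drift that is
bounded, continuous in time and Lipschitz in space, with constants independent of γ
(`CoeffBounds.driftBounds`). Solutions are recast in Davie's form `IsDavie`: x_t - x_s agrees with
the local expansion `germ` at (s, x_s) up to Γ|t - s|^{3κ}, where 3κ > 1. This is one inequality for
each pair (s,t), so it survives pointwise limits. It is equivalent to the notion in the theorem
(`IsDavie.isSolution`, `IsSolution.exists_isDavie`).

Existence comes from Euler schemes, which satisfy Davie's inequality on their grid with a constant
depending only on κ and M (`RoughData.euler_estimate`). The point is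
`RoughData.norm_delta2_germ_le`: if the error constant is G³, boundedness of the coefficients makes
the defect of the germ grow only like G². The discrete sewing argument therefore closes for large G
on all of [0,T] at once.

For uniqueness, the integrated remainders of two solutions are compared (`remDiff`). The increment
of their difference is bounded by the supremum of x - x' plus a small multiple of the constant being
estimated (`norm_delta2_remDiff_le`). On a short interval each sewing halves that constant, so it is
zero. The exponent is 2/3 + κ > 1. The 2/3 is the Hölder exponent in time of ∇σ, found by
Landau–Kolmogorov interpolation between the time-Lipschitz bound on σ and the bound on ∇³σ
(`IsCb13.exists_smoothBounds`).

Stability (`tendsto_solution`) combines the two: limit points of the solutions are Davie solutions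
of the limiting equation with the same constant, hence equal to its unique solution. Dominated
convergence then handles the rewards. -/

namespace RoughControl

open Filter Topology
open scoped ENNReal NNReal

set_option linter.unusedSectionVars false

/-! ### The Wasserstein distance: triangle inequality and weak convergence. -/

section Gluing

variable {U : Type*} [MetricSpace U] [MeasurableSpace U] [BorelSpace U]
  [SecondCountableTopology U]

/-- The transport cost of a coupling, as an `L²` norm. -/
noncomputable def planCost (π : Measure (U × U)) : ℝ≥0∞ :=
  (∫⁻ p, edist p.1 p.2 ^ (2 : ℝ) ∂π) ^ (1 / (2 : ℝ))

/-- The optimal transport cost, as an `L²` norm with values in `[0, ∞]`. -/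
noncomputable def optCost (μ ν : P2 U) : ℝ≥0∞ :=
  (⨅ π ∈ couplings μ ν, ∫⁻ p, edist p.1 p.2 ^ 2 ∂π) ^ (1 / (2 : ℝ))

lemma W2_eq_toReal_optCost (μ ν : P2 U) : W2 μ ν = (optCost μ ν).toReal := by
  rw [W2, optCost, ← ENNReal.toReal_rpow, Real.sqrt_eq_rpow]

lemma planCost_eq (π : Measure (U × U)) :
    planCost π = (∫⁻ p, edist p.1 p.2 ^ 2 ∂π) ^ (1 / (2 : ℝ)) := by
  simp only [planCost, ENNReal.rpow_two]

lemma optCost_le_planCost {μ ν : P2 U} {π : Measure (U × U)} (hπ : π ∈ couplings μ ν) :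
    optCost μ ν ≤ planCost π := by
  rw [planCost_eq, optCost]
  exact ENNReal.rpow_le_rpow (iInf₂_le π hπ) (by norm_num)

lemma exists_planCost_lt {μ ν : P2 U} {a : ℝ≥0∞} (h : optCost μ ν < a) :
    ∃ π ∈ couplings μ ν, planCost π < a := by
  have h2 : (⨅ π ∈ couplings μ ν, ∫⁻ p, edist p.1 p.2 ^ 2 ∂π) < a ^ (2 : ℝ) := by
    rw [optCost] at h
    rwa [one_div, ENNReal.rpow_inv_lt_iff (by norm_num)] at h
  simp only [iInf_lt_iff] at h2
  obtain ⟨π, hπ, hlt⟩ := h2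
  refine ⟨π, hπ, ?_⟩
  rw [planCost_eq, one_div, ENNReal.rpow_inv_lt_iff (by norm_num)]
  exact hlt

lemma measurable_edist_rpow :
    Measurable (fun p : U × U => edist p.1 p.2 ^ (2 : ℝ)) :=
  (measurable_fst.edist measurable_snd).pow_const _

/-- A separable metric space splits into countably many measurable pieces of small diameter. -/
lemma exists_small_partition [Nonempty U] {δ : ℝ≥0∞} (hδ : δ ≠ 0) :
    ∃ B : ℕ → Set U, (∀ n, MeasurableSet (B n)) ∧ Pairwise (Function.onFun Disjoint B) ∧
      (⋃ n, B n) = univ ∧ ∀ n, ∀ x ∈ B n, ∀ y ∈ B n, edist x y ≤ δ := by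
  have hδ2 : 0 < δ / 2 := ENNReal.half_pos hδ
  let A : ℕ → Set U := fun n => Metric.eball (TopologicalSpace.denseSeq U n) (δ / 2)
  refine ⟨disjointed A, fun n => MeasurableSet.disjointed (fun _ => Metric.isOpen_eball.measurableSet) n,
    disjoint_disjointed A, ?_, fun n x hx y hy => ?_⟩
  · rw [iUnion_disjointed, eq_univ_iff_forall]
    intro x
    obtain ⟨n, hn⟩ :=
      (TopologicalSpace.denseRange_denseSeq U).exists_mem_open (Metric.isOpen_eball (x := x) (ε := δ / 2))
        ⟨x, Metric.mem_eball_self hδ2⟩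
    exact mem_iUnion.2 ⟨n, Metric.mem_eball_comm.1 hn⟩
  · have h1 := disjointed_subset A n hx
    have h2 := disjointed_subset A n hy
    calc edist x y ≤ edist x (TopologicalSpace.denseSeq U n)
          + edist y (TopologicalSpace.denseSeq U n) := edist_triangle_right _ _ _
      _ ≤ δ / 2 + δ / 2 := add_le_add (le_of_lt h1) (le_of_lt h2)
      _ = δ := ENNReal.add_halves δ

/-- Approximate gluing of two couplings along a partition of the middle space. -/
noncomputable def glue (μ : Measure U) (B : ℕ → Set U) (π₁ π₂ : Measure (U × U)) :
    Measure ((U × U) × (U × U)) :=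
  Measure.sum fun n => (μ (B n))⁻¹ •
    (π₁.restrict (Prod.snd ⁻¹' B n)).prod (π₂.restrict (Prod.fst ⁻¹' B n))

section

variable {μ : Measure U} [IsProbabilityMeasure μ] {B : ℕ → Set U}
  {π₁ π₂ : Measure (U × U)} [IsProbabilityMeasure π₁] [IsProbabilityMeasure π₂]
  (hB : ∀ n, MeasurableSet (B n)) (hd : Pairwise (Function.onFun Disjoint B))
  (hU : (⋃ n, B n) = univ) (h₁ : π₁.map Prod.snd = μ) (h₂ : π₂.map Prod.fst = μ)

include hB hd hU h₁ h₂

/-- Integrating out the second factor of the n-th block leaves the mass `π₂ (Prod.fst ⁻¹' B n) = μ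
(B n)`, which cancels the normalising factor. A cell of mass zero contributes nothing on either
side. -/
lemma map_fst_glue : (glue μ B π₁ π₂).map Prod.fst = π₁ := by
  rw [glue, Measure.map_sum measurable_fst.aemeasurable]
  have key : ∀ n, ((μ (B n))⁻¹ •
      (π₁.restrict (Prod.snd ⁻¹' B n)).prod (π₂.restrict (Prod.fst ⁻¹' B n))).map Prod.fst
      = π₁.restrict (Prod.snd ⁻¹' B n) := by
    intro n
    have e1 : π₁ (Prod.snd ⁻¹' B n) = μ (B n) := by
      rw [← h₁, Measure.map_apply measurable_snd (hB n)]
    have e2 : π₂ (Prod.fst ⁻¹' B n) = μ (B n) := by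
      rw [← h₂, Measure.map_apply measurable_fst (hB n)]
    rw [Measure.map_smul, Measure.map_fst_prod, Measure.restrict_apply_univ, e2, smul_smul]
    by_cases h0 : μ (B n) = 0
    · rw [Measure.restrict_eq_zero.2 (e1.trans h0), smul_zero]
    · rw [ENNReal.inv_mul_cancel h0 (measure_ne_top _ _), one_smul]
  simp_rw [key]
  rw [← Measure.restrict_iUnion (fun i j hij => (hd hij).preimage _)
    (fun n => measurable_snd (hB n)), ← preimage_iUnion, hU, preimage_univ, Measure.restrict_univ]

lemma map_snd_glue : (glue μ B π₁ π₂).map Prod.snd = π₂ := by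
  rw [glue, Measure.map_sum measurable_snd.aemeasurable]
  have key : ∀ n, ((μ (B n))⁻¹ •
      (π₁.restrict (Prod.snd ⁻¹' B n)).prod (π₂.restrict (Prod.fst ⁻¹' B n))).map Prod.snd
      = π₂.restrict (Prod.fst ⁻¹' B n) := by
    intro n
    have e1 : π₁ (Prod.snd ⁻¹' B n) = μ (B n) := by
      rw [← h₁, Measure.map_apply measurable_snd (hB n)]
    have e2 : π₂ (Prod.fst ⁻¹' B n) = μ (B n) := by
      rw [← h₂, Measure.map_apply measurable_fst (hB n)]
    rw [Measure.map_smul, Measure.map_snd_prod, Measure.restrict_apply_univ, e1, smul_smul]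
    by_cases h0 : μ (B n) = 0
    · rw [Measure.restrict_eq_zero.2 (e2.trans h0), smul_zero]
    · rw [ENNReal.inv_mul_cancel h0 (measure_ne_top _ _), one_smul]
  simp_rw [key]
  rw [← Measure.restrict_iUnion (fun i j hij => (hd hij).preimage _)
    (fun n => measurable_fst (hB n)), ← preimage_iUnion, hU, preimage_univ, Measure.restrict_univ]

/-- In each block both middle coordinates lie in the same cell, so they agree up to its diameter.
This replaces the exact agreement that a disintegration would give. -/
lemma ae_glue_edist_le {δ : ℝ≥0∞} (hδ : ∀ n, ∀ x ∈ B n, ∀ y ∈ B n, edist x y ≤ δ) :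
    ∀ᵐ q ∂(glue μ B π₁ π₂), edist q.1.2 q.2.1 ≤ δ := by
  rw [glue, Measure.ae_sum_iff]
  intro n
  refine Measure.ae_smul_measure ?_ _
  rw [Measure.prod_restrict]
  filter_upwards [ae_restrict_mem ((measurable_snd (hB n)).prod (measurable_fst (hB n)))] with q hq
  exact hδ n _ hq.1 _ hq.2

end

lemma isProbabilityMeasure_of_mem_couplings {μ ν : P2 U} {π : Measure (U × U)}
    (hπ : π ∈ couplings μ ν) : IsProbabilityMeasure π := by
  have := μ.isProb
  constructor
  have h := congrArg (fun m : Measure U => m univ) hπ.1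
  simpa [Measure.map_apply measurable_fst MeasurableSet.univ] using h

/-- The outer marginals of the glued measure couple μ₁ with μ₃. Minkowski's inequality in L² along
the path through the two middle points adds the two costs and δ. -/
lemma optCost_triangle (μ₁ μ₂ μ₃ : P2 U) : optCost μ₁ μ₃ ≤ optCost μ₁ μ₂ + optCost μ₂ μ₃ := by
  have hne : Nonempty U := ⟨μ₁.moment.choose⟩
  have main : ∀ π₁ ∈ couplings μ₁ μ₂, ∀ π₂ ∈ couplings μ₂ μ₃, ∀ δ : ℝ≥0∞, δ ≠ 0 →
      optCost μ₁ μ₃ ≤ planCost π₁ + δ + planCost π₂ := by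
    intro π₁ h₁ π₂ h₂ δ hδ
    have := isProbabilityMeasure_of_mem_couplings h₁
    have := isProbabilityMeasure_of_mem_couplings h₂
    have := μ₂.isProb
    obtain ⟨B, hB, hd, hU, hdiam⟩ := exists_small_partition (U := U) hδ
    set Q := glue μ₂.measure B π₁ π₂ with hQ
    have hf : Q.map Prod.fst = π₁ := map_fst_glue hB hd hU h₁.2 h₂.1
    have hs : Q.map Prod.snd = π₂ := map_snd_glue hB hd hU h₁.2 h₂.1
    have hQprob : IsProbabilityMeasure Q := by
      constructor
      have h := congrArg (fun m : Measure (U × U) => m univ) hf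
      simpa [Measure.map_apply measurable_fst MeasurableSet.univ] using h
    have hmeas : Measurable (fun q : (U × U) × (U × U) => (q.1.1, q.2.2)) := by fun_prop
    have hc : Q.map (fun q : (U × U) × (U × U) => (q.1.1, q.2.2)) ∈ couplings μ₁ μ₃ := by
      constructor
      · rw [Measure.map_map measurable_fst hmeas, ← h₁.1, ← hf,
          Measure.map_map measurable_fst measurable_fst]
        rfl
      · rw [Measure.map_map measurable_snd hmeas, ← h₂.2, ← hs,
          Measure.map_map measurable_snd measurable_snd]
        rfl
    refine (optCost_le_planCost hc).trans ?_
    let f₁ : (U × U) × (U × U) → ℝ≥0∞ := fun q => edist q.1.1 q.1.2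
    let f₂ : (U × U) × (U × U) → ℝ≥0∞ := fun _ => δ
    let f₃ : (U × U) × (U × U) → ℝ≥0∞ := fun q => edist q.2.1 q.2.2
    have m₁ : Measurable f₁ := (measurable_fst.comp measurable_fst).edist
      (measurable_snd.comp measurable_fst)
    have m₂ : Measurable f₂ := measurable_const
    have m₃ : Measurable f₃ := (measurable_fst.comp measurable_snd).edist
      (measurable_snd.comp measurable_snd)
    have i₁ : (∫⁻ q, f₁ q ^ (2 : ℝ) ∂Q) ^ (1 / (2 : ℝ)) = planCost π₁ := by
      rw [planCost, ← hf, lintegral_map measurable_edist_rpow measurable_fst]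
    have i₂ : (∫⁻ q, f₂ q ^ (2 : ℝ) ∂Q) ^ (1 / (2 : ℝ)) = δ := by
      simp only [f₂, lintegral_const, measure_univ, mul_one]
      rw [← ENNReal.rpow_mul]
      norm_num
    have i₃ : (∫⁻ q, f₃ q ^ (2 : ℝ) ∂Q) ^ (1 / (2 : ℝ)) = planCost π₂ := by
      rw [planCost, ← hs, lintegral_map measurable_edist_rpow measurable_snd]
    rw [planCost, lintegral_map measurable_edist_rpow hmeas]
    calc (∫⁻ q, edist q.1.1 q.2.2 ^ (2 : ℝ) ∂Q) ^ (1 / (2 : ℝ))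
        ≤ (∫⁻ q, ((f₁ + f₂) + f₃) q ^ (2 : ℝ) ∂Q) ^ (1 / (2 : ℝ)) := by
          refine ENNReal.rpow_le_rpow (lintegral_mono_ae ?_) (by norm_num)
          filter_upwards [ae_glue_edist_le (μ := μ₂.measure) (π₁ := π₁) (π₂ := π₂) hB hd hU h₁.2
            h₂.1 hdiam] with q hq
          refine ENNReal.rpow_le_rpow ?_ (by norm_num)
          calc edist q.1.1 q.2.2 ≤ edist q.1.1 q.1.2 + edist q.1.2 q.2.1 + edist q.2.1 q.2.2 :=
                edist_triangle4 _ _ _ _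
            _ ≤ _ := add_le_add (add_le_add le_rfl hq) le_rfl
      _ ≤ (∫⁻ q, (f₁ + f₂) q ^ (2 : ℝ) ∂Q) ^ (1 / (2 : ℝ))
            + (∫⁻ q, f₃ q ^ (2 : ℝ) ∂Q) ^ (1 / (2 : ℝ)) :=
          ENNReal.lintegral_Lp_add_le (m₁.add m₂).aemeasurable m₃.aemeasurable (by norm_num)
      _ ≤ ((∫⁻ q, f₁ q ^ (2 : ℝ) ∂Q) ^ (1 / (2 : ℝ)) + (∫⁻ q, f₂ q ^ (2 : ℝ) ∂Q) ^ (1 / (2 : ℝ)))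
            + (∫⁻ q, f₃ q ^ (2 : ℝ) ∂Q) ^ (1 / (2 : ℝ)) := by
          gcongr
          exact ENNReal.lintegral_Lp_add_le m₁.aemeasurable m₂.aemeasurable (by norm_num)
      _ = planCost π₁ + δ + planCost π₂ := by rw [i₁, i₂, i₃]
  -- The error ε is shared equally by the two near-optimal couplings and the cell diameter.
  refine ENNReal.le_of_forall_pos_le_add fun ε hε hfin => ?_
  have hfin' := ENNReal.add_lt_top.1 hfin
  set e : ℝ≥0∞ := (ε : ℝ≥0∞) / 3 with he
  have he0 : e ≠ 0 := by simp [he, hε.ne']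
  obtain ⟨π₁, h₁, c₁⟩ := exists_planCost_lt (ENNReal.lt_add_right hfin'.1.ne he0)
  obtain ⟨π₂, h₂, c₂⟩ := exists_planCost_lt (ENNReal.lt_add_right hfin'.2.ne he0)
  calc optCost μ₁ μ₃ ≤ planCost π₁ + e + planCost π₂ :=
        main π₁ h₁ π₂ h₂ e he0
    _ ≤ (optCost μ₁ μ₂ + e) + e + (optCost μ₂ μ₃ + e) := by gcongr
    _ = optCost μ₁ μ₂ + optCost μ₂ μ₃ + (e + e + e) := by ring
    _ = optCost μ₁ μ₂ + optCost μ₂ μ₃ + ε := by rw [he, ENNReal.add_thirds]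

/-- The product coupling has finite cost: the distance is split through the two centres of the
moment conditions. -/
lemma optCost_lt_top (μ ν : P2 U) : optCost μ ν < ⊤ := by
  obtain ⟨a, ha⟩ := μ.moment
  obtain ⟨a', ha'⟩ := ν.moment
  have := μ.isProb
  have := ν.isProb
  have hc : μ.measure.prod ν.measure ∈ couplings μ ν := by
    constructor
    · simp [Measure.map_fst_prod]
    · simp [Measure.map_snd_prod]
  refine (optCost_le_planCost hc).trans_lt ?_
  have hsq : ∀ (ρ : P2 U) (c : U), ∫⁻ x, edist x c ^ 2 ∂ρ.measure < ⊤ →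
      ∫⁻ x, edist x c ^ (2 : ℝ) ∂ρ.measure < ⊤ := by
    intro ρ c h
    simpa only [ENNReal.rpow_two] using h
  set P := μ.measure.prod ν.measure
  have m₁ : Measurable (fun q : U × U => edist q.1 a) := measurable_fst.edist measurable_const
  have m₂ : Measurable (fun _ : U × U => edist a a') := measurable_const
  have m₃ : Measurable (fun q : U × U => edist q.2 a') := measurable_snd.edist measurable_const
  have i₁ : ∫⁻ q, (fun q : U × U => edist q.1 a) q ^ (2 : ℝ) ∂P < ⊤ := by
    have h := lintegral_map (μ := P) (f := fun x : U => edist x a ^ (2 : ℝ))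
      ((measurable_id.edist measurable_const).pow_const _) measurable_fst
    rw [hc.1] at h
    exact h ▸ hsq μ a ha
  have i₃ : ∫⁻ q, (fun q : U × U => edist q.2 a') q ^ (2 : ℝ) ∂P < ⊤ := by
    have h := lintegral_map (μ := P) (f := fun x : U => edist x a' ^ (2 : ℝ))
      ((measurable_id.edist measurable_const).pow_const _) measurable_snd
    rw [hc.2] at h
    exact h ▸ hsq ν a' ha'
  have i₂ : ∫⁻ q, (fun _ : U × U => edist a a') q ^ (2 : ℝ) ∂P < ⊤ := by
    simp only [lintegral_const, measure_univ, mul_one]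
    exact ENNReal.rpow_lt_top_of_nonneg (by norm_num) (edist_ne_top _ _)
  have j₁ := ENNReal.lintegral_rpow_add_lt_top_of_lintegral_rpow_lt_top m₁.aemeasurable i₁ i₂
    (by norm_num : (1 : ℝ) ≤ 2)
  have j₂ := ENNReal.lintegral_rpow_add_lt_top_of_lintegral_rpow_lt_top
    (m₁.add m₂).aemeasurable j₁ i₃ (by norm_num : (1 : ℝ) ≤ 2)
  refine ENNReal.rpow_lt_top_of_nonneg (by norm_num) (ne_of_lt (lt_of_le_of_lt ?_ j₂))
  refine lintegral_mono fun q => ENNReal.rpow_le_rpow ?_ (by norm_num)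
  calc edist q.1 q.2 ≤ edist q.1 a + edist a a' + edist a' q.2 := edist_triangle4 _ _ _ _
    _ = _ := by rw [edist_comm a' q.2]; rfl

lemma W2_triangle (μ₁ μ₂ μ₃ : P2 U) : W2 μ₁ μ₃ ≤ W2 μ₁ μ₂ + W2 μ₂ μ₃ := by
  simp only [W2_eq_toReal_optCost]
  rw [← ENNReal.toReal_add (optCost_lt_top _ _).ne (optCost_lt_top _ _).ne]
  exact ENNReal.toReal_mono (ENNReal.add_lt_top.2 ⟨optCost_lt_top _ _, optCost_lt_top _ _⟩).ne
    (optCost_triangle _ _ _)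

lemma W2_nonneg (μ ν : P2 U) : 0 ≤ W2 μ ν := Real.sqrt_nonneg _

lemma optCost_self (μ : P2 U) : optCost μ μ = 0 := by
  have hm : Measurable (fun x : U => (x, x)) := measurable_id.prodMk measurable_id
  have hc : μ.measure.map (fun x : U => (x, x)) ∈ couplings μ μ := by
    constructor
    · rw [Measure.map_map measurable_fst hm]; exact Measure.map_id
    · rw [Measure.map_map measurable_snd hm]; exact Measure.map_id
  refine le_antisymm ((optCost_le_planCost hc).trans ?_) bot_le
  rw [planCost, lintegral_map measurable_edist_rpow hm]
  simp

lemma W2_self (μ : P2 U) : W2 μ μ = 0 := by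
  rw [W2_eq_toReal_optCost, optCost_self, ENNReal.toReal_zero]

lemma optCost_comm_le (μ ν : P2 U) : optCost μ ν ≤ optCost ν μ := by
  refine le_of_forall_gt fun a ha => ?_
  obtain ⟨π, hπ, hlt⟩ := exists_planCost_lt ha
  have hc : π.map Prod.swap ∈ couplings μ ν := by
    constructor
    · rw [Measure.map_map measurable_fst measurable_swap]; exact hπ.2
    · rw [Measure.map_map measurable_snd measurable_swap]; exact hπ.1
  refine (optCost_le_planCost hc).trans_lt ?_
  rw [planCost, lintegral_map measurable_edist_rpow measurable_swap]
  simpa [planCost, edist_comm] using hlt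

lemma W2_comm (μ ν : P2 U) : W2 μ ν = W2 ν μ := by
  rw [W2_eq_toReal_optCost, W2_eq_toReal_optCost,
    le_antisymm (optCost_comm_le μ ν) (optCost_comm_le ν μ)]

/-- Balls of `W2` are neighbourhoods of their centres. -/
lemma tendsto_W2_of_tendsto {ι : Type*} {l : Filter ι} {μs : ι → P2 U} {μ : P2 U}
    (h : Tendsto μs l (𝓝 μ)) : Tendsto (fun i => W2 (μs i) μ) l (𝓝 0) := by
  rw [Metric.tendsto_nhds]
  intro r hr
  -- The topology is given by a neighbourhood condition, so that balls are open depends on the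
  -- triangle inequality.
  have hopen : IsOpen {ν : P2 U | W2 ν μ < r} := by
    intro ν hν
    refine ⟨r - W2 ν μ, sub_pos.2 hν, fun ρ hρ => ?_⟩
    have := W2_triangle ρ ν μ
    rw [W2_comm ρ ν] at this
    simp only [mem_ofPred_eq]
    linarith
  have := h (hopen.mem_nhds (by simpa [W2_self] using hr))
  filter_upwards [this] with i hi
  rw [Real.dist_eq, sub_zero, abs_of_nonneg (W2_nonneg _ _)]
  exact hi

/-- Integrals of bounded Lipschitz functions are Lipschitz for `W2`. -/
lemma abs_integral_sub_le_W2 {f : U → ℝ} {C : ℝ≥0} (hf : LipschitzWith C f)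
    (hb : ∃ M : ℝ, ∀ x, ‖f x‖ ≤ M) (μ ν : P2 U) :
    |∫ a, f a ∂μ.measure - ∫ a, f a ∂ν.measure| ≤ C * W2 μ ν := by
  obtain ⟨M, hM⟩ := hb
  have := μ.isProb
  have := ν.isProb
  have hfm : Measurable f := hf.continuous.measurable
  have key : ∀ π ∈ couplings μ ν,
      ENNReal.ofReal |∫ a, f a ∂μ.measure - ∫ a, f a ∂ν.measure| ≤ C * planCost π := by
    intro π hπ
    have := isProbabilityMeasure_of_mem_couplings hπ
    have e₁ : ∫ a, f a ∂μ.measure = ∫ p, f p.1 ∂π := by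
      rw [← hπ.1, integral_map measurable_fst.aemeasurable hfm.aestronglyMeasurable]
    have e₂ : ∫ a, f a ∂ν.measure = ∫ p, f p.2 ∂π := by
      rw [← hπ.2, integral_map measurable_snd.aemeasurable hfm.aestronglyMeasurable]
    have g₁ : Integrable (fun p : U × U => f p.1) π :=
      Integrable.of_bound (hfm.comp measurable_fst).aestronglyMeasurable M (ae_of_all _ fun p => hM _)
    have g₂ : Integrable (fun p : U × U => f p.2) π :=
      Integrable.of_bound (hfm.comp measurable_snd).aestronglyMeasurable M (ae_of_all _ fun p => hM _)
    rw [e₁, e₂, ← integral_sub g₁ g₂, ← Real.norm_eq_abs, ofReal_norm]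
    have hm : AEMeasurable (fun p : U × U => edist p.1 p.2) π :=
      (measurable_fst.edist measurable_snd).aemeasurable
    calc ‖∫ p, f p.1 - f p.2 ∂π‖ₑ ≤ ∫⁻ p, ‖f p.1 - f p.2‖ₑ ∂π := enorm_integral_le_lintegral_enorm _
      _ ≤ ∫⁻ p, C * edist p.1 p.2 ∂π := by
          refine lintegral_mono fun p => ?_
          rw [← edist_eq_enorm_sub]
          exact hf p.1 p.2
      _ = C * ∫⁻ p, edist p.1 p.2 ∂π := lintegral_const_mul' _ _ ENNReal.coe_ne_top
      _ ≤ C * planCost π := by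
          gcongr
          -- Cauchy–Schwarz against the constant 1, for the probability measure π.
          have h := ENNReal.lintegral_mul_le_Lp_mul_Lq π
            (Real.HolderConjugate.two_two) hm (aemeasurable_const (b := (1 : ℝ≥0∞)))
          simpa [planCost] using h
  have h2 : ENNReal.ofReal |∫ a, f a ∂μ.measure - ∫ a, f a ∂ν.measure| ≤ C * optCost μ ν := by
    refine ENNReal.le_of_forall_pos_le_add fun ε hε _ => ?_
    -- Dividing by C + 1 instead of C also covers C = 0.
    have hC : (C : ℝ≥0∞) + 1 ≠ 0 := by simp
    have hC' : (C : ℝ≥0∞) + 1 ≠ ⊤ := by simp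
    obtain ⟨π, hπ, hlt⟩ := exists_planCost_lt (ENNReal.lt_add_right (optCost_lt_top μ ν).ne
      (ENNReal.div_pos (by exact_mod_cast hε.ne' : (ε : ℝ≥0∞) ≠ 0) hC').ne')
    calc _ ≤ C * planCost π := key π hπ
      _ ≤ C * (optCost μ ν + ε / (C + 1)) := by gcongr
      _ = C * optCost μ ν + C * (ε / (C + 1)) := mul_add _ _ _
      _ ≤ C * optCost μ ν + (C + 1) * (ε / (C + 1)) := by gcongr; exact le_self_add
      _ = _ := by rw [ENNReal.mul_div_cancel hC hC']
  rw [W2_eq_toReal_optCost]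
  have h3 := ENNReal.toReal_mono (ENNReal.mul_lt_top ENNReal.coe_lt_top (optCost_lt_top μ ν)).ne h2
  rwa [ENNReal.toReal_ofReal (abs_nonneg _), ENNReal.toReal_mul, ENNReal.coe_toReal] at h3

/-- `W2`-convergence implies convergence of the integrals of bounded continuous functions. -/
lemma tendsto_integral_of_tendsto_W2 {ι : Type*} {l : Filter ι} [l.IsCountablyGenerated]
    {μs : ι → P2 U} {μ : P2 U} (h : Tendsto (fun i => W2 (μs i) μ) l (𝓝 0))
    {f : U → ℝ} (hf : Continuous f) {M : ℝ} (hM : ∀ x, ‖f x‖ ≤ M) :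
    Tendsto (fun i => ∫ a, f a ∂(μs i).measure) l (𝓝 (∫ a, f a ∂μ.measure)) := by
  let P : P2 U → ProbabilityMeasure U := fun ν => ⟨ν.measure, ν.isProb⟩
  have hP : Tendsto (fun i => P (μs i)) l (𝓝 (P μ)) := by
    -- Weak convergence may be tested on bounded Lipschitz functions, for which `W2` gives a rate.
    rw [tendsto_iff_forall_lipschitz_integral_tendsto]
    rintro g ⟨C, hC⟩ ⟨L, hL⟩
    have hb : ∃ M : ℝ, ∀ x, ‖g x‖ ≤ M := by
      obtain ⟨x₀, -⟩ := μ.moment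
      refine ⟨‖g x₀‖ + C, fun x => ?_⟩
      have := hC x x₀
      rw [dist_eq_norm] at this
      linarith [norm_sub_norm_le (g x) (g x₀)]
    rw [tendsto_iff_dist_tendsto_zero]
    refine squeeze_zero (fun _ => dist_nonneg) (fun i => abs_integral_sub_le_W2 hL hb _ _) ?_
    simpa using h.const_mul (L : ℝ)
  rw [ProbabilityMeasure.tendsto_iff_forall_integral_tendsto] at hP
  exact hP (BoundedContinuousFunction.ofNormedAddCommGroup f hf M hM)

/-- Vector-valued version of `tendsto_integral_of_tendsto_W2`. -/
lemma tendsto_integral_vec_of_tendsto_W2 {ι : Type*} {l : Filter ι} [l.IsCountablyGenerated]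
    {m : ℕ} {μs : ι → P2 U} {μ : P2 U} (h : Tendsto (fun i => W2 (μs i) μ) l (𝓝 0))
    {f : U → Vec m} (hf : Continuous f) {M : ℝ} (hM : ∀ x, ‖f x‖ ≤ M) :
    Tendsto (fun i => ∫ a, f a ∂(μs i).measure) l (𝓝 (∫ a, f a ∂μ.measure)) := by
  have hint : ∀ ν : P2 U, Integrable f ν.measure := fun ν =>
    have := ν.isProb
    Integrable.of_bound hf.aestronglyMeasurable M (ae_of_all _ hM)
  have hcoord : ∀ (ν : P2 U) (i : Fin m), (∫ a, f a ∂ν.measure) i = ∫ a, f a i ∂ν.measure :=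
    fun ν i => ((EuclideanSpace.proj (𝕜 := ℝ) i).integral_comp_comm (hint ν)).symm
  rw [(PiLp.homeomorph 2 (fun _ : Fin m => ℝ)).isInducing.tendsto_nhds_iff, tendsto_pi_nhds]
  intro i
  have hi : Continuous fun a => f a i := (EuclideanSpace.proj (𝕜 := ℝ) i).continuous.comp hf
  have := tendsto_integral_of_tendsto_W2 h hi (fun a => (PiLp.norm_apply_le (f a) i).trans (hM a))
  simp only [← hcoord] at this
  exact this

end Gluing

/-! ### Taylor, four-point and Landau–Kolmogorov estimates. -/

section Calculus

variable {E W : Type*} [NormedAddCommGroup E] [NormedSpace ℝ E] [NormedAddCommGroup W]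
  [NormedSpace ℝ W]

lemma norm_sub_le_of_norm_fderiv_le {φ : E → W} {C : ℝ} (hd : Differentiable ℝ φ)
    (hC : ∀ x, ‖fderiv ℝ φ x‖ ≤ C) (x y : E) : ‖φ x - φ y‖ ≤ C * ‖x - y‖ :=
  convex_univ.norm_image_sub_le_of_norm_fderiv_le (𝕜 := ℝ) (fun z _ => hd z) (fun z _ => hC z)
    (mem_univ y) (mem_univ x)

/-- Mean value inequality for φ minus its linear part on the ball of radius ‖v‖, where the
derivative is at most L‖v‖. This gives L in place of the sharp L/2. -/
lemma norm_taylor_one_le {φ : E → W} {L : ℝ} (hd : Differentiable ℝ φ)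
    (hL : ∀ x y, ‖fderiv ℝ φ x - fderiv ℝ φ y‖ ≤ L * ‖x - y‖) (hL0 : 0 ≤ L) (x v : E) :
    ‖φ (x + v) - φ x - fderiv ℝ φ x v‖ ≤ L * ‖v‖ ^ 2 := by
  have h := (convex_closedBall x ‖v‖).norm_image_sub_le_of_norm_fderiv_le' (𝕜 := ℝ) (f := φ)
    (C := L * ‖v‖) (φ := fderiv ℝ φ x) (x := x) (y := x + v) (fun z _ => hd z)
    (fun z hz => (hL z x).trans (mul_le_mul_of_nonneg_left (by simpa [dist_eq_norm] using hz) hL0))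
    (Metric.mem_closedBall_self (norm_nonneg _)) (by simp)
  simpa [pow_two, mul_assoc] using h

/-- One step of the Landau inequality. -/
lemma norm_fderiv_le_landau {φ : E → W} {a L h : ℝ} (hd : Differentiable ℝ φ)
    (ha : ∀ x, ‖φ x‖ ≤ a) (hL : ∀ x y, ‖fderiv ℝ φ x - fderiv ℝ φ y‖ ≤ L * ‖x - y‖) (hL0 : 0 ≤ L)
    (hh : 0 < h) (x : E) : ‖fderiv ℝ φ x‖ ≤ 2 * a / h + L * h := by
  have ha0 : 0 ≤ a := (norm_nonneg _).trans (ha x)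
  refine ContinuousLinearMap.opNorm_le_of_unit_norm (by positivity) fun v hv => ?_
  -- The derivative is read off from a difference quotient of step h: the quotient is at most 2a/h
  -- and its error at most Lh.
  have h1 := norm_taylor_one_le hd hL hL0 x (h • v)
  have h2 : ‖h • v‖ = h := by rw [norm_smul, hv, Real.norm_of_nonneg hh.le, mul_one]
  have h3 : ‖fderiv ℝ φ x (h • v)‖ ≤ 2 * a + L * h ^ 2 := by
    calc ‖fderiv ℝ φ x (h • v)‖
        = ‖φ (x + h • v) - φ x - (φ (x + h • v) - φ x - fderiv ℝ φ x (h • v))‖ := by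
          congr 1; abel
      _ ≤ ‖φ (x + h • v)‖ + ‖φ x‖ + ‖φ (x + h • v) - φ x - fderiv ℝ φ x (h • v)‖ :=
          (norm_sub_le _ _).trans (add_le_add (norm_sub_le _ _) le_rfl)
      _ ≤ a + a + L * h ^ 2 := by
          rw [h2] at h1
          exact add_le_add (add_le_add (ha _) (ha _)) h1
      _ = _ := by ring
  rw [map_smul, norm_smul, Real.norm_of_nonneg hh.le] at h3
  have : ‖fderiv ℝ φ x v‖ ≤ (2 * a + L * h ^ 2) / h := by
    rw [le_div_iff₀ hh]; linarith
  calc _ ≤ _ := this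
    _ = _ := by field_simp

/-- Landau–Kolmogorov inequality for the first derivative in terms of the function and its
third derivative. -/
lemma norm_fderiv_le_landau_three {φ : E → W} {a L K h : ℝ} (hd : Differentiable ℝ φ)
    (hd' : Differentiable ℝ (fderiv ℝ φ)) (ha : ∀ x, ‖φ x‖ ≤ a) (hK : ∀ x, ‖fderiv ℝ φ x‖ ≤ K)
    (hL : ∀ x y, ‖fderiv ℝ (fderiv ℝ φ) x - fderiv ℝ (fderiv ℝ φ) y‖ ≤ L * ‖x - y‖) (hL0 : 0 ≤ L)
    (hh : 0 < h) (x : E) : ‖fderiv ℝ φ x‖ ≤ 4 * a / h + 8 * L * h ^ 2 := by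
  have hbdd : BddAbove (range fun x => ‖fderiv ℝ φ x‖) := ⟨K, by rintro _ ⟨x, rfl⟩; exact hK x⟩
  set S := ⨆ x, ‖fderiv ℝ φ x‖ with hS
  have hS1 : ∀ x, ‖fderiv ℝ φ x‖ ≤ S := fun x => le_ciSup hbdd x
  have hS0 : 0 ≤ S := (norm_nonneg _).trans (hS1 x)
  -- Step 4h here and step h below make S reappear with factor 1/2, so that it can be absorbed. The
  -- bound K only guarantees that S is finite, and does not enter the result.
  have h2 : ∀ x, ‖fderiv ℝ (fderiv ℝ φ) x‖ ≤ 2 * S / (4 * h) + L * (4 * h) := fun x =>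
    norm_fderiv_le_landau hd' hS1 hL hL0 (by positivity) x
  have h3 : ∀ x, ‖fderiv ℝ φ x‖ ≤ 2 * a / h + (2 * S / (4 * h) + L * (4 * h)) * h := fun x =>
    norm_fderiv_le_landau hd ha (norm_sub_le_of_norm_fderiv_le hd' h2) (by positivity) hh x
  have h4 : S ≤ 2 * a / h + (2 * S / (4 * h) + L * (4 * h)) * h := ciSup_le h3
  have h5 : 2 * a / h + (2 * S / (4 * h) + L * (4 * h)) * h
      = 2 * (a / h) + S / 2 + 4 * L * h ^ 2 := by field_simp; ring
  refine (hS1 x).trans ?_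
  rw [h5] at h4
  rw [mul_div_assoc]
  linarith

/-- A four-point estimate for functions with bounded Lipschitz derivative. -/
lemma norm_four_point_le {φ : E → W} {M : ℝ} (hd : Differentiable ℝ φ)
    (hM : ∀ x, ‖fderiv ℝ φ x‖ ≤ M)
    (hL : ∀ x y, ‖fderiv ℝ φ x - fderiv ℝ φ y‖ ≤ M * ‖x - y‖) (p v p' v' : E) :
    ‖(φ (p + v) - φ p) - (φ (p' + v') - φ p')‖ ≤ M * (‖v‖ * ‖p - p'‖ + ‖v - v'‖) := by
  -- The base point is moved at fixed increment v, where the translate difference is M‖v‖-Lipschitz.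
  -- The increment is moved afterwards.
  have hs : ∀ x, HasFDerivAt (fun z => φ (z + v) - φ z) (fderiv ℝ φ (x + v) - fderiv ℝ φ x) x := by
    intro x
    have h1 : HasFDerivAt (fun z => φ (z + v)) (fderiv ℝ φ (x + v)) x :=
      (hasFDerivAt_comp_add_right v).2 (hd (x + v)).hasFDerivAt
    exact h1.sub (hd x).hasFDerivAt
  have h1 := norm_sub_le_of_norm_fderiv_le (φ := fun z => φ (z + v) - φ z) (C := M * ‖v‖)
    (fun x => (hs x).differentiableAt)
    (fun x => by rw [(hs x).fderiv]; simpa using hL (x + v) x) p p'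
  have h2 := norm_sub_le_of_norm_fderiv_le hd hM (p' + v) (p' + v')
  calc _ = ‖((φ (p + v) - φ p) - (φ (p' + v) - φ p')) + (φ (p' + v) - φ (p' + v'))‖ := by
        congr 1; abel
    _ ≤ _ := norm_add_le _ _
    _ ≤ M * ‖v‖ * ‖p - p'‖ + M * ‖(p' + v) - (p' + v')‖ := add_le_add h1 h2
    _ = _ := by rw [add_sub_add_left_eq_sub]; ring

/-- A four-point estimate for first-order Taylor remainders. -/
lemma norm_taylor_four_point_le {φ : E → W} {M : ℝ} (hM0 : 0 ≤ M) (hd : Differentiable ℝ φ)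
    (hd' : Differentiable ℝ (fderiv ℝ φ))
    (hM : ∀ x, ‖fderiv ℝ (fderiv ℝ φ) x‖ ≤ M)
    (hL : ∀ x y, ‖fderiv ℝ (fderiv ℝ φ) x - fderiv ℝ (fderiv ℝ φ) y‖ ≤ M * ‖x - y‖)
    (p v p' v' : E) :
    ‖(φ (p + v) - φ p - fderiv ℝ φ p v) - (φ (p' + v') - φ p' - fderiv ℝ φ p' v')‖
      ≤ M * (‖v‖ ^ 2 * ‖p - p'‖ + (‖v‖ + ‖v'‖) * ‖v - v'‖) := by
  have hl := norm_sub_le_of_norm_fderiv_le hd' hM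
  have hs : ∀ x, HasFDerivAt (fun z => φ (z + v) - φ z - fderiv ℝ φ z v)
      (fderiv ℝ φ (x + v) - fderiv ℝ φ x - (fderiv ℝ (fderiv ℝ φ) x).flip v) x := by
    intro x
    have h1 : HasFDerivAt (fun z => φ (z + v)) (fderiv ℝ φ (x + v)) x :=
      (hasFDerivAt_comp_add_right v).2 (hd (x + v)).hasFDerivAt
    have h2 : HasFDerivAt (fun z => fderiv ℝ φ z v) ((fderiv ℝ (fderiv ℝ φ) x).flip v) x := by
      have := (hd' x).hasFDerivAt.clm_apply (hasFDerivAt_const v x)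
      simpa using this
    exact (h1.sub (hd x).hasFDerivAt).sub h2
  -- Symmetry of the second derivative turns the derivative of the Taylor remainder in the base
  -- point into the Taylor remainder of `fderiv ℝ φ`, which is quadratic in v.
  have hsym : ∀ x, (fderiv ℝ (fderiv ℝ φ) x).flip v = fderiv ℝ (fderiv ℝ φ) x v := by
    intro x
    ext w
    exact second_derivative_symmetric (𝕜 := ℝ) (f := φ) (f' := fderiv ℝ φ)
      (fun y => (hd y).hasFDerivAt) (hd' x).hasFDerivAt w v
  have h1 := norm_sub_le_of_norm_fderiv_le (φ := fun z => φ (z + v) - φ z - fderiv ℝ φ z v)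
    (C := M * ‖v‖ ^ 2) (fun x => (hs x).differentiableAt)
    (fun x => by
      rw [(hs x).fderiv, hsym]
      exact norm_taylor_one_le hd' hL hM0 x v) p p'
  have hv : ∀ w, HasFDerivAt (fun w => φ (p' + w) - φ p' - fderiv ℝ φ p' w)
      (fderiv ℝ φ (p' + w) - fderiv ℝ φ p') w := by
    intro w
    have h1 : HasFDerivAt (fun z => φ (p' + z)) (fderiv ℝ φ (p' + w)) w :=
      (hasFDerivAt_comp_add_left p').2 (hd (p' + w)).hasFDerivAt
    exact (h1.sub_const _).sub (fderiv ℝ φ p').hasFDerivAt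
  have h2 : ‖(φ (p' + v) - φ p' - fderiv ℝ φ p' v) - (φ (p' + v') - φ p' - fderiv ℝ φ p' v')‖
      ≤ M * (‖v‖ + ‖v'‖) * ‖v - v'‖ := by
    refine (convex_closedBall (0 : E) (‖v‖ + ‖v'‖)).norm_image_sub_le_of_norm_fderiv_le (𝕜 := ℝ)
      (f := fun w => φ (p' + w) - φ p' - fderiv ℝ φ p' w) (x := v') (y := v)
      (fun w _ => (hv w).differentiableAt) (fun w hw => ?_) ?_ ?_
    · rw [(hv w).fderiv]
      refine (hl _ _).trans (mul_le_mul_of_nonneg_left ?_ hM0)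
      simpa using hw
    · simp
    · simp
  calc _ = ‖((φ (p + v) - φ p - fderiv ℝ φ p v) - (φ (p' + v) - φ p' - fderiv ℝ φ p' v))
        + ((φ (p' + v) - φ p' - fderiv ℝ φ p' v) - (φ (p' + v') - φ p' - fderiv ℝ φ p' v'))‖ := by
        congr 1; abel
    _ ≤ _ := norm_add_le _ _
    _ ≤ _ := add_le_add h1 h2
    _ = _ := by ring

/-- Quantitative form of `IsCb13`, with the time regularity of the space derivatives that
follows by interpolation. -/
structure SmoothBounds (T M : ℝ) (σ : ℝ → E → W) : Prop where
  one_le : 1 ≤ M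
  diff : ∀ t ∈ Icc 0 T, Differentiable ℝ (σ t)
  diff' : ∀ t ∈ Icc 0 T, Differentiable ℝ (fderiv ℝ (σ t))
  bdd : ∀ t ∈ Icc 0 T, ∀ x, ‖σ t x‖ ≤ M
  bdd' : ∀ t ∈ Icc 0 T, ∀ x, ‖fderiv ℝ (σ t) x‖ ≤ M
  bdd'' : ∀ t ∈ Icc 0 T, ∀ x, ‖fderiv ℝ (fderiv ℝ (σ t)) x‖ ≤ M
  lip'' : ∀ t ∈ Icc 0 T, ∀ x y,
    ‖fderiv ℝ (fderiv ℝ (σ t)) x - fderiv ℝ (fderiv ℝ (σ t)) y‖ ≤ M * ‖x - y‖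
  time : ∀ t ∈ Icc 0 T, ∀ s ∈ Icc 0 T, ∀ x, ‖σ t x - σ s x‖ ≤ M * |t - s|
  time' : ∀ t ∈ Icc 0 T, ∀ s ∈ Icc 0 T, ∀ x,
    ‖fderiv ℝ (σ t) x - fderiv ℝ (σ s) x‖ ≤ M * |t - s| ^ (2 / 3 : ℝ)
  time'' : ∀ t ∈ Icc 0 T, ∀ s ∈ Icc 0 T, ∀ x,
    ‖fderiv ℝ (fderiv ℝ (σ t)) x - fderiv ℝ (fderiv ℝ (σ s)) x‖ ≤ M * |t - s| ^ (1 / 3 : ℝ)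

set_option maxSynthPendingDepth 6 in
-- Only σ itself is assumed differentiable in time. For the space derivatives, φ = σ_t - σ_s is of
-- size |t - s| and has a bounded third derivative. Interpolation then gives order |t - s|^{2/3} for
-- ∇φ and |t - s|^{1/3} for ∇²φ.
lemma IsCb13.exists_smoothBounds {T : ℝ} {σ : ℝ → E → W} (h : IsCb13 T σ) :
    ∃ M, SmoothBounds T M σ := by
  obtain ⟨N₀, h0⟩ := h.space_bdd 0 (by norm_num)
  obtain ⟨N₁, h1⟩ := h.space_bdd 1 (by norm_num)
  obtain ⟨N₂, h2⟩ := h.space_bdd 2 (by norm_num)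
  obtain ⟨N₃, h3⟩ := h.space_bdd 3 le_rfl
  obtain ⟨Nt, ht⟩ := h.time_bdd
  set N := 1 + |N₀| + |N₁| + |N₂| + |N₃| + |Nt| with hN
  have a0 := abs_nonneg N₀
  have a1 := abs_nonneg N₁
  have a2 := abs_nonneg N₂
  have a3 := abs_nonneg N₃
  have at' := abs_nonneg Nt
  have hN1 : 1 ≤ N := by linarith
  have hN0 : 0 ≤ N := by linarith
  have hd : ∀ t ∈ Icc 0 T, Differentiable ℝ (σ t) := fun t ht =>
    (h.space_diff t ht).differentiable (by norm_num)
  have hc2 : ∀ t ∈ Icc 0 T, ContDiff ℝ 2 (fderiv ℝ (σ t)) := fun t ht =>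
    (h.space_diff t ht).fderiv_right (by norm_num)
  have hd' : ∀ t ∈ Icc 0 T, Differentiable ℝ (fderiv ℝ (σ t)) := fun t ht =>
    (hc2 t ht).differentiable (by norm_num)
  have hd'' : ∀ t ∈ Icc 0 T, Differentiable ℝ (fderiv ℝ (fderiv ℝ (σ t))) := fun t ht =>
    ((hc2 t ht).fderiv_right (m := 1) (by norm_num)).differentiable (by norm_num)
  have b0 : ∀ t ∈ Icc 0 T, ∀ x, ‖σ t x‖ ≤ N := fun t ht x => by
    have := h0 t ht x
    rw [norm_iteratedFDeriv_zero] at this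
    linarith [le_abs_self N₀]
  have b1 : ∀ t ∈ Icc 0 T, ∀ x, ‖fderiv ℝ (σ t) x‖ ≤ N := fun t ht x => by
    have := h1 t ht x
    rw [← norm_iteratedFDeriv_fderiv, norm_iteratedFDeriv_zero] at this
    linarith [le_abs_self N₁]
  have b2 : ∀ t ∈ Icc 0 T, ∀ x, ‖fderiv ℝ (fderiv ℝ (σ t)) x‖ ≤ N := fun t ht x => by
    have := h2 t ht x
    rw [← norm_iteratedFDeriv_fderiv, ← norm_iteratedFDeriv_fderiv, norm_iteratedFDeriv_zero] at this
    linarith [le_abs_self N₂]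
  have b3 : ∀ t ∈ Icc 0 T, ∀ x, ‖fderiv ℝ (fderiv ℝ (fderiv ℝ (σ t))) x‖ ≤ N := fun t ht x => by
    have := h3 t ht x
    rw [← norm_iteratedFDeriv_fderiv, ← norm_iteratedFDeriv_fderiv, ← norm_iteratedFDeriv_fderiv,
      norm_iteratedFDeriv_zero] at this
    linarith [le_abs_self N₃]
  have l2 : ∀ t ∈ Icc 0 T, ∀ x y,
      ‖fderiv ℝ (fderiv ℝ (σ t)) x - fderiv ℝ (fderiv ℝ (σ t)) y‖ ≤ N * ‖x - y‖ := fun t ht x y =>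
    norm_sub_le_of_norm_fderiv_le (hd'' t ht) (b3 t ht) x y
  have tm : ∀ t ∈ Icc 0 T, ∀ s ∈ Icc 0 T, ∀ x, ‖σ t x - σ s x‖ ≤ N * |t - s| := by
    intro t ht' s hs x
    have := (convex_Icc (0 : ℝ) T).norm_image_sub_le_of_norm_derivWithin_le (𝕜 := ℝ)
      (f := fun s => σ s x) (C := N) (h.time_diff x)
      (fun r hr => (ht r hr x).trans (by linarith [le_abs_self Nt])) hs ht'
    simpa using this
  have key : ∀ t ∈ Icc 0 T, ∀ s ∈ Icc 0 T, t ≠ s → ∀ x,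
      ‖fderiv ℝ (σ t) x - fderiv ℝ (σ s) x‖ ≤ 20 * N * |t - s| ^ (2 / 3 : ℝ) ∧
      ‖fderiv ℝ (fderiv ℝ (σ t)) x - fderiv ℝ (fderiv ℝ (σ s)) x‖
        ≤ 42 * N * |t - s| ^ (1 / 3 : ℝ) := by
    intro t ht s hs hne
    have hτ : 0 < |t - s| := abs_pos.2 (sub_ne_zero.2 hne)
    -- The step k balances the two Landau terms: 4Nk³/k + 16Nk² = 20Nk² for the gradient, then 40Nk
    -- + 2Nk = 42Nk for the Hessian.
    set k := |t - s| ^ (1 / 3 : ℝ) with hk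
    have hk0 : 0 < k := Real.rpow_pos_of_pos hτ _
    have hk2 : |t - s| ^ (2 / 3 : ℝ) = k ^ 2 := by
      rw [hk, ← Real.rpow_natCast, ← Real.rpow_mul hτ.le]; norm_num
    have hk3 : |t - s| = k ^ 3 := by
      rw [hk, ← Real.rpow_natCast, ← Real.rpow_mul hτ.le]; norm_num
    let φ : E → W := fun x => σ t x - σ s x
    have e1 : fderiv ℝ φ = fun x => fderiv ℝ (σ t) x - fderiv ℝ (σ s) x := by
      funext x; exact fderiv_sub (hd t ht x) (hd s hs x)
    have e2 : fderiv ℝ (fderiv ℝ φ)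
        = fun x => fderiv ℝ (fderiv ℝ (σ t)) x - fderiv ℝ (fderiv ℝ (σ s)) x := by
      rw [e1]; funext x; exact fderiv_sub (hd' t ht x) (hd' s hs x)
    have dφ : Differentiable ℝ φ := (hd t ht).sub (hd s hs)
    have dφ' : Differentiable ℝ (fderiv ℝ φ) := by rw [e1]; exact (hd' t ht).sub (hd' s hs)
    have lφ : ∀ x y, ‖fderiv ℝ (fderiv ℝ φ) x - fderiv ℝ (fderiv ℝ φ) y‖ ≤ 2 * N * ‖x - y‖ := by
      intro x y
      rw [e2]
      calc _ = ‖(fderiv ℝ (fderiv ℝ (σ t)) x - fderiv ℝ (fderiv ℝ (σ t)) y)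
            - (fderiv ℝ (fderiv ℝ (σ s)) x - fderiv ℝ (fderiv ℝ (σ s)) y)‖ := by
            rw [sub_sub_sub_comm]
        _ ≤ _ := norm_sub_le _ _
        _ ≤ _ := add_le_add (l2 t ht x y) (l2 s hs x y)
        _ = _ := by ring
    have f1 : ∀ x, ‖fderiv ℝ φ x‖ ≤ 20 * N * k ^ 2 := by
      intro x
      have := norm_fderiv_le_landau_three (φ := φ) (a := N * k ^ 3) (K := N + N) dφ dφ'
        (fun x => (tm t ht s hs x).trans (by rw [← hk3])) (fun x => by
          rw [e1]; exact (norm_sub_le _ _).trans (add_le_add (b1 t ht x) (b1 s hs x)))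
        lφ (by positivity) hk0 x
      refine this.trans (le_of_eq ?_)
      field_simp
      ring
    have f2 : ∀ x, ‖fderiv ℝ (fderiv ℝ φ) x‖ ≤ 42 * N * k := by
      intro x
      have := norm_fderiv_le_landau dφ' f1 lφ (by positivity) hk0 x
      refine this.trans (le_of_eq ?_)
      field_simp
      ring
    intro x
    rw [e1] at f1
    rw [e2] at f2
    rw [hk2]
    exact ⟨f1 x, f2 x⟩
  refine ⟨42 * N, by linarith, hd, hd', fun t ht x => (b0 t ht x).trans (by linarith),
    fun t ht x => (b1 t ht x).trans (by linarith), fun t ht x => (b2 t ht x).trans (by linarith),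
    fun t ht x y => (l2 t ht x y).trans (by gcongr; linarith),
    fun t ht s hs x => (tm t ht s hs x).trans (by gcongr; linarith), ?_, ?_⟩
  · intro t ht s hs x
    rcases eq_or_ne t s with rfl | hne
    · simp
    · exact (key t ht s hs hne x).1.trans (by gcongr; linarith)
  · intro t ht s hs x
    rcases eq_or_ne t s with rfl | hne
    · simp
    · exact (key t ht s hs hne x).2

end Calculus

/-! ### Sewing estimates -/

section Sewing

lemma two_rpow_lt_one {a : ℝ} (ha : 1 < a) : (2 : ℝ) ^ (1 - a) < 1 :=
  Real.rpow_lt_one_of_one_lt_of_neg (by norm_num) (by linarith)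

lemma half_rpow_add {a τ : ℝ} (hτ : 0 ≤ τ) :
    (τ / 2) ^ a + (τ / 2) ^ a = 2 ^ (1 - a) * τ ^ a := by
  rw [Real.div_rpow hτ (by norm_num), Real.rpow_sub (by norm_num), Real.rpow_one]
  ring

/-- A two-index map of order `a > 1` is controlled by its increments. -/
lemma norm_le_of_delta2_le {V : Type*} [NormedAddCommGroup V] {r : ℝ → ℝ → V} {a A b Θ B : ℝ}
    (ha : 1 < a)
    (h0 : ∀ s t, A ≤ s → s ≤ t → t ≤ b → ‖r s t‖ ≤ Θ * (t - s) ^ a)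
    (hδ : ∀ s u t, A ≤ s → s ≤ u → u ≤ t → t ≤ b → ‖delta2 r s u t‖ ≤ B * (t - s) ^ a)
    {s t : ℝ} (hs : A ≤ s) (hst : s ≤ t) (ht : t ≤ b) :
    ‖r s t‖ ≤ B / (1 - 2 ^ (1 - a)) * (t - s) ^ a := by
  set θ : ℝ := 2 ^ (1 - a) with hθ
  have hθ0 : 0 < θ := Real.rpow_pos_of_pos (by norm_num) _
  have hθ1 : 0 < 1 - θ := sub_pos.2 (two_rpow_lt_one ha)
  rcases hst.eq_or_lt with rfl | hlt
  · have := h0 s s hs le_rfl ht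
    simpa [Real.zero_rpow (by linarith : a ≠ 0)] using this
  have hpos : 0 < (t - s) ^ a := Real.rpow_pos_of_pos (sub_pos.2 hlt) _
  have hB : 0 ≤ B := by
    have := (norm_nonneg _).trans (hδ s s t hs le_rfl hst ht)
    exact nonneg_of_mul_nonneg_left this hpos
  -- Each bisection multiplies the a priori constant Θ by θ < 1 and adds B. The fixed point of this
  -- recursion is B/(1 - θ), and Θ disappears in the limit.
  have iter : ∀ n : ℕ, ∀ s t, A ≤ s → s ≤ t → t ≤ b →
      ‖r s t‖ ≤ (θ ^ n * Θ + B / (1 - θ)) * (t - s) ^ a := by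
    intro n
    induction n with
    | zero =>
      intro s t hs hst ht
      refine (h0 s t hs hst ht).trans ?_
      have : 0 ≤ (t - s) ^ a := Real.rpow_nonneg (sub_nonneg.2 hst) _
      gcongr
      have : 0 ≤ B / (1 - θ) := by positivity
      simpa using this
    | succ n ih =>
      intro s t hs hst ht
      have hm1 : s ≤ (s + t) / 2 := by linarith
      have hm2 : (s + t) / 2 ≤ t := by linarith
      have e1 : (s + t) / 2 - s = (t - s) / 2 := by ring
      have e2 : t - (s + t) / 2 = (t - s) / 2 := by ring
      have i1 := ih s _ hs hm1 (hm2.trans ht)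
      have i2 := ih _ t (hs.trans hm1) hm2 ht
      have i3 := hδ s _ t hs hm1 hm2 ht
      rw [e1] at i1
      rw [e2] at i2
      calc ‖r s t‖ = ‖delta2 r s ((s + t) / 2) t + r s ((s + t) / 2) + r ((s + t) / 2) t‖ := by
            congr 1; simp only [delta2]; abel
        _ ≤ _ := norm_add₃_le
        _ ≤ B * (t - s) ^ a + (θ ^ n * Θ + B / (1 - θ)) * ((t - s) / 2) ^ a
            + (θ ^ n * Θ + B / (1 - θ)) * ((t - s) / 2) ^ a := by gcongr
        _ = (B + (θ ^ n * Θ + B / (1 - θ)) * θ) * (t - s) ^ a := by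
            rw [add_assoc, ← mul_add, half_rpow_add (sub_nonneg.2 hst)]; ring
        _ = _ := by
            congr 1
            field_simp
            ring
  have hlim : Tendsto (fun n : ℕ => (θ ^ n * Θ + B / (1 - θ)) * (t - s) ^ a) atTop
      (𝓝 ((0 * Θ + B / (1 - θ)) * (t - s) ^ a)) :=
    (((tendsto_pow_atTop_nhds_zero_of_lt_one hθ0.le (by linarith)).mul_const _).add_const _).mul_const _
  rw [zero_mul, zero_add] at hlim
  exact ge_of_tendsto' hlim fun n => iter n s t hs hst ht

/-- Discrete sewing estimate: the bound on the increments may use the bound to be proved on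
the first subinterval. -/
lemma discrete_sewing {ω : ℕ → ℕ → ℝ} {a h Γ B : ℝ} {N : ℕ} (ha : 1 < a) (hh : 0 ≤ h)
    (hΓ0 : 0 ≤ Γ) (hΓ : 2 * B ≤ (1 - 2 ^ (1 - a)) * Γ)
    (h0 : ∀ i, i ≤ N → ω i i ≤ 0) (h1 : ∀ i, i < N → ω i (i + 1) ≤ 0)
    (step : ∀ i j k, i ≤ j → j ≤ k → k ≤ N → ω i j ≤ Γ * (((j - i : ℕ) : ℝ) * h) ^ a →
      ω i k ≤ ω i j + ω j k + B * (((k - i : ℕ) : ℝ) * h) ^ a) :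
    ∀ i k, i ≤ k → k ≤ N → ω i k ≤ Γ * (((k - i : ℕ) : ℝ) * h) ^ a := by
  have main : ∀ n i k : ℕ, k = i + n → k ≤ N → ω i k ≤ Γ * ((n : ℝ) * h) ^ a := by
    intro n
    induction n using Nat.strong_induction_on with
    | _ n ih =>
      intro i k hk hkN
      have hnn : 0 ≤ Γ * ((n : ℝ) * h) ^ a := by positivity
      rcases Nat.lt_or_ge n 2 with hn | hn
      · refine le_trans ?_ hnn
        interval_cases n
        · subst hk; exact h0 _ hkN
        · subst hk; exact h1 _ (by omega)
      -- The n steps are cut as p + 1 + q with p, q ≤ n/2. The middle single step has no defect, the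
      -- two cuts cost 2B, and the two halves give 2^{1-a}Γ. This is the origin of the condition
      -- `hΓ`.
      · set p := (n - 1) / 2 with hp
        set q := n - 1 - p with hq
        have hB : B ≤ Γ := by
          have : 0 < (2 : ℝ) ^ (1 - a) := Real.rpow_pos_of_pos (by norm_num) _
          nlinarith
        have p1 : (p : ℝ) ≤ n / 2 := by
          rw [le_div_iff₀ (by norm_num)]; exact_mod_cast (by omega : p * 2 ≤ n)
        have q1 : (q : ℝ) ≤ n / 2 := by
          rw [le_div_iff₀ (by norm_num)]; exact_mod_cast (by omega : q * 2 ≤ n)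
        have mono : ∀ {c : ℝ}, 0 ≤ c → c ≤ n / 2 → Γ * (c * h) ^ a ≤ Γ * ((n : ℝ) * h / 2) ^ a := by
          intro c hc hcn
          refine mul_le_mul_of_nonneg_left (Real.rpow_le_rpow (by positivity) ?_ (by linarith)) hΓ0
          calc c * h ≤ n / 2 * h := by gcongr
            _ = _ := by ring
        have r1 : ω i (i + p) ≤ Γ * ((p : ℝ) * h) ^ a := ih p (by omega) i (i + p) rfl (by omega)
        have r2 : ω (i + p + 1) k ≤ Γ * ((q : ℝ) * h) ^ a :=
          ih q (by omega) (i + p + 1) k (by omega) hkN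
        have r3 : ω (i + p) (i + p + 1) ≤ 0 := h1 _ (by omega)
        have s1 := step i (i + p) k (by omega) (by omega) hkN
          (by rw [Nat.add_sub_cancel_left]; exact r1)
        have s2 := step (i + p) (i + p + 1) k (by omega) (by omega) hkN
          (r3.trans (by positivity))
        have hki : k - i = n := by omega
        rw [hki] at s1
        have hB' : B * (((k - (i + p) : ℕ) : ℝ) * h) ^ a ≤ |B| * ((n : ℝ) * h) ^ a := by
          refine mul_le_mul (le_abs_self B) (Real.rpow_le_rpow (by positivity) ?_ (by linarith))
            (by positivity) (abs_nonneg _)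
          gcongr
          omega
        -- No sign of B is assumed. If B ≤ 0 the error terms are dropped and 2^{1-a}Γ ≤ Γ suffices.
        have hcases : |B| = B ∨ B ≤ 0 := by
          rcases le_total 0 B with h | h
          · exact Or.inl (abs_of_nonneg h)
          · exact Or.inr h
        have hX : 0 ≤ ((n : ℝ) * h) ^ a := by positivity
        have hhalf := half_rpow_add (a := a) (τ := (n : ℝ) * h) (by positivity)
        have m1 := mono (Nat.cast_nonneg p) p1
        have m2 := mono (Nat.cast_nonneg q) q1
        have tot : Γ * ((n : ℝ) * h / 2) ^ a + Γ * ((n : ℝ) * h / 2) ^ a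
            = 2 ^ (1 - a) * Γ * ((n : ℝ) * h) ^ a := by
          rw [← mul_add, hhalf]; ring
        rcases hcases with hc | hc
        · rw [hc] at hB'
          nlinarith
        · have hBneg : B * (((k - (i + p) : ℕ) : ℝ) * h) ^ a ≤ 0 :=
            mul_nonpos_of_nonpos_of_nonneg hc (by positivity)
          have hBneg' : B * ((n : ℝ) * h) ^ a ≤ 0 := mul_nonpos_of_nonpos_of_nonneg hc hX
          have hθ := two_rpow_lt_one ha
          have : 2 ^ (1 - a) * Γ * ((n : ℝ) * h) ^ a ≤ Γ * ((n : ℝ) * h) ^ a := by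
            have : 2 ^ (1 - a) * Γ ≤ Γ := by nlinarith
            gcongr
          linarith
  intro i k hik hk
  exact main (k - i) i k (by omega) hk

end Sewing

/-! ### Classes of time-dependent coefficients -/

section Coefficients

/-- The constant that compares different powers of numbers in `[0, T]`. -/
noncomputable def powConst (T : ℝ) : ℝ := (1 + |T|) ^ 2

lemma one_le_powConst (T : ℝ) : 1 ≤ powConst T := by
  have := abs_nonneg T
  rw [powConst]
  nlinarith

/-- The restriction p ≤ q + 2 lets the single constant (1 + |T|)² serve all pairs of exponents. -/
lemma rpow_le_powConst_mul {T τ p q : ℝ} (hτ : 0 ≤ τ) (hT : τ ≤ T) (hq : 0 ≤ q) (hqp : q ≤ p)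
    (hpq : p ≤ q + 2) : τ ^ p ≤ powConst T * τ ^ q := by
  have e : τ ^ p = τ ^ (p - q) * τ ^ q := by
    rw [← Real.rpow_add_of_nonneg hτ (by linarith) hq]; congr 1; ring
  rw [e, powConst]
  refine mul_le_mul_of_nonneg_right ?_ (Real.rpow_nonneg hτ _)
  calc τ ^ (p - q) ≤ (1 + |T|) ^ (p - q) :=
        Real.rpow_le_rpow hτ (by linarith [le_abs_self T]) (by linarith)
    _ ≤ (1 + |T|) ^ (2 : ℝ) :=
        Real.rpow_le_rpow_of_exponent_le (by linarith [abs_nonneg T]) (by linarith)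
    _ = _ := Real.rpow_two _

lemma le_powConst_mul_rpow {T τ q : ℝ} (hτ : 0 ≤ τ) (hT : τ ≤ T) (hq : 0 ≤ q) (hq1 : q ≤ 1) :
    τ ≤ powConst T * τ ^ q := by
  simpa using rpow_le_powConst_mul (p := 1) hτ hT hq hq1 (by linarith)

variable {E W X Y D : Type*} [NormedAddCommGroup E] [NormedSpace ℝ E] [NormedAddCommGroup W]
  [NormedSpace ℝ W] [NormedAddCommGroup X] [NormedSpace ℝ X] [NormedAddCommGroup Y]
  [NormedSpace ℝ Y] [NormedAddCommGroup D] [NormedSpace ℝ D]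

/-- Bounded coefficients that are Lipschitz in space in the sense of four-point estimates and
Hölder in time. -/
structure LipBounds (T M : ℝ) (g : ℝ → E → W) : Prop where
  nonneg : 0 ≤ M
  bdd : ∀ t ∈ Icc 0 T, ∀ x, ‖g t x‖ ≤ M
  lip : ∀ t ∈ Icc 0 T, ∀ x y, ‖g t x - g t y‖ ≤ M * ‖x - y‖
  time : ∀ t ∈ Icc 0 T, ∀ s ∈ Icc 0 T, ∀ x, ‖g t x - g s x‖ ≤ M * |t - s| ^ (2 / 3 : ℝ)
  four : ∀ t ∈ Icc 0 T, ∀ p q p' q', ‖(g t q - g t p) - (g t q' - g t p')‖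
    ≤ M * ((‖q - p‖ + ‖q' - p'‖) * ‖p - p'‖ + ‖(q - p) - (q' - p')‖)
  time_lip : ∀ t ∈ Icc 0 T, ∀ s ∈ Icc 0 T, ∀ x y, ‖(g t x - g s x) - (g t y - g s y)‖
    ≤ M * |t - s| ^ (1 / 3 : ℝ) * ‖x - y‖

lemma abs_sub_mem {T t s : ℝ} (ht : t ∈ Icc 0 T) (hs : s ∈ Icc 0 T) : |t - s| ≤ T :=
  abs_le.2 ⟨by linarith [ht.1, hs.2], by linarith [ht.2, hs.1]⟩

/-- The field `four` comes from the Lipschitz gradient, and `time_lip` from the mean value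
inequality for σ_t - σ_s. Here the available exponents 1 and 2/3 are lowered to 2/3 and 1/3. -/
lemma SmoothBounds.lipBounds {T M : ℝ} {σ : ℝ → E → W} (h : SmoothBounds T M σ) :
    LipBounds T (M * powConst T) σ := by
  have hM := h.one_le
  have hN := one_le_powConst T
  have hMN : M ≤ M * powConst T := le_mul_of_one_le_right (by linarith) hN
  have hl : ∀ t ∈ Icc 0 T, ∀ x y, ‖σ t x - σ t y‖ ≤ M * ‖x - y‖ := fun t ht =>
    norm_sub_le_of_norm_fderiv_le (h.diff t ht) (h.bdd' t ht)
  have hl' : ∀ t ∈ Icc 0 T, ∀ x y, ‖fderiv ℝ (σ t) x - fderiv ℝ (σ t) y‖ ≤ M * ‖x - y‖ :=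
    fun t ht => norm_sub_le_of_norm_fderiv_le (h.diff' t ht) (h.bdd'' t ht)
  refine ⟨by positivity, fun t ht x => (h.bdd t ht x).trans hMN,
    fun t ht x y => (hl t ht x y).trans (by gcongr), fun t ht s hs x => ?_,
    fun t ht p q p' q' => ?_, fun t ht s hs x y => ?_⟩
  · refine (h.time t ht s hs x).trans ?_
    rw [mul_assoc]
    exact mul_le_mul_of_nonneg_left
      (le_powConst_mul_rpow (abs_nonneg _) (abs_sub_mem ht hs) (by norm_num) (by norm_num))
      (by linarith)
  · have := norm_four_point_le (h.diff t ht) (h.bdd' t ht) (hl' t ht) p (q - p) p' (q' - p')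
    simp only [add_sub_cancel] at this
    refine this.trans ?_
    gcongr
    linarith [norm_nonneg (q' - p')]
  · refine (norm_sub_le_of_norm_fderiv_le (φ := fun x => σ t x - σ s x)
      (C := M * |t - s| ^ (2 / 3 : ℝ)) ((h.diff t ht).sub (h.diff s hs)) (fun x => ?_) x y).trans ?_
    · rw [fderiv_fun_sub (h.diff t ht x) (h.diff s hs x)]
      exact h.time' t ht s hs x
    · rw [mul_assoc M (powConst T)]
      gcongr
      exact rpow_le_powConst_mul (abs_nonneg _) (abs_sub_mem ht hs) (by norm_num) (by norm_num)
        (by norm_num)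

/-- For the gradient the exponents 2/3 and 1/3 are those supplied by the interpolation, and the
four-point bound uses the Lipschitz Hessian. -/
lemma SmoothBounds.lipBounds_fderiv {T M : ℝ} {σ : ℝ → E → W} (h : SmoothBounds T M σ) :
    LipBounds T (M * powConst T) (fun t => fderiv ℝ (σ t)) := by
  have hM := h.one_le
  have hN := one_le_powConst T
  have hMN : M ≤ M * powConst T := le_mul_of_one_le_right (by linarith) hN
  have hl' : ∀ t ∈ Icc 0 T, ∀ x y, ‖fderiv ℝ (σ t) x - fderiv ℝ (σ t) y‖ ≤ M * ‖x - y‖ :=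
    fun t ht => norm_sub_le_of_norm_fderiv_le (h.diff' t ht) (h.bdd'' t ht)
  refine ⟨by positivity, fun t ht x => (h.bdd' t ht x).trans hMN,
    fun t ht x y => (hl' t ht x y).trans (by gcongr),
    fun t ht s hs x => (h.time' t ht s hs x).trans (by gcongr),
    fun t ht p q p' q' => ?_, fun t ht s hs x y => ?_⟩
  · have := norm_four_point_le (h.diff' t ht) (h.bdd'' t ht) (h.lip'' t ht) p (q - p) p' (q' - p')
    simp only [add_sub_cancel] at this
    refine this.trans ?_
    gcongr
    linarith [norm_nonneg (q' - p')]
  · refine (norm_sub_le_of_norm_fderiv_le (φ := fun x => fderiv ℝ (σ t) x - fderiv ℝ (σ s) x)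
      (C := M * |t - s| ^ (1 / 3 : ℝ)) ((h.diff' t ht).sub (h.diff' s hs)) (fun x => ?_) x y).trans ?_
    · rw [fderiv_fun_sub (h.diff' t ht x) (h.diff' s hs x)]
      exact h.time'' t ht s hs x
    · gcongr

lemma norm_comp_le_of_le {a : X →L[ℝ] Y} {b : D →L[ℝ] X} {A B : ℝ} (ha : ‖a‖ ≤ A) (hb : ‖b‖ ≤ B) :
    ‖a.comp b‖ ≤ A * B :=
  (a.opNorm_comp_le b).trans
    (mul_le_mul ha hb (norm_nonneg _) ((norm_nonneg _).trans ha))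

/-- The class is closed under products, which brings ∇σ σ into it without differentiating this
product. -/
lemma LipBounds.comp {T M : ℝ} {a : ℝ → E → X →L[ℝ] Y} {b : ℝ → E → D →L[ℝ] X}
    (ha : LipBounds T M a) (hb : LipBounds T M b) :
    LipBounds T (8 * powConst T * M ^ 2) (fun t x => (a t x).comp (b t x)) := by
  have hM := ha.nonneg
  have hN := one_le_powConst T
  have hM2 : 0 ≤ M ^ 2 := by positivity
  have hle : ∀ k : ℝ, k ≤ 8 → k * M ^ 2 ≤ 8 * powConst T * M ^ 2 := fun k hk => by
    gcongr; linarith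
  refine ⟨by positivity, fun t ht x => ?_, fun t ht x y => ?_, fun t ht s hs x => ?_,
    fun t ht p q p' q' => ?_, fun t ht s hs x y => ?_⟩
  · calc _ ≤ M * M := norm_comp_le_of_le (ha.bdd t ht x) (hb.bdd t ht x)
      _ = 1 * M ^ 2 := by ring
      _ ≤ _ := hle 1 (by norm_num)
  · calc ‖(a t x).comp (b t x) - (a t y).comp (b t y)‖
        = ‖(a t x - a t y).comp (b t x) + (a t y).comp (b t x - b t y)‖ := by
          congr 1; ext v; simp
      _ ≤ _ := norm_add_le _ _
      _ ≤ (M * ‖x - y‖) * M + M * (M * ‖x - y‖) :=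
          add_le_add (norm_comp_le_of_le (ha.lip t ht x y) (hb.bdd t ht x))
            (norm_comp_le_of_le (ha.bdd t ht y) (hb.lip t ht x y))
      _ = (2 * M ^ 2) * ‖x - y‖ := by ring
      _ ≤ _ := mul_le_mul_of_nonneg_right (hle 2 (by norm_num)) (norm_nonneg _)
  · calc ‖(a t x).comp (b t x) - (a s x).comp (b s x)‖
        = ‖(a t x - a s x).comp (b t x) + (a s x).comp (b t x - b s x)‖ := by
          congr 1; ext v; simp
      _ ≤ _ := norm_add_le _ _
      _ ≤ (M * |t - s| ^ (2 / 3 : ℝ)) * M + M * (M * |t - s| ^ (2 / 3 : ℝ)) :=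
          add_le_add (norm_comp_le_of_le (ha.time t ht s hs x) (hb.bdd t ht x))
            (norm_comp_le_of_le (ha.bdd s hs x) (hb.time t ht s hs x))
      _ = (2 * M ^ 2) * |t - s| ^ (2 / 3 : ℝ) := by ring
      _ ≤ _ := mul_le_mul_of_nonneg_right (hle 2 (by norm_num)) (by positivity)
  · set R := (‖q - p‖ + ‖q' - p'‖) * ‖p - p'‖ + ‖(q - p) - (q' - p')‖ with hR
    -- Leibniz rule for second differences: each term contains a four-point difference of one
    -- factor, or two first differences of which one is controlled by ‖p - p'‖.
    have e : ((a t q).comp (b t q) - (a t p).comp (b t p))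
          - ((a t q').comp (b t q') - (a t p').comp (b t p'))
        = ((a t q - a t p) - (a t q' - a t p')).comp (b t q)
          + ((a t q' - a t p').comp ((b t q - b t p) - (b t q' - b t p'))
            + (a t q' - a t p').comp (b t p - b t p'))
          + (a t p - a t p').comp (b t q - b t p)
          + (a t p').comp ((b t q - b t p) - (b t q' - b t p')) := by
      ext v; simp; abel
    have h2 : ‖a t q' - a t p'‖ ≤ M + M :=
      (norm_sub_le _ _).trans (add_le_add (ha.bdd t ht _) (ha.bdd t ht _))
    have f1 := norm_comp_le_of_le (ha.four t ht p q p' q') (hb.bdd t ht q)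
    have f2 := norm_comp_le_of_le h2 (hb.four t ht p q p' q')
    have f3 := norm_comp_le_of_le (ha.lip t ht q' p') (hb.lip t ht p p')
    have f4 := norm_comp_le_of_le (ha.lip t ht p p') (hb.lip t ht q p)
    have f5 := norm_comp_le_of_le (ha.bdd t ht p') (hb.four t ht p q p' q')
    rw [← hR] at f1 f2 f5
    rw [e]
    have hR' : (‖q - p‖ + ‖q' - p'‖) * ‖p - p'‖ ≤ R := by
      rw [hR]; linarith [norm_nonneg ((q - p) - (q' - p'))]
    have hR0 : 0 ≤ R := (by positivity : (0 : ℝ) ≤ _).trans hR'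
    have hsplit : M * M * ((‖q - p‖ + ‖q' - p'‖) * ‖p - p'‖) ≤ M * M * R := by gcongr
    refine (norm_add_le _ _).trans ?_
    refine (add_le_add ((norm_add_le _ _).trans (add_le_add ((norm_add_le _ _).trans
      (add_le_add f1 ((norm_add_le _ _).trans (add_le_add f2 f3)))) f4)) f5).trans ?_
    have : 8 * powConst T * M ^ 2 * R ≥ 8 * (M ^ 2 * R) := by
      have : 0 ≤ M ^ 2 * R := by positivity
      nlinarith
    nlinarith
  · have e : ((a t x).comp (b t x) - (a s x).comp (b s x))
          - ((a t y).comp (b t y) - (a s y).comp (b s y))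
        = ((a t x - a s x) - (a t y - a s y)).comp (b t x)
          + (a t y - a s y).comp (b t x - b t y)
          + (a s x - a s y).comp (b t x - b s x)
          + (a s y).comp ((b t x - b s x) - (b t y - b s y)) := by
      ext v; simp; abel
    have hp : |t - s| ^ (2 / 3 : ℝ) ≤ powConst T * |t - s| ^ (1 / 3 : ℝ) :=
      rpow_le_powConst_mul (abs_nonneg _) (abs_sub_mem ht hs) (by norm_num) (by norm_num)
        (by norm_num)
    have hq : 0 ≤ |t - s| ^ (1 / 3 : ℝ) := by positivity
    have f1 := norm_comp_le_of_le (ha.time_lip t ht s hs x y) (hb.bdd t ht x)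
    have f2 := norm_comp_le_of_le ((ha.time t ht s hs y).trans (mul_le_mul_of_nonneg_left hp hM))
      (hb.lip t ht x y)
    have f3 := norm_comp_le_of_le (ha.lip s hs x y)
      ((hb.time t ht s hs x).trans (mul_le_mul_of_nonneg_left hp hM))
    have f4 := norm_comp_le_of_le (ha.bdd s hs y) (hb.time_lip t ht s hs x y)
    rw [e]
    refine (norm_add_le _ _).trans ((add_le_add ((norm_add_le _ _).trans (add_le_add
      ((norm_add_le _ _).trans (add_le_add f1 f2)) f3)) f4).trans ?_)
    have : M ^ 2 * |t - s| ^ (1 / 3 : ℝ) * ‖x - y‖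
        ≤ powConst T * (M ^ 2 * |t - s| ^ (1 / 3 : ℝ) * ‖x - y‖) :=
      le_mul_of_one_le_left (by positivity) hN
    have h0 : 0 ≤ powConst T * (M ^ 2 * |t - s| ^ (1 / 3 : ℝ) * ‖x - y‖) := by positivity
    nlinarith

end Coefficients

/-! ### Rough path bounds -/

section RoughBounds

variable {d : ℕ}

/-- Quantitative bounds on the driving rough path, with Hölder exponent `κ`. -/
structure RoughBounds (T κ c : ℝ) (ζ : ℝ → Vec d) (Z : ℝ → ℝ → Matrix (Fin d) (Fin d) ℝ) :
    Prop where
  one_le : 1 ≤ c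
  lt_exp : 1 / 3 < κ
  exp_le : κ ≤ 1 / 2
  path : ∀ s t, 0 ≤ s → s ≤ t → t ≤ T → ‖delta1 ζ s t‖ ≤ c * (t - s) ^ κ
  area : ∀ s t, 0 ≤ s → s ≤ t → t ≤ T → ∑ i, ∑ j, |Z s t i j| ≤ c * ((t - s) ^ κ) ^ 2
  chen : ∀ (i j : Fin d) (s u t : ℝ), 0 ≤ s → s ≤ u → u ≤ t → t ≤ T →
    Z s t i j = Z s u i j + Z u t i j + delta1 ζ s u i * delta1 ζ u t j

variable {V : Type*} [NormedAddCommGroup V] [NormedSpace ℝ V]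

lemma norm_contract_le (A : Vec d →L[ℝ] Vec d →L[ℝ] V) (Z : Matrix (Fin d) (Fin d) ℝ) :
    ‖contract A Z‖ ≤ ‖A‖ * ∑ i, ∑ j, |Z i j| := by
  rw [contract, Finset.mul_sum]
  refine (norm_sum_le _ _).trans (Finset.sum_le_sum fun i _ => ?_)
  rw [Finset.mul_sum]
  refine (norm_sum_le _ _).trans (Finset.sum_le_sum fun j _ => ?_)
  rw [norm_smul, mul_comm, Real.norm_eq_abs]
  refine mul_le_mul_of_nonneg_right ?_ (abs_nonneg _)
  have := A.le_opNorm₂ (EuclideanSpace.single i (1 : ℝ)) (EuclideanSpace.single j (1 : ℝ))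
  simpa using this

lemma contract_sub (A B : Vec d →L[ℝ] Vec d →L[ℝ] V) (Z : Matrix (Fin d) (Fin d) ℝ) :
    contract (A - B) Z = contract A Z - contract B Z := by
  simp [contract, smul_sub, Finset.sum_sub_distrib]

lemma apply_apply_eq_sum (A : Vec d →L[ℝ] Vec d →L[ℝ] V) (x y : Vec d) :
    A x y = ∑ i, ∑ j, (x i * y j) •
      A (EuclideanSpace.single i (1 : ℝ)) (EuclideanSpace.single j (1 : ℝ)) := by
  have hx : ∀ x : Vec d, x = ∑ i, x i • EuclideanSpace.single i (1 : ℝ) := by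
    intro x
    simpa using ((EuclideanSpace.basisFun (Fin d) ℝ).sum_repr x).symm
  conv_lhs => rw [hx x, hx y]
  simp only [map_sum, map_smul, sum_apply, smul_apply,
    Finset.smul_sum, smul_smul]
  rw [Finset.sum_comm]
  refine Finset.sum_congr rfl fun i _ => Finset.sum_congr rfl fun j _ => ?_
  first | rfl | rw [mul_comm]

lemma RoughBounds.contract_chen {T κ c : ℝ} {ζ : ℝ → Vec d} {Z : ℝ → ℝ → Matrix (Fin d) (Fin d) ℝ}
    (h : RoughBounds T κ c ζ Z) (A : Vec d →L[ℝ] Vec d →L[ℝ] V) {s u t : ℝ} (hs : 0 ≤ s)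
    (hsu : s ≤ u) (hut : u ≤ t) (ht : t ≤ T) :
    contract A (Z s t) = contract A (Z s u) + contract A (Z u t)
      + A (delta1 ζ s u) (delta1 ζ u t) := by
  rw [apply_apply_eq_sum A]
  simp only [contract, ← Finset.sum_add_distrib, ← add_smul]
  refine Finset.sum_congr rfl fun i _ => Finset.sum_congr rfl fun j _ => ?_
  rw [h.chen i j s u t hs hsu hut ht]

lemma RoughBounds.norm_contract_le {T κ c : ℝ} {ζ : ℝ → Vec d}
    {Z : ℝ → ℝ → Matrix (Fin d) (Fin d) ℝ}
    (h : RoughBounds T κ c ζ Z) (A : Vec d →L[ℝ] Vec d →L[ℝ] V) {s t : ℝ} (hs : 0 ≤ s)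
    (hst : s ≤ t) (ht : t ≤ T) : ‖contract A (Z s t)‖ ≤ ‖A‖ * (c * ((t - s) ^ κ) ^ 2) :=
  (RoughControl.norm_contract_le A _).trans
    (mul_le_mul_of_nonneg_left (h.area s t hs hst ht) A.opNorm_nonneg)

/-- On a bounded interval, lowering the exponent from α to κ costs only a power of |T|. -/
lemma IsGeometricRoughPath.exists_roughBounds {T α κ : ℝ} {ζ : ℝ → Vec d}
    {Z : ℝ → ℝ → Matrix (Fin d) (Fin d) ℝ} (h : IsGeometricRoughPath T α ζ Z) (hκ : 1 / 3 < κ)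
    (hκα : κ < α) (hκ2 : κ ≤ 1 / 2) : ∃ c, RoughBounds T κ c ζ Z := by
  have comp : ∀ (C p q τ : ℝ), 0 ≤ τ → τ ≤ T → 0 ≤ q → q ≤ p →
      C * τ ^ p ≤ |C| * |T| ^ (p - q) * τ ^ q := by
    intro C p q τ hτ hT hq hqp
    have e : τ ^ p = τ ^ (p - q) * τ ^ q := by
      rw [← Real.rpow_add_of_nonneg hτ (by linarith) hq]; congr 1; ring
    rw [e, ← mul_assoc]
    refine mul_le_mul_of_nonneg_right ?_ (Real.rpow_nonneg hτ _)
    exact mul_le_mul (le_abs_self C) (Real.rpow_le_rpow hτ (hT.trans (le_abs_self T)) (by linarith))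
      (Real.rpow_nonneg hτ _) (abs_nonneg _)
  obtain ⟨C, hC⟩ := h.holder
  choose D hD using h.area_holder
  set c₁ := |C| * |T| ^ (α - κ) with hc₁
  set c₂ := ∑ i, ∑ j, |D i j| * |T| ^ (2 * α - 2 * κ) with hc₂
  have h1 : 0 ≤ c₁ := by positivity
  have h2 : 0 ≤ c₂ := by positivity
  refine ⟨1 + c₁ + c₂, by linarith, hκ, hκ2, fun s t hs hst ht => ?_, fun s t hs hst ht => ?_,
    fun i j s u t hs hsu hut ht => ?_⟩
  · have hτ : 0 ≤ t - s := sub_nonneg.2 hst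
    refine (hC s t hs hst ht).trans ((comp C α κ (t - s) hτ (by linarith) (by linarith) hκα.le).trans ?_)
    gcongr
    linarith
  · have hτ : 0 ≤ t - s := sub_nonneg.2 hst
    have e : ((t - s) ^ κ) ^ 2 = (t - s) ^ (2 * κ) := by
      rw [← Real.rpow_natCast, ← Real.rpow_mul hτ]; congr 1; push_cast; ring
    rw [e]
    calc ∑ i, ∑ j, |Z s t i j| ≤ ∑ i, ∑ j, |D i j| * |T| ^ (2 * α - 2 * κ) * (t - s) ^ (2 * κ) := by
          refine Finset.sum_le_sum fun i _ => Finset.sum_le_sum fun j _ => ?_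
          exact (hD i j s t hs hst ht).trans
            (comp (D i j) (2 * α) (2 * κ) (t - s) hτ (by linarith) (by linarith) (by linarith))
      _ = c₂ * (t - s) ^ (2 * κ) := by simp only [hc₂, Finset.sum_mul]
      _ ≤ _ := by gcongr; linarith
  · have := h.chen i j s u t hs hsu hut ht
    rw [delta2] at this
    linarith

end RoughBounds

/-! ### Local expansions of the equation -/

section Germ

variable {m d : ℕ}

/-- The derivative `∇σ σ` of the rough integrand. -/
noncomputable def gub (σ : ℝ → Vec m → Vec d →L[ℝ] Vec m) (s : ℝ) (p : Vec m) :
    Vec d →L[ℝ] Vec d →L[ℝ] Vec m :=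
  (fderiv ℝ (σ s) p).comp (σ s p)

/-- The rough part of the local expansion. -/
noncomputable def roughGerm (ζ : ℝ → Vec d) (Z : ℝ → ℝ → Matrix (Fin d) (Fin d) ℝ)
    (σ : ℝ → Vec m → Vec d →L[ℝ] Vec m) (s t : ℝ) (p : Vec m) : Vec m :=
  σ s p (delta1 ζ s t) + contract (gub σ s p) (Z s t)

/-- The local expansion of the equation at the point `p`, with frozen drift. -/
noncomputable def germ (f : ℝ → Vec m → Vec m) (ζ : ℝ → Vec d)
    (Z : ℝ → ℝ → Matrix (Fin d) (Fin d) ℝ)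
    (σ : ℝ → Vec m → Vec d →L[ℝ] Vec m) (s t : ℝ) (p : Vec m) : Vec m :=
  (∫ u in s..t, f u p) + roughGerm ζ Z σ s t p

/-- Solutions in the sense of Davie. -/
def IsDavie (T κ Γ : ℝ) (f : ℝ → Vec m → Vec m) (ζ : ℝ → Vec d)
    (Z : ℝ → ℝ → Matrix (Fin d) (Fin d) ℝ) (σ : ℝ → Vec m → Vec d →L[ℝ] Vec m)
    (x : ℝ → Vec m) : Prop :=
  ∀ s t, 0 ≤ s → s ≤ t → t ≤ T →
    ‖x t - x s - germ f ζ Z σ s t (x s)‖ ≤ Γ * ((t - s) ^ κ) ^ 3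

/-- Bounded continuous Lipschitz drifts. -/
structure DriftBounds (T M : ℝ) (f : ℝ → Vec m → Vec m) : Prop where
  cont : ∀ p, ContinuousOn (fun u => f u p) (Icc 0 T)
  bdd : ∀ u ∈ Icc 0 T, ∀ p, ‖f u p‖ ≤ M
  lip : ∀ u ∈ Icc 0 T, ∀ p q, ‖f u p - f u q‖ ≤ M * ‖p - q‖

/-- All bounds on the rough path and the diffusion coefficient, with a single constant. -/
structure RoughData (T κ M : ℝ) (ζ : ℝ → Vec d) (Z : ℝ → ℝ → Matrix (Fin d) (Fin d) ℝ)
    (σ : ℝ → Vec m → Vec d →L[ℝ] Vec m) : Prop where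
  pow : powConst T ≤ M
  rough : RoughBounds T κ M ζ Z
  smooth : SmoothBounds T M σ
  sig : LipBounds T M σ
  gub : LipBounds T M (gub σ)

lemma RoughBounds.mono {T κ c c' : ℝ} {ζ : ℝ → Vec d} {Z : ℝ → ℝ → Matrix (Fin d) (Fin d) ℝ}
    (h : RoughBounds T κ c ζ Z) (hc : c ≤ c') : RoughBounds T κ c' ζ Z where
  one_le := h.one_le.trans hc
  lt_exp := h.lt_exp
  exp_le := h.exp_le
  path s t hs hst ht := (h.path s t hs hst ht).trans (mul_le_mul_of_nonneg_right hc
    (Real.rpow_nonneg (sub_nonneg.2 hst) _))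
  area s t hs hst ht := (h.area s t hs hst ht).trans (mul_le_mul_of_nonneg_right hc (sq_nonneg _))
  chen := h.chen

lemma SmoothBounds.mono {E W : Type*} [NormedAddCommGroup E] [NormedSpace ℝ E]
    [NormedAddCommGroup W] [NormedSpace ℝ W] {T c c' : ℝ} {σ : ℝ → E → W}
    (h : SmoothBounds T c σ) (hc : c ≤ c') : SmoothBounds T c' σ where
  one_le := h.one_le.trans hc
  diff := h.diff
  diff' := h.diff'
  bdd t ht x := (h.bdd t ht x).trans hc
  bdd' t ht x := (h.bdd' t ht x).trans hc
  bdd'' t ht x := (h.bdd'' t ht x).trans hc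
  lip'' t ht x y := (h.lip'' t ht x y).trans (by gcongr)
  time t ht s hs x := (h.time t ht s hs x).trans (by gcongr)
  time' t ht s hs x := (h.time' t ht s hs x).trans (by gcongr)
  time'' t ht s hs x := (h.time'' t ht s hs x).trans (by gcongr)

lemma LipBounds.mono {E W : Type*} [NormedAddCommGroup E] [NormedAddCommGroup W]
    [NormedSpace ℝ W] {T c c' : ℝ} {σ : ℝ → E → W}
    (h : LipBounds T c σ) (hc : c ≤ c') : LipBounds T c' σ where
  nonneg := h.nonneg.trans hc
  bdd t ht x := (h.bdd t ht x).trans hc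
  lip t ht x y := (h.lip t ht x y).trans (by gcongr)
  time t ht s hs x := (h.time t ht s hs x).trans (by gcongr)
  four t ht p q p' q' := (h.four t ht p q p' q').trans (by gcongr)
  time_lip t ht s hs x y := (h.time_lip t ht s hs x y).trans (by gcongr)

lemma LipBounds.norm_sub_le {E W : Type*} [NormedAddCommGroup E] [NormedAddCommGroup W]
    [NormedSpace ℝ W] {T M : ℝ} {g : ℝ → E → W} (h : LipBounds T M g) {u s : ℝ}
    (hu : u ∈ Icc 0 T) (hs : s ∈ Icc 0 T) (q p : E) :
    ‖g u q - g s p‖ ≤ M * |u - s| ^ (2 / 3 : ℝ) + M * ‖q - p‖ := by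
  calc ‖g u q - g s p‖ = ‖(g u q - g s q) + (g s q - g s p)‖ := by congr 1; abel
    _ ≤ _ := norm_add_le _ _
    _ ≤ _ := add_le_add (h.time u hu s hs q) (h.lip s hs q p)

lemma LipBounds.norm_sub_le_add {E W : Type*} [NormedAddCommGroup E] [NormedAddCommGroup W]
    [NormedSpace ℝ W] {T M : ℝ} {g : ℝ → E → W} (h : LipBounds T M g) {u s : ℝ}
    (hu : u ∈ Icc 0 T) (hs : s ∈ Icc 0 T) (q p : E) : ‖g u q - g s p‖ ≤ M + M :=
  (_root_.norm_sub_le _ _).trans (add_le_add (h.bdd u hu q) (h.bdd s hs p))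

lemma RoughData.mono {T κ c c' : ℝ} {ζ : ℝ → Vec d} {Z : ℝ → ℝ → Matrix (Fin d) (Fin d) ℝ}
    {σ : ℝ → Vec m → Vec d →L[ℝ] Vec m}
    (h : RoughData T κ c ζ Z σ) (hc : c ≤ c') : RoughData T κ c' ζ Z σ :=
  ⟨h.pow.trans hc, h.rough.mono hc, h.smooth.mono hc, h.sig.mono hc, h.gub.mono hc⟩

lemma exists_roughData {T α κ : ℝ} {ζ : ℝ → Vec d} {Z : ℝ → ℝ → Matrix (Fin d) (Fin d) ℝ}
    {σ : ℝ → Vec m → Vec d →L[ℝ] Vec m}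
    (h : IsGeometricRoughPath T α ζ Z) (hκ : 1 / 3 < κ)
    (hκα : κ < α) (hκ2 : κ ≤ 1 / 2) (hσ : IsCb13 T σ) : ∃ M, RoughData T κ M ζ Z σ := by
  obtain ⟨c, hc⟩ := h.exists_roughBounds hκ hκα hκ2
  obtain ⟨M, hM⟩ := hσ.exists_smoothBounds
  have h1 := hM.lipBounds
  have h2 := hM.lipBounds_fderiv.comp h1
  have hc0 : 0 ≤ c := zero_le_one.trans hc.one_le
  have hM0 : 0 ≤ M := zero_le_one.trans hM.one_le
  have hp0 : 0 ≤ powConst T := zero_le_one.trans (one_le_powConst T)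
  have h10 := h1.nonneg
  have h20 := h2.nonneg
  exact ⟨powConst T + c + M + M * powConst T + 8 * powConst T * (M * powConst T) ^ 2,
    by linarith, hc.mono (by linarith), hM.mono (by linarith), h1.mono (by linarith),
    h2.mono (by linarith)⟩

variable {T κ M : ℝ} {ζ : ℝ → Vec d} {Z : ℝ → ℝ → Matrix (Fin d) (Fin d) ℝ}
  {σ : ℝ → Vec m → Vec d →L[ℝ] Vec m} {f : ℝ → Vec m → Vec m}

lemma RoughData.one_le (h : RoughData T κ M ζ Z σ) : 1 ≤ M := h.rough.one_le

lemma RoughData.kappa_pos (h : RoughData T κ M ζ Z σ) : 0 < κ := by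
  linarith [h.rough.lt_exp]

lemma RoughData.rpow_le (h : RoughData T κ M ζ Z σ) {τ p q : ℝ} (hτ : 0 ≤ τ) (hT : τ ≤ T)
    (hq : 0 ≤ q) (hqp : q ≤ p) (hpq : p ≤ q + 2) : τ ^ p ≤ M * τ ^ q :=
  (rpow_le_powConst_mul hτ hT hq hqp hpq).trans
    (mul_le_mul_of_nonneg_right h.pow (Real.rpow_nonneg hτ _))

lemma RoughData.rpow_kappa_le (h : RoughData T κ M ζ Z σ) {τ : ℝ} (hτ : 0 ≤ τ) (hT : τ ≤ T) :
    τ ^ κ ≤ M := by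
  have := h.rpow_le (p := κ) (q := 0) hτ hT le_rfl h.kappa_pos.le (by linarith [h.rough.exp_le])
  simpa using this

lemma RoughData.le_sq (h : RoughData T κ M ζ Z σ) {τ : ℝ} (hτ : 0 ≤ τ) (hT : τ ≤ T) :
    τ ≤ M * (τ ^ κ) ^ 2 := by
  have := h.rpow_le (p := 1) (q := 2 * κ) hτ hT (by linarith [h.kappa_pos])
    (by linarith [h.rough.exp_le]) (by linarith [h.kappa_pos])
  rwa [Real.rpow_one, mul_comm 2 κ, Real.rpow_mul hτ, Real.rpow_two] at this

lemma RoughData.two_thirds_le (h : RoughData T κ M ζ Z σ) {τ : ℝ} (hτ : 0 ≤ τ) (hT : τ ≤ T) :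
    τ ^ (2 / 3 : ℝ) ≤ M * τ ^ κ :=
  h.rpow_le hτ hT h.kappa_pos.le (by linarith [h.rough.exp_le]) (by linarith [h.kappa_pos])

lemma DriftBounds.intervalIntegrable (hf : DriftBounds T M f) (p : Vec m) {s t : ℝ} (hs : 0 ≤ s)
    (hst : s ≤ t) (ht : t ≤ T) : IntervalIntegrable (fun u => f u p) volume s t := by
  refine ContinuousOn.intervalIntegrable ((hf.cont p).mono ?_)
  rw [uIcc_of_le hst]
  exact Icc_subset_Icc hs ht

lemma DriftBounds.norm_integral_le (hf : DriftBounds T M f) (p : Vec m) {s t : ℝ} (hs : 0 ≤ s)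
    (hst : s ≤ t) (ht : t ≤ T) : ‖∫ u in s..t, f u p‖ ≤ M * (t - s) := by
  have := intervalIntegral.norm_integral_le_of_norm_le_const (a := s) (b := t)
    (f := fun u => f u p) (C := M) (fun u hu => by
      rw [uIoc_of_le hst] at hu
      exact hf.bdd u ⟨hs.trans hu.1.le, hu.2.trans ht⟩ p)
  rwa [abs_of_nonneg (sub_nonneg.2 hst)] at this

lemma RoughData.norm_sig_le (h : RoughData T κ M ζ Z σ) {s t : ℝ} (hs : 0 ≤ s)
    (hst : s ≤ t) (ht : t ≤ T) (p : Vec m) :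
    ‖σ s p (delta1 ζ s t)‖ ≤ M ^ 2 * (t - s) ^ κ := by
  have hsT : s ∈ Icc 0 T := ⟨hs, hst.trans ht⟩
  have hM := h.one_le
  calc _ ≤ ‖σ s p‖ * ‖delta1 ζ s t‖ := (σ s p).le_opNorm _
    _ ≤ M * (M * (t - s) ^ κ) :=
        mul_le_mul (h.smooth.bdd s hsT p) (h.rough.path s t hs hst ht) (norm_nonneg _) (by linarith)
    _ = _ := by ring

lemma RoughData.norm_area_le (h : RoughData T κ M ζ Z σ) {s t : ℝ} (hs : 0 ≤ s)
    (hst : s ≤ t) (ht : t ≤ T) (p : Vec m) :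
    ‖contract (RoughControl.gub σ s p) (Z s t)‖ ≤ M ^ 2 * ((t - s) ^ κ) ^ 2 := by
  have hsT : s ∈ Icc 0 T := ⟨hs, hst.trans ht⟩
  have hM := h.one_le
  calc _ ≤ _ := h.rough.norm_contract_le _ hs hst ht
    _ ≤ M * (M * ((t - s) ^ κ) ^ 2) :=
        mul_le_mul_of_nonneg_right (h.gub.bdd s hsT p) (by positivity)
    _ = _ := by ring

lemma RoughData.norm_germ_sub_le (h : RoughData T κ M ζ Z σ) (hf : DriftBounds T M f) {s t : ℝ}
    (hs : 0 ≤ s) (hst : s ≤ t) (ht : t ≤ T) (p : Vec m) :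
    ‖germ f ζ Z σ s t p - σ s p (delta1 ζ s t)‖ ≤ 2 * M ^ 2 * ((t - s) ^ κ) ^ 2 := by
  have hM := h.one_le
  have e : germ f ζ Z σ s t p - σ s p (delta1 ζ s t)
      = (∫ u in s..t, f u p) + contract (RoughControl.gub σ s p) (Z s t) := by
    rw [germ, roughGerm]; abel
  have h1 := hf.norm_integral_le p hs hst ht
  have h2 := h.le_sq (sub_nonneg.2 hst) (by linarith)
  have h3 := h.norm_area_le hs hst ht p
  rw [e]
  refine (norm_add_le _ _).trans ((add_le_add h1 h3).trans ?_)
  nlinarith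

lemma RoughData.norm_germ_le (h : RoughData T κ M ζ Z σ) (hf : DriftBounds T M f) {s t : ℝ}
    (hs : 0 ≤ s) (hst : s ≤ t) (ht : t ≤ T) (p : Vec m) :
    ‖germ f ζ Z σ s t p‖ ≤ 3 * M ^ 3 * (t - s) ^ κ := by
  have hM := h.one_le
  have h1 := h.norm_germ_sub_le hf hs hst ht p
  have h2 := h.norm_sig_le hs hst ht p
  have h3 := h.rpow_kappa_le (sub_nonneg.2 hst) (by linarith)
  have h0 : 0 ≤ (t - s) ^ κ := Real.rpow_nonneg (sub_nonneg.2 hst) _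
  set ξ := (t - s) ^ κ
  have e : germ f ζ Z σ s t p
      = (germ f ζ Z σ s t p - σ s p (delta1 ζ s t)) + σ s p (delta1 ζ s t) := by abel
  rw [e]
  refine (norm_add_le _ _).trans ((add_le_add h1 h2).trans ?_)
  have k1 : 2 * M ^ 2 * ξ ^ 2 ≤ 2 * M ^ 2 * (M * ξ) := by
    rw [pow_two ξ]; gcongr
  have k2 : M ^ 2 * ξ ≤ M ^ 3 * ξ :=
    mul_le_mul_of_nonneg_right (pow_le_pow_right₀ hM (by norm_num)) h0
  linarith

/-- The remainder of the rough integrand. -/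
lemma SmoothBounds.norm_remainder_le (h : SmoothBounds T M σ) {s u : ℝ} (hs : s ∈ Icc 0 T)
    (hu : u ∈ Icc 0 T) (p q : Vec m) (v : Vec d) :
    ‖σ u q - σ s p - gub σ s p v‖
      ≤ M * |u - s| + M * ‖q - p‖ ^ 2 + M * ‖q - p - σ s p v‖ := by
  have hM := h.one_le
  have e : σ u q - σ s p - gub σ s p v
      = (σ u q - σ s q) + (σ s q - σ s p - fderiv ℝ (σ s) p (q - p))
        + fderiv ℝ (σ s) p (q - p - σ s p v) := by
    simp only [gub, ContinuousLinearMap.comp_apply, map_sub]; abel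
  have h1 := h.time u hu s hs q
  have h2 := norm_taylor_one_le (h.diff s hs)
    (norm_sub_le_of_norm_fderiv_le (h.diff' s hs) (h.bdd'' s hs)) (by linarith) p (q - p)
  rw [add_sub_cancel] at h2
  have h3 : ‖fderiv ℝ (σ s) p (q - p - σ s p v)‖ ≤ M * ‖q - p - σ s p v‖ :=
    ((fderiv ℝ (σ s) p).le_opNorm _).trans
      (mul_le_mul_of_nonneg_right (h.bdd' s hs p) (norm_nonneg _))
  rw [e]
  exact (norm_add_le _ _).trans (add_le_add ((norm_add_le _ _).trans (add_le_add h1 h2)) h3)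

/-- By Chen's relation, the defect of the rough germ is minus the three-index map that is sewn in
`IsRoughIntegral`. The points p and q need not lie on a solution, so the identity serves Euler
schemes as well. -/
lemma RoughData.delta2_roughGerm (h : RoughData T κ M ζ Z σ) {s u t : ℝ} (hs : 0 ≤ s)
    (hsu : s ≤ u) (hut : u ≤ t) (ht : t ≤ T) (p q : Vec m) :
    roughGerm ζ Z σ s t p - roughGerm ζ Z σ s u p - roughGerm ζ Z σ u t q
      = -((σ u q - σ s p - RoughControl.gub σ s p (delta1 ζ s u)) (delta1 ζ u t)
        + contract (RoughControl.gub σ u q - RoughControl.gub σ s p) (Z u t)) := by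
  have hζ : delta1 ζ s t = delta1 ζ s u + delta1 ζ u t := by simp only [delta1]; abel
  simp only [roughGerm]
  rw [h.rough.contract_chen (RoughControl.gub σ s p) hs hsu hut ht, contract_sub, hζ]
  simp only [map_add, sub_apply]
  abel

/-- For a ≤ 1 the cube is below the square; for a ≥ 1 the truncation at 1 does the work. With a = Gξ
this is how one power of G is saved. -/
lemma min_one_le_sq {r a : ℝ} (ha : 0 ≤ a) (hr : r ≤ a ^ 3) : min 1 r ≤ a ^ 2 := by
  rcases le_total a 1 with h | h
  · exact (min_le_right _ _).trans (hr.trans (pow_le_pow_of_le_one ha h (by norm_num)))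
  · exact (min_le_left _ _).trans (one_le_pow₀ h)

lemma min_one_le_self {r a : ℝ} (ha : 0 ≤ a) (hr : r ≤ a ^ 3) : min 1 r ≤ a := by
  rcases le_total a 1 with h | h
  · refine (min_le_right _ _).trans (hr.trans ?_)
    simpa using pow_le_pow_of_le_one ha h (by norm_num : 1 ≤ 3)
  · exact (min_le_left _ _).trans h

set_option maxHeartbeats 1000000 in
/-- The defect of the local expansion along an approximate solution. -/
lemma RoughData.norm_delta2_germ_le (h : RoughData T κ M ζ Z σ) (hf : DriftBounds T M f) {G : ℝ}
    (hG : 1 ≤ G) {s u t : ℝ} (hs : 0 ≤ s) (hsu : s ≤ u) (hut : u ≤ t) (ht : t ≤ T) {p q : Vec m}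
    (hr : ‖q - p - germ f ζ Z σ s u p‖ ≤ G ^ 3 * ((u - s) ^ κ) ^ 3) :
    ‖germ f ζ Z σ s t p - germ f ζ Z σ s u p - germ f ζ Z σ u t q‖
      ≤ 56 * M ^ 8 * G ^ 2 * ((t - s) ^ κ) ^ 3 := by
  have hM := h.one_le
  have hM0 : 0 ≤ M := by linarith
  have hκ := h.kappa_pos
  have sT : s ∈ Icc 0 T := ⟨hs, by linarith⟩
  have uT : u ∈ Icc 0 T := ⟨by linarith, by linarith⟩
  have tT : t ∈ Icc 0 T := ⟨by linarith, by linarith⟩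
  set ξ := (t - s) ^ κ with hξ
  have x0 : 0 ≤ ξ := Real.rpow_nonneg (by linarith) _
  have xsu : (u - s) ^ κ ≤ ξ := Real.rpow_le_rpow (by linarith) (by linarith) hκ.le
  have xut : (t - u) ^ κ ≤ ξ := Real.rpow_le_rpow (by linarith) (by linarith) hκ.le
  have xsu0 : 0 ≤ (u - s) ^ κ := Real.rpow_nonneg (by linarith) _
  have xut0 : 0 ≤ (t - u) ^ κ := Real.rpow_nonneg (by linarith) _
  have xM : ξ ≤ M := h.rpow_kappa_le (by linarith) (by linarith)
  have tsu : u - s ≤ M * ξ ^ 2 := (h.le_sq (by linarith) (by linarith)).trans (by gcongr)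
  have tut : t - u ≤ M * ξ ^ 2 := (h.le_sq (by linarith) (by linarith)).trans (by gcongr)
  have tsu' : |u - s| ^ (2 / 3 : ℝ) ≤ M * ξ := by
    rw [abs_of_nonneg (by linarith)]
    exact (h.two_thirds_le (by linarith) (by linarith)).trans (by gcongr)
  set r := ‖q - p - germ f ζ Z σ s u p‖ with hrdef
  have r0 : 0 ≤ r := norm_nonneg _
  have hr3 : r ≤ (G * ξ) ^ 3 := by
    rw [mul_pow]; exact hr.trans (by gcongr)
  have hmin2 := min_one_le_sq (by positivity) hr3
  have hmin1 := min_one_le_self (by positivity) hr3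
  -- Regularity bounds the differences of the coefficients in terms of r, and boundedness covers r >
  -- 1, so r enters only through min 1 r. Since min 1 r ≤ (Gξ)² and min 1 r ≤ Gξ, the defect grows
  -- like G² although r may be of size G³ξ³.
  set μ := min 1 r with hμ
  have hμ0 : 0 ≤ μ := le_min zero_le_one r0
  have v1 : ‖q - p‖ ≤ 3 * M ^ 3 * ξ + r := by
    have := h.norm_germ_le hf hs hsu (by linarith) p
    calc ‖q - p‖ = ‖germ f ζ Z σ s u p + (q - p - germ f ζ Z σ s u p)‖ := by congr 1; abel
      _ ≤ _ := norm_add_le _ _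
      _ ≤ _ := add_le_add (this.trans (by gcongr)) le_rfl
  have v2 : ‖q - p - σ s p (delta1 ζ s u)‖ ≤ 2 * M ^ 2 * ξ ^ 2 + r := by
    have := h.norm_germ_sub_le hf hs hsu (by linarith) p
    calc ‖q - p - σ s p (delta1 ζ s u)‖
        = ‖(germ f ζ Z σ s u p - σ s p (delta1 ζ s u)) + (q - p - germ f ζ Z σ s u p)‖ := by
          congr 1; abel
      _ ≤ _ := norm_add_le _ _
      _ ≤ _ := add_le_add (this.trans (by gcongr)) le_rfl
  have p27 : M ^ 2 ≤ M ^ 7 := pow_le_pow_right₀ hM (by norm_num)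
  have p37 : M ^ 3 ≤ M ^ 7 := pow_le_pow_right₀ hM (by norm_num)
  have p47 : M ^ 4 ≤ M ^ 7 := pow_le_pow_right₀ hM (by norm_num)
  have p17 : M ≤ M ^ 7 := le_self_pow₀ hM (by norm_num)
  have p14 : M ≤ M ^ 4 := le_self_pow₀ hM (by norm_num)
  have p24 : M ^ 2 ≤ M ^ 4 := pow_le_pow_right₀ hM (by norm_num)
  have b1 : ‖σ u q - σ s p - RoughControl.gub σ s p (delta1 ζ s u)‖ ≤ 21 * M ^ 7 * (ξ ^ 2 + μ) := by
    rcases le_total r 1 with hr1 | hr1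
    · have hμr : μ = r := min_eq_right hr1
      have := h.smooth.norm_remainder_le sT uT p q (delta1 ζ s u)
      rw [abs_of_nonneg (by linarith)] at this
      have hsq : ‖q - p‖ ^ 2 ≤ 18 * M ^ 6 * ξ ^ 2 + 2 * r := by
        have h1 : ‖q - p‖ ^ 2 ≤ (3 * M ^ 3 * ξ + r) ^ 2 := by gcongr
        nlinarith [sq_nonneg (3 * M ^ 3 * ξ - r)]
      rw [hμr]
      calc _ ≤ _ := this
        _ ≤ M * (M * ξ ^ 2) + M * (18 * M ^ 6 * ξ ^ 2 + 2 * r) + M * (2 * M ^ 2 * ξ ^ 2 + r) := by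
            gcongr
        _ = M ^ 2 * ξ ^ 2 + 18 * M ^ 7 * ξ ^ 2 + 2 * (M ^ 3 * ξ ^ 2) + 3 * (M * r) := by ring
        _ ≤ M ^ 7 * ξ ^ 2 + 18 * M ^ 7 * ξ ^ 2 + 2 * (M ^ 7 * ξ ^ 2) + 3 * (M ^ 7 * r) := by gcongr
        _ ≤ _ := by
            have : 0 ≤ M ^ 7 * r := by positivity
            linarith
    · have hμ1 : μ = 1 := min_eq_left hr1
      have g1 : ‖RoughControl.gub σ s p (delta1 ζ s u)‖ ≤ M ^ 3 := by
        calc _ ≤ _ := (RoughControl.gub σ s p).le_opNorm _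
          _ ≤ M * (M * (u - s) ^ κ) := mul_le_mul (h.gub.bdd s sT p)
              (h.rough.path s u hs hsu (by linarith)) (norm_nonneg _) hM0
          _ ≤ M * (M * M) := by gcongr; exact xsu.trans xM
          _ = _ := by ring
      have h1 := h.smooth.bdd u uT q
      have h2 := h.smooth.bdd s sT p
      have : ‖σ u q - σ s p - RoughControl.gub σ s p (delta1 ζ s u)‖ ≤ M + M + M ^ 3 :=
        (norm_sub_le _ _).trans (add_le_add ((norm_sub_le _ _).trans (add_le_add h1 h2)) g1)
      rw [hμ1]
      have : 0 ≤ M ^ 7 * ξ ^ 2 := by positivity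
      linarith
  have b2 : ‖RoughControl.gub σ u q - RoughControl.gub σ s p‖ ≤ 4 * M ^ 4 * (ξ + μ) := by
    rcases le_total r 1 with hr1 | hr1
    · have hμr : μ = r := min_eq_right hr1
      rw [hμr]
      calc ‖RoughControl.gub σ u q - RoughControl.gub σ s p‖
          ≤ M * |u - s| ^ (2 / 3 : ℝ) + M * ‖q - p‖ := h.gub.norm_sub_le uT sT q p
        _ ≤ M * (M * ξ) + M * (3 * M ^ 3 * ξ + r) := by gcongr
        _ = M ^ 2 * ξ + 3 * M ^ 4 * ξ + M * r := by ring
        _ ≤ M ^ 4 * ξ + 3 * M ^ 4 * ξ + M ^ 4 * r := by gcongr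
        _ ≤ _ := by
            have : 0 ≤ M ^ 4 * r := by positivity
            linarith
    · have hμ1 : μ = 1 := min_eq_left hr1
      have : ‖RoughControl.gub σ u q - RoughControl.gub σ s p‖ ≤ M + M :=
        h.gub.norm_sub_le_add uT sT q p
      rw [hμ1]
      have : 0 ≤ M ^ 4 * ξ := by positivity
      linarith
  have b3 : ∀ w ∈ Icc 0 T, ‖f w p - f w q‖ ≤ 3 * M ^ 4 * (ξ + μ) := by
    intro w hw
    rcases le_total r 1 with hr1 | hr1
    · have hμr : μ = r := min_eq_right hr1
      rw [hμr]
      have := hf.lip w hw p q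
      rw [norm_sub_rev p q] at this
      calc _ ≤ _ := this
        _ ≤ M * (3 * M ^ 3 * ξ + r) := by gcongr
        _ = 3 * M ^ 4 * ξ + M * r := by ring
        _ ≤ 3 * M ^ 4 * ξ + M ^ 4 * r := by gcongr
        _ ≤ _ := by
            have : 0 ≤ M ^ 4 * r := by positivity
            linarith
    · have hμ1 : μ = 1 := min_eq_left hr1
      have : ‖f w p - f w q‖ ≤ M + M :=
        (norm_sub_le _ _).trans (add_le_add (hf.bdd w hw p) (hf.bdd w hw q))
      rw [hμ1]
      have : 0 ≤ M ^ 4 * ξ := by positivity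
      linarith
  have c1 : ξ ^ 2 + μ ≤ 2 * G ^ 2 * ξ ^ 2 := by
    have : ξ ^ 2 ≤ G ^ 2 * ξ ^ 2 := le_mul_of_one_le_left (by positivity) (one_le_pow₀ hG)
    rw [mul_pow] at hmin2
    linarith
  have c2 : ξ + μ ≤ 2 * G ^ 2 * ξ := by
    have h1 : ξ ≤ G ^ 2 * ξ := le_mul_of_one_le_left x0 (one_le_pow₀ hG)
    have h2 : G * ξ ≤ G ^ 2 * ξ := by gcongr; exact le_self_pow₀ hG (by norm_num)
    linarith
  have idr : (∫ w in s..t, f w p) - (∫ w in s..u, f w p) - (∫ w in u..t, f w q)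
      = ∫ w in u..t, (f w p - f w q) := by
    rw [intervalIntegral.integral_sub (hf.intervalIntegrable p uT.1 hut ht)
      (hf.intervalIntegrable q uT.1 hut ht),
      ← intervalIntegral.integral_add_adjacent_intervals (hf.intervalIntegrable p hs hsu (by linarith))
      (hf.intervalIntegrable p uT.1 hut ht)]
    abel
  have e : germ f ζ Z σ s t p - germ f ζ Z σ s u p - germ f ζ Z σ u t q
      = (∫ w in u..t, (f w p - f w q))
        + -((σ u q - σ s p - RoughControl.gub σ s p (delta1 ζ s u)) (delta1 ζ u t)
        + contract (RoughControl.gub σ u q - RoughControl.gub σ s p) (Z u t)) := by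
    rw [← idr, ← h.delta2_roughGerm hs hsu hut ht p q]
    simp only [germ]
    abel
  have n1 : ‖∫ w in u..t, (f w p - f w q)‖ ≤ 3 * M ^ 4 * (2 * G ^ 2 * ξ) * (M * ξ ^ 2) := by
    have := intervalIntegral.norm_integral_le_of_norm_le_const (a := u) (b := t)
      (f := fun w => f w p - f w q) (C := 3 * M ^ 4 * (ξ + μ)) (fun w hw => by
        rw [uIoc_of_le hut] at hw
        exact b3 w ⟨uT.1.trans hw.1.le, hw.2.trans ht⟩)
    rw [abs_of_nonneg (by linarith)] at this
    have tu0 : 0 ≤ t - u := by linarith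
    exact this.trans (by gcongr)
  have n2 : ‖(σ u q - σ s p - RoughControl.gub σ s p (delta1 ζ s u)) (delta1 ζ u t)‖
      ≤ 21 * M ^ 7 * (2 * G ^ 2 * ξ ^ 2) * (M * ξ) := by
    refine (ContinuousLinearMap.le_opNorm _ _).trans ?_
    exact mul_le_mul (b1.trans (by gcongr)) ((h.rough.path u t uT.1 hut ht).trans (by gcongr))
      (norm_nonneg _) (by positivity)
  have n3 : ‖contract (RoughControl.gub σ u q - RoughControl.gub σ s p) (Z u t)‖
      ≤ 4 * M ^ 4 * (2 * G ^ 2 * ξ) * (M * ξ ^ 2) := by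
    refine (h.rough.norm_contract_le _ uT.1 hut ht).trans ?_
    exact mul_le_mul (b2.trans (by gcongr)) (by gcongr) (by positivity) (by positivity)
  rw [e]
  refine (norm_add_le _ _).trans ?_
  rw [norm_neg]
  refine (add_le_add n1 ((norm_add_le _ _).trans (add_le_add n2 n3))).trans ?_
  have p58 : M ^ 5 ≤ M ^ 8 := pow_le_pow_right₀ hM (by norm_num)
  have : M ^ 5 * (G ^ 2 * ξ ^ 3) ≤ M ^ 8 * (G ^ 2 * ξ ^ 3) := by gcongr
  nlinarith

end Germ

/-! ### Euler schemes and existence of Davie solutions. -/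

section Existence

variable {m d : ℕ} {T κ M : ℝ} {ζ : ℝ → Vec d} {Z : ℝ → ℝ → Matrix (Fin d) (Fin d) ℝ}
  {σ : ℝ → Vec m → Vec d →L[ℝ] Vec m} {f : ℝ → Vec m → Vec m}

/-- Continuity of the germ in its endpoints and base point, for endpoints approached from the left,
as happens when times are rounded down to a grid. The areas over [s',t'] and [s,t] are compared by
writing Chen's relation over [s',t] in two ways. -/
lemma RoughData.norm_roughGerm_sub_le (h : RoughData T κ M ζ Z σ) {s' s t' t : ℝ} (hs' : 0 ≤ s')
    (hss : s' ≤ s) (hst : s ≤ t) (hst' : s' ≤ t') (htt : t' ≤ t) (ht : t ≤ T) (p' p : Vec m) :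
    ‖roughGerm ζ Z σ s' t' p' - roughGerm ζ Z σ s t p‖
      ≤ 2 * M ^ 4 * (|s' - s| ^ (2 / 3 : ℝ) + ‖p' - p‖)
        + 4 * M ^ 4 * ((s - s') ^ κ + (t - t') ^ κ) := by
  have hM := h.one_le
  have hM0 : 0 ≤ M := by linarith
  have sT : s ∈ Icc 0 T := ⟨by linarith, by linarith⟩
  have sT' : s' ∈ Icc 0 T := ⟨by linarith, by linarith⟩
  set a := (s - s') ^ κ with ha
  set b := (t - t') ^ κ with hb
  set D := |s' - s| ^ (2 / 3 : ℝ) + ‖p' - p‖ with hD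
  have a0 : 0 ≤ a := Real.rpow_nonneg (by linarith) _
  have b0 : 0 ≤ b := Real.rpow_nonneg (by linarith) _
  have D0 : 0 ≤ D := by positivity
  have aM : a ≤ M := h.rpow_kappa_le (by linarith) (by linarith)
  have bM : b ≤ M := h.rpow_kappa_le (by linarith) (by linarith)
  have ξM : (t' - s') ^ κ ≤ M := h.rpow_kappa_le (by linarith) (by linarith)
  have ξ0 : 0 ≤ (t' - s') ^ κ := Real.rpow_nonneg (by linarith) _
  have ηM : (t - s) ^ κ ≤ M := h.rpow_kappa_le (by linarith) (by linarith)
  have z1 := h.rough.path s' s hs' hss (by linarith)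
  have z2 := h.rough.path t' t (by linarith) htt ht
  have z3 : ‖delta1 ζ s' t'‖ ≤ M * M :=
    (h.rough.path s' t' hs' hst' (by linarith)).trans (by gcongr)
  have z4 : ‖delta1 ζ s t‖ ≤ M * M :=
    (h.rough.path s t (by linarith) hst (by linarith)).trans (by gcongr)
  have hσd : ‖σ s' p' - σ s p‖ ≤ M * D :=
    (h.sig.norm_sub_le sT' sT p' p).trans (le_of_eq (by rw [hD]; ring))
  have hgd : ‖RoughControl.gub σ s' p' - RoughControl.gub σ s p‖ ≤ M * D :=
    (h.gub.norm_sub_le sT' sT p' p).trans (le_of_eq (by rw [hD]; ring))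
  set A := RoughControl.gub σ s p with hA
  have hAb : ‖A‖ ≤ M := h.gub.bdd s sT p
  have app : ∀ x y : Vec d, ∀ X Y : ℝ, ‖x‖ ≤ X → ‖y‖ ≤ Y → ‖A x y‖ ≤ M * X * Y := by
    intro x y X Y hx hy
    have X0 := (norm_nonneg x).trans hx
    exact (A.le_opNorm₂ x y).trans (by gcongr)
  have c1 := h.rough.contract_chen A hs' hst' htt ht
  have c2 := h.rough.contract_chen A hs' hss hst ht
  have e : roughGerm ζ Z σ s' t' p' - roughGerm ζ Z σ s t p
      = (σ s' p' - σ s p) (delta1 ζ s' t') + σ s p (delta1 ζ s' s) - σ s p (delta1 ζ t' t)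
        + (contract (RoughControl.gub σ s' p' - A) (Z s' t') + contract A (Z s' s)
          + A (delta1 ζ s' s) (delta1 ζ s t) - contract A (Z t' t)
          - A (delta1 ζ s' t') (delta1 ζ t' t)) := by
    have k1 : contract A (Z s t) = contract A (Z s' t') + contract A (Z t' t)
        + A (delta1 ζ s' t') (delta1 ζ t' t) - contract A (Z s' s)
        - A (delta1 ζ s' s) (delta1 ζ s t) := by
      rw [← c1, c2]; abel
    have k2 : delta1 ζ s t = delta1 ζ s' t' - delta1 ζ s' s + delta1 ζ t' t := by
      simp only [delta1]; abel
    simp only [roughGerm]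
    rw [← hA, k1, contract_sub]
    have k3 : σ s p (delta1 ζ s t)
        = σ s p (delta1 ζ s' t') - σ s p (delta1 ζ s' s) + σ s p (delta1 ζ t' t) := by
      rw [k2, map_add, map_sub]
    rw [k3, sub_apply]
    abel
  have n1 : ‖(σ s' p' - σ s p) (delta1 ζ s' t')‖ ≤ M * D * (M * M) :=
    (ContinuousLinearMap.le_opNorm _ _).trans (mul_le_mul hσd z3 (norm_nonneg _) (by positivity))
  have n2 : ‖σ s p (delta1 ζ s' s)‖ ≤ M * (M * a) :=
    (ContinuousLinearMap.le_opNorm _ _).trans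
      (mul_le_mul (h.smooth.bdd s sT p) z1 (norm_nonneg _) (by positivity))
  have n3 : ‖σ s p (delta1 ζ t' t)‖ ≤ M * (M * b) :=
    (ContinuousLinearMap.le_opNorm _ _).trans
      (mul_le_mul (h.smooth.bdd s sT p) z2 (norm_nonneg _) (by positivity))
  have n4 : ‖contract (RoughControl.gub σ s' p' - A) (Z s' t')‖ ≤ M * D * (M * M ^ 2) :=
    (h.rough.norm_contract_le _ hs' hst' (by linarith)).trans
      (mul_le_mul hgd (by gcongr) (by positivity) (by positivity))
  have n5 : ‖contract A (Z s' s)‖ ≤ M * (M * (a * M)) :=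
    (h.rough.norm_contract_le _ hs' hss (by linarith)).trans
      (mul_le_mul hAb (by rw [pow_two]; gcongr) (by positivity) (by positivity))
  have n6 : ‖contract A (Z t' t)‖ ≤ M * (M * (b * M)) :=
    (h.rough.norm_contract_le _ (by linarith) htt ht).trans
      (mul_le_mul hAb (by rw [pow_two]; gcongr) (by positivity) (by positivity))
  have n7 := app _ _ _ _ z1 z4
  have n8 := app _ _ _ _ z3 z2
  rw [e]
  refine (norm_add_le _ _).trans ((add_le_add
    ((norm_sub_le _ _).trans (add_le_add ((norm_add_le _ _).trans (add_le_add n1 n2)) n3))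
    ((norm_sub_le _ _).trans (add_le_add ((norm_sub_le _ _).trans (add_le_add
      ((norm_add_le _ _).trans (add_le_add ((norm_add_le _ _).trans (add_le_add n4 n5)) n7)) n6))
      n8))).trans ?_)
  have p3 : M ^ 3 ≤ M ^ 4 := pow_le_pow_right₀ hM (by norm_num)
  have p2 : M ^ 2 ≤ M ^ 4 := pow_le_pow_right₀ hM (by norm_num)
  have q1 : M ^ 3 * D ≤ M ^ 4 * D := by gcongr
  have q2 : M ^ 2 * a ≤ M ^ 4 * a := by gcongr
  have q3 : M ^ 2 * b ≤ M ^ 4 * b := by gcongr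
  have q4 : M ^ 3 * a ≤ M ^ 4 * a := by gcongr
  have q5 : M ^ 3 * b ≤ M ^ 4 * b := by gcongr
  have q6 : 0 ≤ M ^ 4 * a := by positivity
  have q7 : 0 ≤ M ^ 4 * b := by positivity
  nlinarith

lemma RoughData.tendsto_roughGerm (h : RoughData T κ M ζ Z σ) {ι : Type*} {l : Filter ι}
    {s' t' : ι → ℝ} {p' : ι → Vec m} {s t : ℝ} {p : Vec m} (hs' : ∀ i, 0 ≤ s' i)
    (hss : ∀ i, s' i ≤ s) (hst : s ≤ t) (hst' : ∀ i, s' i ≤ t' i) (htt : ∀ i, t' i ≤ t)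
    (ht : t ≤ T) (ls : Tendsto s' l (𝓝 s)) (lt : Tendsto t' l (𝓝 t)) (lp : Tendsto p' l (𝓝 p)) :
    Tendsto (fun i => roughGerm ζ Z σ (s' i) (t' i) (p' i)) l (𝓝 (roughGerm ζ Z σ s t p)) := by
  rw [tendsto_iff_norm_sub_tendsto_zero]
  refine squeeze_zero (fun _ => norm_nonneg _) (fun i => h.norm_roughGerm_sub_le (hs' i) (hss i)
    hst (hst' i) (htt i) ht (p' i) p) ?_
  have hκ := h.kappa_pos
  have k1 : Tendsto (fun i => |s' i - s| ^ (2 / 3 : ℝ)) l (𝓝 0) := by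
    have : Tendsto (fun i => |s' i - s|) l (𝓝 0) := by
      simpa using (ls.sub_const s).abs
    simpa using this.rpow_const (p := (2 / 3 : ℝ)) (Or.inr (by norm_num))
  have k2 : Tendsto (fun i => ‖p' i - p‖) l (𝓝 0) := tendsto_iff_norm_sub_tendsto_zero.1 lp
  have k3 : Tendsto (fun i => (s - s' i) ^ κ) l (𝓝 0) := by
    have : Tendsto (fun i => s - s' i) l (𝓝 0) := by simpa using ls.const_sub s
    simpa [Real.zero_rpow hκ.ne'] using this.rpow_const (p := κ) (Or.inr hκ.le)
  have k4 : Tendsto (fun i => (t - t' i) ^ κ) l (𝓝 0) := by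
    have : Tendsto (fun i => t - t' i) l (𝓝 0) := by simpa using lt.const_sub t
    simpa [Real.zero_rpow hκ.ne'] using this.rpow_const (p := κ) (Or.inr hκ.le)
  have := ((k1.add k2).const_mul (2 * M ^ 4)).add ((k3.add k4).const_mul (4 * M ^ 4))
  simpa using this

lemma DriftBounds.norm_integral_sub_le (hf : DriftBounds T M f) (hM : 0 ≤ M) {s' s t' t : ℝ}
    (hs' : 0 ≤ s') (hss : s' ≤ s) (hst : s ≤ t) (hst' : s' ≤ t') (htt : t' ≤ t) (ht : t ≤ T)
    (p' p : Vec m) :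
    ‖(∫ u in s'..t', f u p') - ∫ u in s..t, f u p‖
      ≤ M * ‖p' - p‖ * T + M * (s - s') + M * (t - t') := by
  have I1 := hf.intervalIntegrable p' hs' hst' (htt.trans ht)
  have I2 := hf.intervalIntegrable p hs' hst' (htt.trans ht)
  have I3 := hf.intervalIntegrable p (hs'.trans hst') htt ht
  have I4 := hf.intervalIntegrable p hs' hss (hst.trans ht)
  have I5 := hf.intervalIntegrable p (hs'.trans hss) hst ht
  have e : (∫ u in s'..t', f u p') - ∫ u in s..t, f u p
      = (∫ u in s'..t', (f u p' - f u p)) + (∫ u in s'..s, f u p) - ∫ u in t'..t, f u p := by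
    have k1 := intervalIntegral.integral_add_adjacent_intervals I2 I3
    have k2 := intervalIntegral.integral_add_adjacent_intervals I4 I5
    have k3 : (∫ u in s..t, f u p)
        = (∫ u in s'..t', f u p) + (∫ u in t'..t, f u p) - ∫ u in s'..s, f u p := by
      rw [k1, ← k2]; abel
    rw [intervalIntegral.integral_sub I1 I2, k3]
    abel
  have n1 : ‖∫ u in s'..t', (f u p' - f u p)‖ ≤ M * ‖p' - p‖ * T := by
    have := intervalIntegral.norm_integral_le_of_norm_le_const (a := s') (b := t')
      (f := fun u => f u p' - f u p) (C := M * ‖p' - p‖) (fun u hu => by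
        rw [uIoc_of_le hst'] at hu
        exact hf.lip u ⟨hs'.trans hu.1.le, hu.2.trans (htt.trans ht)⟩ p' p)
    rw [abs_of_nonneg (by linarith)] at this
    refine this.trans ?_
    gcongr
    linarith
  rw [e]
  exact (norm_sub_le _ _).trans (add_le_add ((norm_add_le _ _).trans
    (add_le_add n1 (hf.norm_integral_le p hs' hss (hst.trans ht))))
    (hf.norm_integral_le p (hs'.trans hst') htt ht))

lemma DriftBounds.tendsto_integral (hf : DriftBounds T M f) (hM : 0 ≤ M) {ι : Type*}
    {l : Filter ι} {s' t' : ι → ℝ} {p' : ι → Vec m} {s t : ℝ} {p : Vec m} (hs' : ∀ i, 0 ≤ s' i)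
    (hss : ∀ i, s' i ≤ s) (hst : s ≤ t) (hst' : ∀ i, s' i ≤ t' i) (htt : ∀ i, t' i ≤ t)
    (ht : t ≤ T) (ls : Tendsto s' l (𝓝 s)) (lt : Tendsto t' l (𝓝 t)) (lp : Tendsto p' l (𝓝 p)) :
    Tendsto (fun i => ∫ u in s' i..t' i, f u (p' i)) l (𝓝 (∫ u in s..t, f u p)) := by
  rw [tendsto_iff_norm_sub_tendsto_zero]
  refine squeeze_zero (fun _ => norm_nonneg _) (fun i => hf.norm_integral_sub_le hM (hs' i) (hss i)
    hst (hst' i) (htt i) ht (p' i) p) ?_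
  have k2 : Tendsto (fun i => ‖p' i - p‖) l (𝓝 0) := tendsto_iff_norm_sub_tendsto_zero.1 lp
  have := (((k2.const_mul M).mul_const T).add ((ls.const_sub s).const_mul M)).add
    ((lt.const_sub t).const_mul M)
  simpa using this

/-- The constant in the a priori estimate for Euler schemes. -/
noncomputable def eulerConst (κ M : ℝ) : ℝ := 1 + 112 * M ^ 8 / (1 - 2 ^ (1 - 3 * κ))

/-- The Euler scheme with step `h`. -/
noncomputable def euler (f : ℝ → Vec m → Vec m) (ζ : ℝ → Vec d)
    (Z : ℝ → ℝ → Matrix (Fin d) (Fin d) ℝ) (σ : ℝ → Vec m → Vec d →L[ℝ] Vec m) (h : ℝ)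
    (y : Vec m) : ℕ → Vec m
  | 0 => y
  | i + 1 => euler f ζ Z σ h y i + germ f ζ Z σ (i * h) ((i + 1 : ℕ) * h) (euler f ζ Z σ h y i)

lemma RoughData.one_le_eulerConst (h : RoughData T κ M ζ Z σ) : 1 ≤ eulerConst κ M := by
  have := two_rpow_lt_one (a := 3 * κ) (by linarith [h.rough.lt_exp])
  have hM := h.one_le
  have : 0 ≤ 112 * M ^ 8 / (1 - 2 ^ (1 - 3 * κ)) := div_nonneg (by positivity) (by linarith)
  rw [eulerConst]; linarith

lemma RoughData.germ_self (h : RoughData T κ M ζ Z σ) (hf : DriftBounds T M f) {t : ℝ} (h0 : 0 ≤ t)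
    (ht : t ≤ T) (p : Vec m) : germ f ζ Z σ t t p = 0 := by
  have := h.norm_germ_le hf h0 le_rfl ht p
  rw [sub_self, Real.zero_rpow h.kappa_pos.ne', mul_zero] at this
  exact norm_le_zero_iff.1 this

/-- Discrete sewing with Γ = G³: a single step has zero error by construction, and the defect of the
germ costs a multiple of G² only. The bound does not depend on the mesh. -/
lemma RoughData.euler_estimate (h : RoughData T κ M ζ Z σ) (hf : DriftBounds T M f) (y : Vec m)
    {N : ℕ} {η : ℝ} (hη : 0 ≤ η) (hN : N * η ≤ T) (i k : ℕ) (hik : i ≤ k) (hk : k ≤ N) :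
    ‖euler f ζ Z σ η y k - euler f ζ Z σ η y i
        - germ f ζ Z σ (i * η) (k * η) (euler f ζ Z σ η y i)‖
      ≤ eulerConst κ M ^ 3 * ((k * η - i * η) ^ κ) ^ 3 := by
  set X := euler f ζ Z σ η y with hX
  set G := eulerConst κ M with hG
  have hM := h.one_le
  have hG1 : 1 ≤ G := h.one_le_eulerConst
  have hθ : 0 < 1 - (2 : ℝ) ^ (1 - 3 * κ) :=
    sub_pos.2 (two_rpow_lt_one (by linarith [h.rough.lt_exp]))
  have mem : ∀ i : ℕ, i ≤ N → (i : ℝ) * η ≤ T := fun i hi =>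
    (mul_le_mul_of_nonneg_right (by exact_mod_cast hi) hη).trans hN
  have mono : ∀ i j : ℕ, i ≤ j → (i : ℝ) * η ≤ j * η := fun i j hij =>
    mul_le_mul_of_nonneg_right (by exact_mod_cast hij) hη
  have nn : ∀ i : ℕ, 0 ≤ (i : ℝ) * η := fun i => by positivity
  have cub : ∀ τ : ℝ, 0 ≤ τ → τ ^ (3 * κ) = (τ ^ κ) ^ 3 := fun τ hτ => by
    rw [mul_comm, Real.rpow_mul hτ]; norm_cast
  have sub : ∀ i j : ℕ, i ≤ j → ((j - i : ℕ) : ℝ) * η = j * η - i * η := fun i j hij => by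
    rw [Nat.cast_sub hij]; ring
  have key := discrete_sewing (ω := fun i k => ‖X k - X i - germ f ζ Z σ (i * η) (k * η) (X i)‖)
    (a := 3 * κ) (h := η) (Γ := G ^ 3) (B := 56 * M ^ 8 * G ^ 2) (N := N)
    (by linarith [h.rough.lt_exp]) hη (by positivity) ?_ ?_ ?_ ?_ i k hik hk
  · rw [sub i k hik, cub _ (sub_nonneg.2 (mono i k hik))] at key
    exact key
  -- `eulerConst` is chosen to satisfy this inequality; multiplied by G² it is the closing condition
  -- 2B ≤ (1 - 2^{1-3κ})G³.
  · have : 112 * M ^ 8 ≤ (1 - 2 ^ (1 - 3 * κ)) * G := by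
      rw [hG, eulerConst, mul_add, mul_div_cancel₀ _ hθ.ne']
      linarith
    calc 2 * (56 * M ^ 8 * G ^ 2) = (112 * M ^ 8) * G ^ 2 := by ring
      _ ≤ ((1 - 2 ^ (1 - 3 * κ)) * G) * G ^ 2 := by gcongr
      _ = _ := by ring
  · intro i hi
    simp [h.germ_self hf (nn i) (mem i hi)]
  · intro i hi
    simp [hX, euler]
  · intro i j k hij hjk hk hle
    rw [sub i j hij, cub _ (sub_nonneg.2 (mono i j hij))] at hle
    have := h.norm_delta2_germ_le hf hG1 (nn i) (mono i j hij) (mono j k hjk) (mem k hk) hle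
    rw [sub i k (hij.trans hjk), cub _ (sub_nonneg.2 (mono i k (hij.trans hjk)))]
    calc ‖X k - X i - germ f ζ Z σ (i * η) (k * η) (X i)‖
        = ‖(X j - X i - germ f ζ Z σ (i * η) (j * η) (X i))
          + (X k - X j - germ f ζ Z σ (j * η) (k * η) (X j))
          - (germ f ζ Z σ (i * η) (k * η) (X i) - germ f ζ Z σ (i * η) (j * η) (X i)
            - germ f ζ Z σ (j * η) (k * η) (X j))‖ := by congr 1; abel
      _ ≤ _ := (norm_sub_le _ _).trans (add_le_add (norm_add_le _ _) this)

/-- Existence of solutions in the sense of Davie, with a constant that is uniform over the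
drifts. -/
theorem RoughData.exists_isDavie (h : RoughData T κ M ζ Z σ) (hT : 0 < T)
    (hf : DriftBounds T M f) (y : Vec m) :
    ∃ x : ℝ → Vec m, x 0 = y ∧ IsDavie T κ (eulerConst κ M ^ 3) f ζ Z σ x := by
  have hM := h.one_le
  have hκ := h.kappa_pos
  have hG := h.one_le_eulerConst
  set G := eulerConst κ M with hGdef
  -- The scheme makes n + 1 steps and ends exactly at T. Between grid points `x n` is constant, and
  -- `π n t` is t rounded down to the grid.
  let η : ℕ → ℝ := fun n => T / (n + 1)
  let fl : ℕ → ℝ → ℕ := fun n t => ⌊t / η n⌋₊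
  let π : ℕ → ℝ → ℝ := fun n t => fl n t * η n
  let x : ℕ → ℝ → Vec m := fun n t => euler f ζ Z σ (η n) y (fl n t)
  have hη : ∀ n, 0 < η n := fun n => by positivity
  have hNη : ∀ n : ℕ, ((n + 1 : ℕ) : ℝ) * η n ≤ T := fun n => by
    simp only [η]; push_cast; rw [mul_div_cancel₀ _ (by positivity)]
  have flmono : ∀ n s t, s ≤ t → fl n s ≤ fl n t := fun n s t hst =>
    Nat.floor_mono (div_le_div_of_nonneg_right hst (hη n).le)
  have flN : ∀ n t, t ≤ T → fl n t ≤ n + 1 := by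
    intro n t ht
    refine Nat.floor_le_of_le ?_
    rw [div_le_iff₀ (hη n)]
    simp only [η]; push_cast; rw [mul_div_cancel₀ _ (by positivity)]; exact ht
  have π0 : ∀ n t, 0 ≤ π n t := fun n t => mul_nonneg (Nat.cast_nonneg _) (hη n).le
  have πle : ∀ n t, 0 ≤ t → π n t ≤ t := fun n t ht => by
    have := Nat.floor_le (div_nonneg ht (hη n).le)
    exact (le_div_iff₀ (hη n)).1 this
  have πge : ∀ n t, t - η n ≤ π n t := fun n t => by
    have h1 := (Nat.lt_floor_add_one (t / η n)).le
    rw [div_le_iff₀ (hη n)] at h1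
    simp only [π, fl]
    linarith
  have πmono : ∀ n s t, s ≤ t → π n s ≤ π n t := fun n s t hst =>
    mul_le_mul_of_nonneg_right (by exact_mod_cast flmono n s t hst) (hη n).le
  have ηlim : Tendsto η atTop (𝓝 0) := by
    have := (tendsto_one_div_add_atTop_nhds_zero_nat (𝕜 := ℝ)).const_mul T
    simpa [η, div_eq_mul_inv] using this
  have πlim : ∀ t, 0 ≤ t → Tendsto (fun n => π n t) atTop (𝓝 t) := fun t ht =>
    tendsto_of_tendsto_of_tendsto_of_le_of_le (by simpa using ηlim.const_sub t)
      tendsto_const_nhds (fun n => πge n t) (fun n => πle n t ht)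
  have est : ∀ n s t, 0 ≤ s → s ≤ t → t ≤ T →
      ‖x n t - x n s - germ f ζ Z σ (π n s) (π n t) (x n s)‖
        ≤ G ^ 3 * ((π n t - π n s) ^ κ) ^ 3 := fun n s t _ hst ht =>
    h.euler_estimate hf y (hη n).le (hNη n) _ _ (flmono n s t hst) (flN n t ht)
  have x0 : ∀ n, x n 0 = y := fun n => by simp [x, fl, euler]
  have bdd : ∀ n t, t ∈ Icc 0 T → x n t ∈ Metric.closedBall y (3 * M ^ 3 * M + G ^ 3 * M ^ 3) := by
    intro n t ht
    have h1 := est n 0 t le_rfl ht.1 ht.2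
    have hπ0 : π n 0 = 0 := by simp [π, fl]
    rw [hπ0, x0, sub_zero] at h1
    have h2 := h.norm_germ_le hf le_rfl (π0 n t) ((πle n t ht.1).trans ht.2) y
    rw [sub_zero] at h2
    have h3 := h.rpow_kappa_le (π0 n t) ((πle n t ht.1).trans ht.2)
    have h4 : 0 ≤ (π n t) ^ κ := Real.rpow_nonneg (π0 n t) _
    rw [mem_closedBall_iff_norm]
    calc ‖x n t - y‖ = ‖germ f ζ Z σ 0 (π n t) y + (x n t - y - germ f ζ Z σ 0 (π n t) y)‖ := by
          congr 1; abel
      _ ≤ _ := norm_add_le _ _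
      _ ≤ _ := add_le_add (h2.trans (by gcongr)) (h1.trans (by gcongr))
  -- Bounded values converge along an ultrafilter at every time simultaneously. Davie's inequality
  -- involves only two times, so pointwise limits are enough and no equicontinuity is needed.
  set 𝒰 : Ultrafilter ℕ := hyperfilter ℕ with h𝒰
  have h𝒰le : (𝒰 : Filter ℕ) ≤ atTop := Nat.hyperfilter_le_atTop
  have lim : ∀ t, ∃ z, t ∈ Icc 0 T → Tendsto (fun n => x n t) 𝒰 (𝓝 z) := by
    intro t
    by_cases ht : t ∈ Icc 0 T
    · obtain ⟨z, -, hz⟩ := (isCompact_closedBall y _).ultrafilter_le_nhds (𝒰.map fun n => x n t)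
        (by
          rw [Ultrafilter.coe_map, le_principal_iff, mem_map]
          exact univ_mem' fun n => bdd n t ht)
      exact ⟨z, fun _ => hz⟩
    · exact ⟨0, fun h => absurd h ht⟩
  choose X hX using lim
  refine ⟨X, ?_, fun s t hs hst ht => ?_⟩
  · have h1 := hX 0 ⟨le_rfl, hT.le⟩
    simp only [x0] at h1
    exact tendsto_nhds_unique h1 tendsto_const_nhds
  · have sT : s ∈ Icc 0 T := ⟨hs, hst.trans ht⟩
    have tT : t ∈ Icc 0 T := ⟨hs.trans hst, ht⟩
    have ls := (πlim s hs).mono_left h𝒰le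
    have lt := (πlim t tT.1).mono_left h𝒰le
    have lg : Tendsto (fun n => germ f ζ Z σ (π n s) (π n t) (x n s)) 𝒰
        (𝓝 (germ f ζ Z σ s t (X s))) :=
      (hf.tendsto_integral (by linarith) (fun n => π0 n s) (fun n => πle n s hs) hst
        (fun n => πmono n s t hst) (fun n => πle n t tT.1) ht ls lt (hX s sT)).add
      (h.tendsto_roughGerm (fun n => π0 n s) (fun n => πle n s hs) hst
        (fun n => πmono n s t hst) (fun n => πle n t tT.1) ht ls lt (hX s sT))
    have lr : Tendsto (fun n => G ^ 3 * ((π n t - π n s) ^ κ) ^ 3) 𝒰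
        (𝓝 (G ^ 3 * ((t - s) ^ κ) ^ 3)) :=
      (((lt.sub ls).rpow_const (Or.inr hκ.le)).pow 3).const_mul _
    exact le_of_tendsto_of_tendsto (((hX t tT).sub (hX s sT)).sub lg).norm lr
      (Eventually.of_forall fun n => est n s t hs hst ht)

end Existence

/-! ### Uniqueness of Davie solutions. -/

section Uniqueness

variable {m d : ℕ} {T κ M : ℝ} {ζ : ℝ → Vec d} {Z : ℝ → ℝ → Matrix (Fin d) (Fin d) ℝ}
  {σ : ℝ → Vec m → Vec d →L[ℝ] Vec m} {f : ℝ → Vec m → Vec m} {x x' : ℝ → Vec m}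

lemma DriftBounds.mono {c c' : ℝ} (hf : DriftBounds T c f) (h : c ≤ c') : DriftBounds T c' f :=
  ⟨hf.cont, fun u hu p => (hf.bdd u hu p).trans h, fun u hu p q => (hf.lip u hu p q).trans
    (by gcongr)⟩

lemma IsDavie.mono {Γ Γ' : ℝ} (hx : IsDavie T κ Γ f ζ Z σ x) (h : Γ ≤ Γ') :
    IsDavie T κ Γ' f ζ Z σ x := fun s t hs hst ht =>
  (hx s t hs hst ht).trans (mul_le_mul_of_nonneg_right h
    (pow_nonneg (Real.rpow_nonneg (sub_nonneg.2 hst) _) 3))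

lemma IsDavie.norm_sub_sig_le (hx : IsDavie T κ M f ζ Z σ x) (h : RoughData T κ M ζ Z σ)
    (hf : DriftBounds T M f) {s t : ℝ} (hs : 0 ≤ s) (hst : s ≤ t) (ht : t ≤ T) :
    ‖x t - x s - σ s (x s) (delta1 ζ s t)‖ ≤ 3 * M ^ 2 * ((t - s) ^ κ) ^ 2 := by
  have hM := h.one_le
  have h1 := h.norm_germ_sub_le hf hs hst ht (x s)
  have h2 := hx s t hs hst ht
  have h3 := h.rpow_kappa_le (sub_nonneg.2 hst) (by linarith)
  have h0 : 0 ≤ (t - s) ^ κ := Real.rpow_nonneg (sub_nonneg.2 hst) _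
  set ξ := (t - s) ^ κ
  calc ‖x t - x s - σ s (x s) (delta1 ζ s t)‖
      = ‖(germ f ζ Z σ s t (x s) - σ s (x s) (delta1 ζ s t))
        + (x t - x s - germ f ζ Z σ s t (x s))‖ := by congr 1; abel
    _ ≤ 2 * M ^ 2 * ξ ^ 2 + M * (M * ξ ^ 2) := by
        refine (norm_add_le _ _).trans (add_le_add h1 (h2.trans ?_))
        rw [pow_succ' ξ 2]
        gcongr
    _ = _ := by ring

lemma IsDavie.norm_sub_le (hx : IsDavie T κ M f ζ Z σ x) (h : RoughData T κ M ζ Z σ)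
    (hf : DriftBounds T M f) {s t : ℝ} (hs : 0 ≤ s) (hst : s ≤ t) (ht : t ≤ T) :
    ‖x t - x s‖ ≤ 4 * M ^ 3 * (t - s) ^ κ := by
  have hM := h.one_le
  have h1 := h.norm_germ_le hf hs hst ht (x s)
  have h2 := hx s t hs hst ht
  have h3 := h.rpow_kappa_le (sub_nonneg.2 hst) (by linarith)
  have h0 : 0 ≤ (t - s) ^ κ := Real.rpow_nonneg (sub_nonneg.2 hst) _
  set ξ := (t - s) ^ κ
  calc ‖x t - x s‖ = ‖germ f ζ Z σ s t (x s) + (x t - x s - germ f ζ Z σ s t (x s))‖ := by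
        congr 1; abel
    _ ≤ 3 * M ^ 3 * ξ + M * (M ^ 2 * ξ) := by
        refine (norm_add_le _ _).trans (add_le_add h1 (h2.trans ?_))
        rw [pow_succ ξ 2]
        gcongr
    _ = _ := by ring

lemma continuousOn_of_holder {V : Type*} [NormedAddCommGroup V] {g : ℝ → V} {C T κ : ℝ}
    (hκ : 0 < κ)
    (hg : ∀ s t, 0 ≤ s → s ≤ t → t ≤ T → ‖g t - g s‖ ≤ C * (t - s) ^ κ) :
    ContinuousOn g (Icc 0 T) := by
  intro t ht
  have hb : ∀ s ∈ Icc 0 T, ‖g s - g t‖ ≤ C * |s - t| ^ κ := by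
    intro s hs
    rcases le_total s t with h | h
    · rw [norm_sub_rev, abs_sub_comm, abs_of_nonneg (sub_nonneg.2 h)]
      exact hg s t hs.1 h ht.2
    · rw [abs_of_nonneg (sub_nonneg.2 h)]
      exact hg t s ht.1 h hs.2
  rw [ContinuousWithinAt, tendsto_iff_norm_sub_tendsto_zero]
  refine squeeze_zero' (Eventually.of_forall fun _ => norm_nonneg _)
    (eventually_nhdsWithin_of_forall hb) ?_
  have h1 : Tendsto (fun s : ℝ => |s - t|) (𝓝[Icc 0 T] t) (𝓝 0) := by
    have : Tendsto (fun s : ℝ => |s - t|) (𝓝 t) (𝓝 |t - t|) :=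
      (continuous_id.sub continuous_const).abs.tendsto t
    rw [sub_self, abs_zero] at this
    exact this.mono_left nhdsWithin_le_nhds
  simpa [Real.zero_rpow hκ.ne'] using (h1.rpow_const (p := κ) (Or.inr hκ.le)).const_mul C

lemma IsDavie.continuousOn (hx : IsDavie T κ M f ζ Z σ x) (h : RoughData T κ M ζ Z σ)
    (hf : DriftBounds T M f) : ContinuousOn x (Icc 0 T) :=
  continuousOn_of_holder h.kappa_pos fun _ _ hs hst ht => hx.norm_sub_le h hf hs hst ht

lemma DriftBounds.continuousOn_comp (hf : DriftBounds T M f) (hx : ContinuousOn x (Icc 0 T)) :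
    ContinuousOn (fun u => f u (x u)) (Icc 0 T) := by
  intro u hu
  have h1 : Tendsto (fun v => f v (x u)) (𝓝[Icc 0 T] u) (𝓝 (f u (x u))) := hf.cont (x u) u hu
  have h2 : Tendsto (fun v => f v (x v) - f v (x u)) (𝓝[Icc 0 T] u) (𝓝 0) := by
    refine squeeze_zero_norm' (a := fun v => M * ‖x v - x u‖)
      (eventually_nhdsWithin_of_forall fun v hv => hf.lip v hv _ _) ?_
    simpa using (tendsto_iff_norm_sub_tendsto_zero.1 (hx u hu)).const_mul M
  have := h2.add h1
  simp only [sub_add_cancel, zero_add] at this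
  exact this

lemma DriftBounds.intervalIntegrable_comp (hf : DriftBounds T M f)
    (hx : ContinuousOn x (Icc 0 T)) {s t : ℝ} (hs : 0 ≤ s) (hst : s ≤ t) (ht : t ≤ T) :
    IntervalIntegrable (fun u => f u (x u)) volume s t := by
  refine ContinuousOn.intervalIntegrable ((hf.continuousOn_comp hx).mono ?_)
  rw [uIcc_of_le hst]
  exact Icc_subset_Icc hs ht

/-- Freezing the drift along a Hölder path costs an error of order `1 + κ`. -/
lemma DriftBounds.norm_integral_freeze_le (hf : DriftBounds T M f) (hM : 0 ≤ M) {C κ : ℝ}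
    (hC : 0 ≤ C) (hκ : 0 < κ)
    (hx : ∀ s t, 0 ≤ s → s ≤ t → t ≤ T → ‖x t - x s‖ ≤ C * (t - s) ^ κ) {s t : ℝ} (hs : 0 ≤ s)
    (hst : s ≤ t) (ht : t ≤ T) :
    ‖(∫ u in s..t, f u (x u)) - ∫ u in s..t, f u (x s)‖ ≤ M * C * (t - s) ^ κ * (t - s) := by
  have hc := continuousOn_of_holder hκ hx
  rw [← intervalIntegral.integral_sub (hf.intervalIntegrable_comp hc hs hst ht)
    (hf.intervalIntegrable (x s) hs hst ht)]
  have := intervalIntegral.norm_integral_le_of_norm_le_const (a := s) (b := t)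
    (f := fun u => f u (x u) - f u (x s)) (C := M * C * (t - s) ^ κ) (fun u hu => by
      rw [uIoc_of_le hst] at hu
      refine (hf.lip u ⟨hs.trans hu.1.le, hu.2.trans ht⟩ _ _).trans ?_
      rw [mul_assoc]
      refine mul_le_mul_of_nonneg_left ((hx s u hs hu.1.le (hu.2.trans ht)).trans ?_) hM
      gcongr
      · linarith [hu.1]
      · exact hu.2)
  rwa [abs_of_nonneg (sub_nonneg.2 hst)] at this

/-- With the drift integrated along the path instead of frozen, its contribution is additive in time
and drops out of `delta2`. The exchange costs order 1 + κ ≥ 3κ. -/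
lemma IsDavie.norm_integrated_le (hx : IsDavie T κ M f ζ Z σ x) (h : RoughData T κ M ζ Z σ)
    (hf : DriftBounds T M f) {s t : ℝ} (hs : 0 ≤ s) (hst : s ≤ t) (ht : t ≤ T) :
    ‖x t - x s - (∫ u in s..t, f u (x u)) - roughGerm ζ Z σ s t (x s)‖
      ≤ 5 * M ^ 5 * ((t - s) ^ κ) ^ 3 := by
  have hM := h.one_le
  have h1 := hx s t hs hst ht
  have h2 := hf.norm_integral_freeze_le (by linarith) (by positivity) h.kappa_pos
    (fun s t hs hst ht => hx.norm_sub_le h hf hs hst ht) hs hst ht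
  have h3 := h.le_sq (sub_nonneg.2 hst) (by linarith)
  have h0 : 0 ≤ (t - s) ^ κ := Real.rpow_nonneg (sub_nonneg.2 hst) _
  set ξ := (t - s) ^ κ
  calc _ = ‖(x t - x s - germ f ζ Z σ s t (x s))
        - ((∫ u in s..t, f u (x u)) - ∫ u in s..t, f u (x s))‖ := by
        rw [germ]; congr 1; abel
    _ ≤ M * ξ ^ 3 + M * (4 * M ^ 3) * ξ * (M * ξ ^ 2) := by
        refine (_root_.norm_sub_le _ _).trans (add_le_add h1 (h2.trans ?_))
        gcongr
    _ = M * ξ ^ 3 + 4 * M ^ 5 * ξ ^ 3 := by ring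
    _ ≤ M ^ 5 * ξ ^ 3 + 4 * M ^ 5 * ξ ^ 3 := by
        gcongr
        exact le_self_pow₀ hM (by norm_num)
    _ = _ := by ring

/-- The difference of the integrated remainders of two solutions. -/
noncomputable def remDiff (f : ℝ → Vec m → Vec m) (ζ : ℝ → Vec d)
    (Z : ℝ → ℝ → Matrix (Fin d) (Fin d) ℝ) (σ : ℝ → Vec m → Vec d →L[ℝ] Vec m)
    (x x' : ℝ → Vec m) (s t : ℝ) : Vec m :=
  (x t - x s - (∫ u in s..t, f u (x u)) - roughGerm ζ Z σ s t (x s))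
    - (x' t - x' s - (∫ u in s..t, f u (x' u)) - roughGerm ζ Z σ s t (x' s))

/-- Estimates for the increments of the difference of two solutions on a short interval. -/
lemma norm_increment_sub_le (h : RoughData T κ M ζ Z σ) (hf : DriftBounds T M f)
    (hx : IsDavie T κ M f ζ Z σ x) (hx' : IsDavie T κ M f ζ Z σ x') {A B S Θ η : ℝ} (hA : 0 ≤ A)
    (hB : B ≤ T) (hη1 : η ≤ 1) (hAB : B - A ≤ η) (hS : ∀ t ∈ Icc A B, ‖x t - x' t‖ ≤ S)
    (hΘ0 : 0 ≤ Θ)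
    (hΘ : ∀ s t, A ≤ s → s ≤ t → t ≤ B →
      ‖remDiff f ζ Z σ x x' s t‖ ≤ Θ * (t - s) ^ (2 / 3 + κ)) {s u : ℝ} (hs : A ≤ s) (hsu : s ≤ u)
    (hu : u ≤ B) :
    ‖(x u - x s) - (x' u - x' s) - (σ s (x s) - σ s (x' s)) (delta1 ζ s u)‖
      ≤ 2 * M ^ 2 * (S + Θ * η ^ (1 / 6 : ℝ)) * ((u - s) ^ κ) ^ 2 ∧
    ‖(x u - x s) - (x' u - x' s)‖ ≤ 3 * M ^ 2 * (S + Θ * η ^ (1 / 6 : ℝ)) * (u - s) ^ κ := by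
  have hM := h.one_le
  have hM0 : 0 ≤ M := by linarith
  have hκ := h.kappa_pos
  have hκ2 := h.rough.exp_le
  have sT : s ∈ Icc 0 T := ⟨by linarith, by linarith⟩
  have sAB : s ∈ Icc A B := ⟨by linarith, by linarith⟩
  have τ0 : 0 ≤ u - s := by linarith
  have τ1 : u - s ≤ 1 := by linarith
  have S0 : 0 ≤ S := (norm_nonneg _).trans (hS s sAB)
  have η0 : 0 ≤ η := by linarith
  have H0 : 0 ≤ η ^ (1 / 6 : ℝ) := Real.rpow_nonneg η0 _
  set H := η ^ (1 / 6 : ℝ) with hH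
  set P := S + Θ * H with hP
  have SP : S ≤ P := by rw [hP]; linarith [mul_nonneg hΘ0 H0]
  have P0 : 0 ≤ P := S0.trans SP
  have ξ0 : 0 ≤ (u - s) ^ κ := Real.rpow_nonneg τ0 _
  have ξ1 : (u - s) ^ κ ≤ 1 := Real.rpow_le_one τ0 τ1 hκ.le
  have τξ : u - s ≤ ((u - s) ^ κ) ^ 2 := by
    rw [← Real.rpow_two, ← Real.rpow_mul τ0]
    have := Real.rpow_le_rpow_of_exponent_ge' τ0 τ1 (by linarith) (by linarith : κ * 2 ≤ 1)
    rwa [Real.rpow_one] at this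
  -- Since κ ≤ 1/2, the exponent 2/3 + κ exceeds 2κ by at least 1/6. This surplus is the small
  -- factor in front of Θ.
  have gain : (u - s) ^ (2 / 3 + κ) ≤ H * ((u - s) ^ κ) ^ 2 := by
    have e : (u - s) ^ (2 / 3 + κ) = (u - s) ^ (2 / 3 - κ) * ((u - s) ^ κ) ^ 2 := by
      rw [← Real.rpow_two, ← Real.rpow_mul τ0, ← Real.rpow_add_of_nonneg τ0 (by linarith)
        (by linarith)]
      congr 1; ring
    rw [e]
    refine mul_le_mul_of_nonneg_right ?_ (sq_nonneg _)
    calc (u - s) ^ (2 / 3 - κ) ≤ (u - s) ^ (1 / 6 : ℝ) :=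
          Real.rpow_le_rpow_of_exponent_ge' τ0 τ1 (by norm_num) (by linarith)
      _ ≤ H := Real.rpow_le_rpow τ0 (by linarith) (by norm_num)
  set ξ := (u - s) ^ κ with hξ
  have cx := hx.continuousOn h hf
  have cx' := hx'.continuousOn h hf
  have I := hf.intervalIntegrable_comp cx sT.1 hsu (hu.trans hB)
  have I' := hf.intervalIntegrable_comp cx' sT.1 hsu (hu.trans hB)
  have zs := hS s sAB
  have n1 : ‖(∫ w in s..u, f w (x w)) - ∫ w in s..u, f w (x' w)‖ ≤ M * S * ξ ^ 2 := by
    rw [← intervalIntegral.integral_sub I I']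
    have := intervalIntegral.norm_integral_le_of_norm_le_const (a := s) (b := u)
      (f := fun w => f w (x w) - f w (x' w)) (C := M * S) (fun w hw => by
        rw [uIoc_of_le hsu] at hw
        refine (hf.lip w ⟨by linarith [hw.1], by linarith [hw.2]⟩ _ _).trans ?_
        exact mul_le_mul_of_nonneg_left (hS w ⟨by linarith [hw.1], by linarith [hw.2]⟩) hM0)
    rw [abs_of_nonneg τ0] at this
    exact this.trans (by gcongr)
  have n2 : ‖contract (RoughControl.gub σ s (x s) - RoughControl.gub σ s (x' s)) (Z s u)‖
      ≤ M * S * (M * ξ ^ 2) := by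
    refine (h.rough.norm_contract_le _ sT.1 hsu (by linarith)).trans ?_
    exact mul_le_mul_of_nonneg_right ((h.gub.lip s sT _ _).trans (by gcongr)) (by positivity)
  have n3 : ‖(σ s (x s) - σ s (x' s)) (delta1 ζ s u)‖ ≤ M * S * (M * ξ) :=
    (ContinuousLinearMap.le_opNorm _ _).trans
      (mul_le_mul ((h.sig.lip s sT _ _).trans (by gcongr))
        (h.rough.path s u sT.1 hsu (by linarith)) (norm_nonneg _) (by positivity))
  have n4 : ‖remDiff f ζ Z σ x x' s u‖ ≤ Θ * (H * ξ ^ 2) :=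
    (hΘ s u hs hsu hu).trans (by gcongr)
  have e : (x u - x s) - (x' u - x' s) - (σ s (x s) - σ s (x' s)) (delta1 ζ s u)
      = remDiff f ζ Z σ x x' s u + ((∫ w in s..u, f w (x w)) - ∫ w in s..u, f w (x' w))
        + contract (RoughControl.gub σ s (x s) - RoughControl.gub σ s (x' s)) (Z s u) := by
    rw [contract_sub]
    simp only [remDiff, roughGerm, sub_apply]
    abel
  have U1 : ‖(x u - x s) - (x' u - x' s) - (σ s (x s) - σ s (x' s)) (delta1 ζ s u)‖
      ≤ 2 * M ^ 2 * P * ξ ^ 2 := by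
    rw [e]
    refine (norm_add_le _ _).trans ((add_le_add ((norm_add_le _ _).trans (add_le_add n4 n1))
      n2).trans ?_)
    have M2 : 1 ≤ M ^ 2 := one_le_pow₀ hM
    have k1 : M * S * ξ ^ 2 ≤ M ^ 2 * (S * ξ ^ 2) := by
      rw [mul_assoc]; gcongr; exact le_self_pow₀ hM (by norm_num)
    have k2 : Θ * H * ξ ^ 2 ≤ M ^ 2 * (Θ * H * ξ ^ 2) := le_mul_of_one_le_left (by positivity) M2
    have k3 : 0 ≤ M ^ 2 * (Θ * H * ξ ^ 2) := by positivity
    rw [hP]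
    nlinarith
  refine ⟨U1, ?_⟩
  calc ‖(x u - x s) - (x' u - x' s)‖
      = ‖((x u - x s) - (x' u - x' s) - (σ s (x s) - σ s (x' s)) (delta1 ζ s u))
        + (σ s (x s) - σ s (x' s)) (delta1 ζ s u)‖ := by congr 1; abel
    _ ≤ _ := norm_add_le _ _
    _ ≤ 2 * M ^ 2 * P * ξ + M * P * (M * ξ) := by
        refine add_le_add (U1.trans ?_) (n3.trans ?_)
        · have : ξ ^ 2 ≤ ξ := by rw [pow_two]; exact mul_le_of_le_one_left ξ0 ξ1
          gcongr
        · gcongr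
    _ = _ := by ring

lemma LipBounds.norm_increment_sub_le {E W : Type*} [NormedAddCommGroup E] [NormedAddCommGroup W]
    [NormedSpace ℝ W] {T M : ℝ} {g : ℝ → E → W} (h : LipBounds T M g) {u s : ℝ}
    (hu : u ∈ Icc 0 T) (hs : s ∈ Icc 0 T) (p q p' q' : E) :
    ‖(g u q - g s p) - (g u q' - g s p')‖ ≤ M * |u - s| ^ (1 / 3 : ℝ) * ‖q - q'‖
      + M * ((‖q - p‖ + ‖q' - p'‖) * ‖p - p'‖ + ‖(q - p) - (q' - p')‖) := by
  calc _ = ‖((g u q - g s q) - (g u q' - g s q')) + ((g s q - g s p) - (g s q' - g s p'))‖ := by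
        congr 1; abel
    _ ≤ _ := norm_add_le _ _
    _ ≤ _ := add_le_add (h.time_lip u hu s hs q q') (h.four s hs p q p' q')

/-- The four terms are the change of time, the difference of Taylor remainders, the change of the
gradient, and the gradient applied to the difference of the path remainders. Each carries a factor
that measures the difference of the two solutions. -/
lemma SmoothBounds.norm_remainder_sub_le (h : SmoothBounds T M σ) {u s : ℝ}
    (hu : u ∈ Icc 0 T) (hs : s ∈ Icc 0 T) (p q p' q' : Vec m) (v : Vec d) :
    ‖(σ u q - σ s p - gub σ s p v) - (σ u q' - σ s p' - gub σ s p' v)‖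
      ≤ M * |u - s| ^ (2 / 3 : ℝ) * ‖q - q'‖
        + M * (‖q - p‖ ^ 2 * ‖p - p'‖ + (‖q - p‖ + ‖q' - p'‖) * ‖(q - p) - (q' - p')‖)
        + M * ‖p - p'‖ * ‖q - p - σ s p v‖
        + M * ‖(q - p) - (q' - p') - (σ s p - σ s p') v‖ := by
  have hM0 : 0 ≤ M := by linarith [h.one_le]
  have e : (σ u q - σ s p - gub σ s p v) - (σ u q' - σ s p' - gub σ s p' v)
      = ((σ u q - σ s q) - (σ u q' - σ s q'))
        + ((σ s q - σ s p - fderiv ℝ (σ s) p (q - p))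
          - (σ s q' - σ s p' - fderiv ℝ (σ s) p' (q' - p')))
        + (fderiv ℝ (σ s) p - fderiv ℝ (σ s) p') (q - p - σ s p v)
        + fderiv ℝ (σ s) p' ((q - p) - (q' - p') - (σ s p - σ s p') v) := by
    simp only [gub, ContinuousLinearMap.comp_apply, map_sub, sub_apply]
    abel
  have n1 : ‖(σ u q - σ s q) - (σ u q' - σ s q')‖ ≤ M * |u - s| ^ (2 / 3 : ℝ) * ‖q - q'‖ :=
    norm_sub_le_of_norm_fderiv_le (φ := fun x => σ u x - σ s x)
      ((h.diff u hu).sub (h.diff s hs)) (fun x => by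
        rw [fderiv_fun_sub (h.diff u hu x) (h.diff s hs x)]
        exact h.time' u hu s hs x) q q'
  have n2 := norm_taylor_four_point_le hM0 (h.diff s hs) (h.diff' s hs) (h.bdd'' s hs)
    (h.lip'' s hs) p (q - p) p' (q' - p')
  simp only [add_sub_cancel] at n2
  have n3 : ‖(fderiv ℝ (σ s) p - fderiv ℝ (σ s) p') (q - p - σ s p v)‖
      ≤ M * ‖p - p'‖ * ‖q - p - σ s p v‖ :=
    (ContinuousLinearMap.le_opNorm _ _).trans (mul_le_mul_of_nonneg_right
      (norm_sub_le_of_norm_fderiv_le (h.diff' s hs) (h.bdd'' s hs) p p') (norm_nonneg _))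
  have n4 : ‖fderiv ℝ (σ s) p' ((q - p) - (q' - p') - (σ s p - σ s p') v)‖
      ≤ M * ‖(q - p) - (q' - p') - (σ s p - σ s p') v‖ :=
    (ContinuousLinearMap.le_opNorm _ _).trans (mul_le_mul_of_nonneg_right
      (h.bdd' s hs p') (norm_nonneg _))
  rw [e]
  exact (norm_add_le _ _).trans (add_le_add ((norm_add_le _ _).trans (add_le_add
    ((norm_add_le _ _).trans (add_le_add n1 n2)) n3)) n4)

/-- The increment of the difference of the remainders of two solutions. -/
lemma norm_delta2_remDiff_le (h : RoughData T κ M ζ Z σ) (hf : DriftBounds T M f)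
    (hx : IsDavie T κ M f ζ Z σ x) (hx' : IsDavie T κ M f ζ Z σ x') {A B S Θ η : ℝ} (hA : 0 ≤ A)
    (hB : B ≤ T) (hη1 : η ≤ 1) (hAB : B - A ≤ η) (hS : ∀ t ∈ Icc A B, ‖x t - x' t‖ ≤ S)
    (hΘ0 : 0 ≤ Θ)
    (hΘ : ∀ s t, A ≤ s → s ≤ t → t ≤ B →
      ‖remDiff f ζ Z σ x x' s t‖ ≤ Θ * (t - s) ^ (2 / 3 + κ)) {s u t : ℝ} (hs : A ≤ s)
    (hsu : s ≤ u) (hut : u ≤ t) (ht : t ≤ B) :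
    ‖delta2 (remDiff f ζ Z σ x x') s u t‖
      ≤ 58 * M ^ 8 * (S + Θ * η ^ (1 / 6 : ℝ)) * (t - s) ^ (2 / 3 + κ) := by
  have hM := h.one_le
  have hM0 : 0 ≤ M := by linarith
  have hκ := h.kappa_pos
  have hκ2 := h.rough.exp_le
  have hκ3 := h.rough.lt_exp
  have sT : s ∈ Icc 0 T := ⟨by linarith, by linarith⟩
  have uT : u ∈ Icc 0 T := ⟨by linarith, by linarith⟩
  have sAB : s ∈ Icc A B := ⟨by linarith, by linarith⟩
  have uAB : u ∈ Icc A B := ⟨by linarith, by linarith⟩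
  have S0 : 0 ≤ S := (norm_nonneg _).trans (hS s sAB)
  have η0 : 0 ≤ η := by linarith
  obtain ⟨U1, U2⟩ := norm_increment_sub_le h hf hx hx' hA hB hη1 hAB hS hΘ0 hΘ hs hsu
    (hut.trans ht)
  have H0 : 0 ≤ η ^ (1 / 6 : ℝ) := Real.rpow_nonneg η0 _
  set P := S + Θ * η ^ (1 / 6 : ℝ) with hP
  have SP : S ≤ P := by rw [hP]; linarith [mul_nonneg hΘ0 H0]
  have P0 : 0 ≤ P := S0.trans SP
  have τ0 : 0 ≤ t - s := by linarith
  have τ1 : t - s ≤ 1 := by linarith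
  have ξsu : (u - s) ^ κ ≤ (t - s) ^ κ := Real.rpow_le_rpow (by linarith) (by linarith) hκ.le
  have ξut : (t - u) ^ κ ≤ (t - s) ^ κ := Real.rpow_le_rpow (by linarith) (by linarith) hκ.le
  have ξsu0 : 0 ≤ (u - s) ^ κ := Real.rpow_nonneg (by linarith) _
  have ξut0 : 0 ≤ (t - u) ^ κ := Real.rpow_nonneg (by linarith) _
  have ψ0 : 0 ≤ (t - s) ^ (1 / 3 : ℝ) := Real.rpow_nonneg τ0 _
  have ξψ : (t - s) ^ κ ≤ (t - s) ^ (1 / 3 : ℝ) :=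
    Real.rpow_le_rpow_of_exponent_ge' τ0 τ1 (by norm_num) hκ3.le
  have χψ : (t - s) ^ (2 / 3 : ℝ) = ((t - s) ^ (1 / 3 : ℝ)) ^ 2 := by
    rw [← Real.rpow_two, ← Real.rpow_mul τ0]; norm_num
  -- The powers of ψ = (t - s)^{1/3} reflect the time regularity of ∇σ: the integrand remainders
  -- differ by order ψ² and meet an increment of ζ of order ξ. The increments of ∇σ σ differ by
  -- order ψ and meet an area of order ξ² ≤ ψξ.
  have eτ : (t - s) ^ (2 / 3 + κ) = ((t - s) ^ (1 / 3 : ℝ)) ^ 2 * (t - s) ^ κ := by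
    rw [← χψ, ← Real.rpow_add_of_nonneg τ0 (by norm_num) hκ.le]
  have ψsu : |u - s| ^ (1 / 3 : ℝ) ≤ (t - s) ^ (1 / 3 : ℝ) := by
    rw [abs_of_nonneg (by linarith)]
    exact Real.rpow_le_rpow (by linarith) (by linarith) (by norm_num)
  have χsu : |u - s| ^ (2 / 3 : ℝ) ≤ ((t - s) ^ (1 / 3 : ℝ)) ^ 2 := by
    rw [abs_of_nonneg (by linarith), ← χψ]
    exact Real.rpow_le_rpow (by linarith) (by linarith) (by norm_num)
  have v1 := hx.norm_sub_le h hf sT.1 hsu uT.2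
  have v1' := hx'.norm_sub_le h hf sT.1 hsu uT.2
  have w1 := hx.norm_sub_sig_le h hf sT.1 hsu uT.2
  rw [eτ]
  set ψ := (t - s) ^ (1 / 3 : ℝ) with hψ
  set ξ := (t - s) ^ κ with hξ
  have ξ0 : 0 ≤ ξ := ξsu0.trans ξsu
  have ψ1 : ψ ≤ 1 := Real.rpow_le_one τ0 τ1 (by norm_num)
  have hρ : ‖(σ u (x u) - σ s (x s) - RoughControl.gub σ s (x s) (delta1 ζ s u))
      - (σ u (x' u) - σ s (x' s) - RoughControl.gub σ s (x' s) (delta1 ζ s u))‖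
      ≤ 46 * M ^ 7 * P * ψ ^ 2 := by
    refine (h.smooth.norm_remainder_sub_le uT sT (x s) (x u) (x' s) (x' u) (delta1 ζ s u)).trans ?_
    have zu := (hS u uAB).trans SP
    have zs := (hS s sAB).trans SP
    have v2 : ‖x u - x s‖ ≤ 4 * M ^ 3 * ψ := v1.trans (by gcongr; exact ξsu.trans ξψ)
    have v2' : ‖x' u - x' s‖ ≤ 4 * M ^ 3 * ψ := v1'.trans (by gcongr; exact ξsu.trans ξψ)
    have w2 : ‖x u - x s - σ s (x s) (delta1 ζ s u)‖ ≤ 3 * M ^ 2 * ψ ^ 2 :=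
      w1.trans (by gcongr; exact ξsu.trans ξψ)
    have U1' := U1.trans (by gcongr; exact ξsu.trans ξψ :
      _ ≤ 2 * M ^ 2 * P * ψ ^ 2)
    have U2' := U2.trans (by gcongr; exact ξsu.trans ξψ : _ ≤ 3 * M ^ 2 * P * ψ)
    calc _ ≤ M * ψ ^ 2 * P
          + M * ((4 * M ^ 3 * ψ) ^ 2 * P + (4 * M ^ 3 * ψ + 4 * M ^ 3 * ψ) * (3 * M ^ 2 * P * ψ))
          + M * P * (3 * M ^ 2 * ψ ^ 2) + M * (2 * M ^ 2 * P * ψ ^ 2) := by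
          gcongr
      _ = (M + 16 * M ^ 7 + 24 * M ^ 6 + 5 * M ^ 3) * (P * ψ ^ 2) := by ring
      _ ≤ (M ^ 7 + 16 * M ^ 7 + 24 * M ^ 7 + 5 * M ^ 7) * (P * ψ ^ 2) := by
          gcongr
          · exact le_self_pow₀ hM (by norm_num)
          · norm_num
          · norm_num
      _ = _ := by ring
  have hg : ‖(RoughControl.gub σ u (x u) - RoughControl.gub σ s (x s))
      - (RoughControl.gub σ u (x' u) - RoughControl.gub σ s (x' s))‖ ≤ 12 * M ^ 4 * P * ψ := by
    refine (h.gub.norm_increment_sub_le uT sT (x s) (x u) (x' s) (x' u)).trans ?_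
    have zu := (hS u uAB).trans SP
    have zs := (hS s sAB).trans SP
    have v2 : ‖x u - x s‖ ≤ 4 * M ^ 3 * ψ := v1.trans (by gcongr; exact ξsu.trans ξψ)
    have v2' : ‖x' u - x' s‖ ≤ 4 * M ^ 3 * ψ := v1'.trans (by gcongr; exact ξsu.trans ξψ)
    have U2' := U2.trans (by gcongr; exact ξsu.trans ξψ : _ ≤ 3 * M ^ 2 * P * ψ)
    calc _ ≤ M * ψ * P + M * ((4 * M ^ 3 * ψ + 4 * M ^ 3 * ψ) * P + 3 * M ^ 2 * P * ψ) := by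
          gcongr
      _ = (M + 8 * M ^ 4 + 3 * M ^ 3) * (P * ψ) := by ring
      _ ≤ (M ^ 4 + 8 * M ^ 4 + 3 * M ^ 4) * (P * ψ) := by
          gcongr
          · exact le_self_pow₀ hM (by norm_num)
          · norm_num
      _ = _ := by ring
  have cx := hx.continuousOn h hf
  have cx' := hx'.continuousOn h hf
  have adj := intervalIntegral.integral_add_adjacent_intervals
    (hf.intervalIntegrable_comp cx sT.1 hsu uT.2)
    (hf.intervalIntegrable_comp cx uT.1 hut (ht.trans hB))
  have adj' := intervalIntegral.integral_add_adjacent_intervals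
    (hf.intervalIntegrable_comp cx' sT.1 hsu uT.2)
    (hf.intervalIntegrable_comp cx' uT.1 hut (ht.trans hB))
  have d1 := h.delta2_roughGerm sT.1 hsu hut (ht.trans hB) (x s) (x u)
  have d2 := h.delta2_roughGerm sT.1 hsu hut (ht.trans hB) (x' s) (x' u)
  -- The path increments and the integrated drifts are additive, so only the defects of the two
  -- rough germs remain.
  have e : delta2 (remDiff f ζ Z σ x x') s u t
      = ((σ u (x u) - σ s (x s) - RoughControl.gub σ s (x s) (delta1 ζ s u))
        - (σ u (x' u) - σ s (x' s) - RoughControl.gub σ s (x' s) (delta1 ζ s u))) (delta1 ζ u t)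
        + contract ((RoughControl.gub σ u (x u) - RoughControl.gub σ s (x s))
      - (RoughControl.gub σ u (x' u) - RoughControl.gub σ s (x' s))) (Z u t) := by
    have e1 : delta2 (remDiff f ζ Z σ x x') s u t
        = (roughGerm ζ Z σ s t (x' s) - roughGerm ζ Z σ s u (x' s) - roughGerm ζ Z σ u t (x' u))
          - (roughGerm ζ Z σ s t (x s) - roughGerm ζ Z σ s u (x s) - roughGerm ζ Z σ u t (x u)) := by
      simp only [delta2, remDiff]
      rw [← adj, ← adj']
      abel
    have gen : ∀ (a a' : Vec d →L[ℝ] Vec m) (c c' : Vec d →L[ℝ] Vec d →L[ℝ] Vec m) (v : Vec d)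
        (Y : Matrix (Fin d) (Fin d) ℝ), -(a' v + contract c' Y) - -(a v + contract c Y)
        = (a - a') v + contract (c - c') Y := by
      intro a a' c c' v Y
      rw [contract_sub, sub_apply]
      abel
    rw [e1, d1, d2]
    exact gen _ _ _ _ _ _
  have n1 : ‖((σ u (x u) - σ s (x s) - RoughControl.gub σ s (x s) (delta1 ζ s u))
        - (σ u (x' u) - σ s (x' s) - RoughControl.gub σ s (x' s) (delta1 ζ s u))) (delta1 ζ u t)‖
      ≤ 46 * M ^ 7 * P * ψ ^ 2 * (M * ξ) :=
    (ContinuousLinearMap.le_opNorm _ _).trans (mul_le_mul hρ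
      ((h.rough.path u t uT.1 hut (ht.trans hB)).trans (by gcongr)) (norm_nonneg _) (by positivity))
  have n2 : ‖contract ((RoughControl.gub σ u (x u) - RoughControl.gub σ s (x s))
      - (RoughControl.gub σ u (x' u) - RoughControl.gub σ s (x' s))) (Z u t)‖
      ≤ 12 * M ^ 4 * P * ψ * (M * (ψ * ξ)) :=
    (h.rough.norm_contract_le _ uT.1 hut (ht.trans hB)).trans (mul_le_mul hg
      (by rw [pow_two]; gcongr; exact ξut.trans ξψ) (by positivity) (by positivity))
  rw [e]
  refine (norm_add_le _ _).trans ((add_le_add n1 n2).trans ?_)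
  calc _ = 46 * M ^ 8 * (P * (ψ ^ 2 * ξ)) + 12 * M ^ 5 * (P * (ψ ^ 2 * ξ)) := by ring
    _ ≤ 46 * M ^ 8 * (P * (ψ ^ 2 * ξ)) + 12 * M ^ 8 * (P * (ψ ^ 2 * ξ)) := by
        gcongr
        · norm_num
    _ = _ := by ring

/-- Uniqueness on short intervals. -/
lemma eqOn_of_short (h : RoughData T κ M ζ Z σ) (hf : DriftBounds T M f)
    (hx : IsDavie T κ M f ζ Z σ x) (hx' : IsDavie T κ M f ζ Z σ x') {A B η : ℝ} (hA : 0 ≤ A)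
    (hB : B ≤ T) (hη1 : η ≤ 1) (hAB : B - A ≤ η) (hηM : M * η ≤ 1 / 2)
    (hηH : 6 * (58 * M ^ 8 / (1 - 2 ^ (1 - (2 / 3 + κ)))) * η ^ (1 / 6 : ℝ) ≤ 1)
    (h0 : x A = x' A) : ∀ t ∈ Icc A B, x t = x' t := by
  intro t₀ ht₀
  have hM := h.one_le
  have hM0 : 0 ≤ M := by linarith
  have hκ := h.kappa_pos
  have hκ3 := h.rough.lt_exp
  have hle : A ≤ B := ht₀.1.trans ht₀.2
  have η0 : 0 ≤ η := by linarith
  have cx := (hx.continuousOn h hf).mono (Icc_subset_Icc hA hB)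
  have cx' := (hx'.continuousOn h hf).mono (Icc_subset_Icc hA hB)
  obtain ⟨τ, hτ, hmax⟩ := isCompact_Icc.exists_isMaxOn (nonempty_Icc.2 hle) (cx.sub cx').norm
  set S := ‖x τ - x' τ‖ with hSdef
  have hS : ∀ t ∈ Icc A B, ‖x t - x' t‖ ≤ S := fun t ht => hmax ht
  have S0 : 0 ≤ S := norm_nonneg _
  have H0 : 0 ≤ η ^ (1 / 6 : ℝ) := Real.rpow_nonneg η0 _
  set H := η ^ (1 / 6 : ℝ) with hH
  set a := 2 / 3 + κ with ha
  have ha1 : 1 < a := by rw [ha]; linarith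
  have hθ : 0 < 1 - (2 : ℝ) ^ (1 - a) := sub_pos.2 (two_rpow_lt_one ha1)
  -- The solutions agree at A, so the rough germs cancel over [A, τ]. What is left is the remainder,
  -- at most ΘH, and the drift, at most MSη ≤ S/2, which is absorbed.
  have hSΘ : ∀ Θ : ℝ, 0 ≤ Θ → (∀ s t, A ≤ s → s ≤ t → t ≤ B →
      ‖remDiff f ζ Z σ x x' s t‖ ≤ Θ * (t - s) ^ a) → S ≤ 2 * (Θ * H) := by
    intro Θ hΘ0 hΘ
    have hτ0 : 0 ≤ τ - A := by linarith [hτ.1]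
    have hτη : τ - A ≤ η := by linarith [hτ.2]
    have e : x τ - x' τ = remDiff f ζ Z σ x x' A τ
        + ((∫ w in A..τ, f w (x w)) - ∫ w in A..τ, f w (x' w)) := by
      simp only [remDiff, h0]; abel
    have n1 : ‖(∫ w in A..τ, f w (x w)) - ∫ w in A..τ, f w (x' w)‖ ≤ M * S * η := by
      rw [← intervalIntegral.integral_sub
        (hf.intervalIntegrable_comp (hx.continuousOn h hf) hA hτ.1 (hτ.2.trans hB))
        (hf.intervalIntegrable_comp (hx'.continuousOn h hf) hA hτ.1 (hτ.2.trans hB))]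
      have := intervalIntegral.norm_integral_le_of_norm_le_const (a := A) (b := τ)
        (f := fun w => f w (x w) - f w (x' w)) (C := M * S) (fun w hw => by
          rw [uIoc_of_le hτ.1] at hw
          refine (hf.lip w ⟨by linarith [hw.1], by linarith [hw.2, hτ.2]⟩ _ _).trans ?_
          exact mul_le_mul_of_nonneg_left
            (hS w ⟨by linarith [hw.1], by linarith [hw.2, hτ.2]⟩) hM0)
      rw [abs_of_nonneg hτ0] at this
      exact this.trans (by gcongr)
    have n2 : ‖remDiff f ζ Z σ x x' A τ‖ ≤ Θ * H := by
      refine (hΘ A τ le_rfl hτ.1 hτ.2).trans (mul_le_mul_of_nonneg_left ?_ hΘ0)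
      calc (τ - A) ^ a ≤ η ^ a := Real.rpow_le_rpow hτ0 hτη (by linarith)
        _ ≤ H := Real.rpow_le_rpow_of_exponent_ge' η0 hη1 (by norm_num) (by linarith)
    have : S ≤ Θ * H + M * S * η := by
      calc S = ‖remDiff f ζ Z σ x x' A τ
            + ((∫ w in A..τ, f w (x w)) - ∫ w in A..τ, f w (x' w))‖ := by rw [← e]
        _ ≤ _ := (norm_add_le _ _).trans (add_le_add n2 n1)
    nlinarith
  -- Now S + ΘH ≤ 3ΘH, and by `hηH` three times the sewing constant times H is at most 1/2.
  have improve : ∀ Θ : ℝ, 0 ≤ Θ → (∀ s t, A ≤ s → s ≤ t → t ≤ B →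
      ‖remDiff f ζ Z σ x x' s t‖ ≤ Θ * (t - s) ^ a) →
      ∀ s t, A ≤ s → s ≤ t → t ≤ B → ‖remDiff f ζ Z σ x x' s t‖ ≤ Θ / 2 * (t - s) ^ a := by
    intro Θ hΘ0 hΘ s t hs hst ht
    have hS2 := hSΘ Θ hΘ0 hΘ
    have := norm_le_of_delta2_le ha1 hΘ (fun s u t hs hsu hut ht =>
      norm_delta2_remDiff_le h hf hx hx' hA hB hη1 hAB hS hΘ0 hΘ hs hsu hut ht) hs hst ht
    refine this.trans (mul_le_mul_of_nonneg_right ?_ (Real.rpow_nonneg (by linarith) _))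
    have k1 : S + Θ * H ≤ 3 * (Θ * H) := by linarith
    have k2 : 0 ≤ 58 * M ^ 8 / (1 - 2 ^ (1 - a)) := by positivity
    calc 58 * M ^ 8 * (S + Θ * H) / (1 - 2 ^ (1 - a))
        = 58 * M ^ 8 / (1 - 2 ^ (1 - a)) * (S + Θ * H) := by ring
      _ ≤ 58 * M ^ 8 / (1 - 2 ^ (1 - a)) * (3 * (Θ * H)) := by gcongr
      _ = (6 * (58 * M ^ 8 / (1 - 2 ^ (1 - a))) * H) * (Θ / 2) := by ring
      _ ≤ 1 * (Θ / 2) := by gcongr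
      _ = _ := one_mul _
  -- The iteration starts from the individual bounds of order 3κ, which is at least 2/3 + κ because
  -- κ ≥ 1/3.
  have start : ∀ s t, A ≤ s → s ≤ t → t ≤ B →
      ‖remDiff f ζ Z σ x x' s t‖ ≤ 10 * M ^ 5 * (t - s) ^ a := by
    intro s t hs hst ht
    have k1 := hx.norm_integrated_le h hf (hA.trans hs) hst (ht.trans hB)
    have k2 := hx'.norm_integrated_le h hf (hA.trans hs) hst (ht.trans hB)
    have τ0 : 0 ≤ t - s := by linarith
    have k3 : ((t - s) ^ κ) ^ 3 ≤ (t - s) ^ a := by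
      have : ((t - s) ^ κ) ^ 3 = (t - s) ^ (κ * 3) := by
        rw [Real.rpow_mul τ0]; norm_cast
      rw [this]
      exact Real.rpow_le_rpow_of_exponent_ge' τ0 (by linarith) (by linarith) (by linarith)
    calc ‖remDiff f ζ Z σ x x' s t‖ ≤ _ := _root_.norm_sub_le _ _
      _ ≤ _ := add_le_add k1 k2
      _ = 10 * M ^ 5 * ((t - s) ^ κ) ^ 3 := by ring
      _ ≤ _ := by gcongr
  have iter : ∀ n : ℕ, ∀ s t, A ≤ s → s ≤ t → t ≤ B →
      ‖remDiff f ζ Z σ x x' s t‖ ≤ 10 * M ^ 5 * (1 / 2) ^ n * (t - s) ^ a := by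
    intro n
    induction n with
    | zero => simpa using start
    | succ n ih =>
      have := improve _ (by positivity) ih
      intro s t hs hst ht
      refine (this s t hs hst ht).trans (le_of_eq ?_)
      rw [pow_succ]; ring
  have hSn : ∀ n : ℕ, S ≤ 2 * (10 * M ^ 5 * (1 / 2) ^ n * H) := fun n =>
    hSΘ _ (by positivity) (iter n)
  have hlim : Tendsto (fun n : ℕ => 2 * (10 * M ^ 5 * (1 / 2 : ℝ) ^ n * H)) atTop
      (𝓝 (2 * (10 * M ^ 5 * 0 * H))) :=
    (((tendsto_pow_atTop_nhds_zero_of_lt_one (by norm_num) (by norm_num)).const_mul _).mul_const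
      _).const_mul _
  have hSle : S ≤ 0 := by simpa using ge_of_tendsto' hlim hSn
  have := (hS t₀ ht₀).trans hSle
  exact sub_eq_zero.1 (norm_le_zero_iff.1 this)

/-- Uniqueness of solutions in the sense of Davie. -/
theorem RoughData.eqOn_of_isDavie (h : RoughData T κ M ζ Z σ) (hf : DriftBounds T M f) {Γ Γ' : ℝ}
    (hx : IsDavie T κ Γ f ζ Z σ x) (hx' : IsDavie T κ Γ' f ζ Z σ x') (h0 : x 0 = x' 0) :
    EqOn x x' (Icc 0 T) := by
  -- One constant for the data and for both Davie estimates, as the local argument requires.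
  set N := max M (max Γ Γ') with hN
  have h := h.mono (le_max_left M (max Γ Γ'))
  have hf := hf.mono (le_max_left M (max Γ Γ'))
  have hx := hx.mono ((le_max_left Γ Γ').trans (le_max_right M _))
  have hx' := hx'.mono ((le_max_right Γ Γ').trans (le_max_right M _))
  rw [← hN] at h hf hx hx'
  have hN1 := h.one_le
  have hκ3 := h.rough.lt_exp
  have hθ : 0 < 1 - (2 : ℝ) ^ (1 - (2 / 3 + κ)) := sub_pos.2 (two_rpow_lt_one (by linarith))
  set c := 58 * N ^ 8 / (1 - 2 ^ (1 - (2 / 3 + κ))) with hc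
  have c0 : 0 ≤ c := by positivity
  -- With η = q⁶ the factor η^{1/6} is q, so 6cη^{1/6} ≤ 1, while Nη ≤ Nq ≤ 1/2. The length η does
  -- not depend on the interval, so finitely many blocks cover [0,T].
  set q := 1 / (6 * c + 2 * N) with hq
  have hden : 0 < 6 * c + 2 * N := by linarith
  have q0 : 0 < q := by positivity
  have hqden : q * (6 * c + 2 * N) = 1 := by rw [hq]; field_simp
  have q1 : q ≤ 1 := by nlinarith
  set η := q ^ 6 with hη
  have η0 : 0 < η := by positivity
  have ηq : η ≤ q := by simpa using pow_le_pow_of_le_one q0.le q1 (by norm_num : 1 ≤ 6)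
  have ηH : η ^ (1 / 6 : ℝ) = q := by
    rw [hη, ← Real.rpow_natCast, ← Real.rpow_mul q0.le]; norm_num
  have main : ∀ n : ℕ, ∀ t ∈ Icc 0 T, t ≤ n * η → x t = x' t := by
    intro n
    induction n with
    | zero =>
      intro t ht hle
      have : t = 0 := le_antisymm (by simpa using hle) ht.1
      rw [this, h0]
    | succ n ih =>
      intro t ht hle
      rcases le_total t (n * η) with hcase | hcase
      · exact ih t ht hcase
      · have nη : 0 ≤ (n : ℝ) * η := by positivity
        refine eqOn_of_short h hf hx hx' (A := n * η) (B := t) (η := η) nη ht.2 (ηq.trans q1)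
          (by push_cast at hle; linarith) ?_ ?_ (ih _ ⟨nη, hcase.trans ht.2⟩ le_rfl) t
          ⟨hcase, le_rfl⟩
        · nlinarith
        · rw [ηH]; nlinarith
  intro t ht
  obtain ⟨n, hn⟩ := exists_nat_ge (t / η)
  exact main n t ht ((div_le_iff₀ η0).1 hn)

end Uniqueness

/-! ### The drift averaged over a control. -/

section Drift

variable {m d k : ℕ} {U : Type*} [MetricSpace U] [MeasurableSpace U]

/-- The averaged drift `∫ b(u, p, a) γ_u(da)`. -/
noncomputable def drift (b : ℝ → Vec m → U → Vec m) (γ : ℝ → P2 U) (u : ℝ) (p : Vec m) : Vec m :=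
  ∫ a, b u p a ∂(γ u).measure

lemma tendsto_const_mul_abs_sub_rpow (L : ℝ) {ε : ℝ} (hε : 0 < ε) (u : ℝ) :
    Tendsto (fun v => L * |v - u| ^ ε) (𝓝 u) (𝓝 0) := by
  have h1 : Tendsto (fun v : ℝ => |v - u|) (𝓝 u) (𝓝 |u - u|) :=
    (continuous_id.sub continuous_const).abs.tendsto u
  rw [sub_self, abs_zero] at h1
  simpa [Real.zero_rpow hε.ne'] using (h1.rpow_const (p := ε) (Or.inr hε.le)).const_mul L

/-- Bounds on the drift coefficient in a form that does not mention the control derivative. -/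
structure CoeffBounds (T M : ℝ) (b : ℝ → Vec m → U → Vec m) : Prop where
  cont : ∀ u ∈ Icc 0 T, ∀ p, Continuous (b u p)
  bdd : ∀ u ∈ Icc 0 T, ∀ p a, ‖b u p a‖ ≤ M
  lip : ∀ u ∈ Icc 0 T, ∀ p q a, ‖b u p a - b u q a‖ ≤ M * ‖p - q‖

lemma IsCb011.exists_coeffBounds {T : ℝ} {ι : U → Vec k} {b : ℝ → Vec m → U → Vec m}
    (hb : IsCb011 T ι b) : ∃ M, CoeffBounds T M b := by
  obtain ⟨M₀, h0⟩ := hb.bdd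
  obtain ⟨M₁, h1⟩ := hb.space_bdd
  refine ⟨max M₀ M₁, fun u hu p => ?_, fun u hu p a => (h0 u hu p a).trans (le_max_left _ _),
    fun u hu p q a => ?_⟩
  · exact hb.cont.comp_continuous (f := fun a => (u, p, a)) (by fun_prop)
      (fun a => ⟨hu, mem_univ _⟩)
  · refine (norm_sub_le_of_norm_fderiv_le (φ := fun p => b u p a) (hb.space_diff u hu a)
      (fun p => h1 u hu p a) p q).trans ?_
    gcongr
    exact le_max_right _ _

lemma CoeffBounds.mono {T c c' : ℝ} {b : ℝ → Vec m → U → Vec m} (h : CoeffBounds T c b)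
    (hc : c ≤ c') : CoeffBounds T c' b :=
  ⟨h.cont, fun u hu p a => (h.bdd u hu p a).trans hc, fun u hu p q a => (h.lip u hu p q a).trans
    (by gcongr)⟩

variable [BorelSpace U] [SecondCountableTopology U]

lemma CoeffBounds.integrable {T M : ℝ} {b : ℝ → Vec m → U → Vec m} (h : CoeffBounds T M b)
    {u : ℝ} (hu : u ∈ Icc 0 T) (p : Vec m) (μ : P2 U) : Integrable (b u p) μ.measure :=
  have := μ.isProb
  Integrable.of_bound (h.cont u hu p).aestronglyMeasurable M (ae_of_all _ (h.bdd u hu p))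

lemma norm_integral_sub_le_of_forall {f g : U → Vec m} {μ : P2 U} {C : ℝ}
    (hf : Integrable f μ.measure) (hg : Integrable g μ.measure) (h : ∀ a, ‖f a - g a‖ ≤ C) :
    ‖(∫ a, f a ∂μ.measure) - ∫ a, g a ∂μ.measure‖ ≤ C := by
  have := μ.isProb
  rw [← integral_sub hf hg]
  simpa using norm_integral_le_of_norm_le_const (μ := μ.measure) (ae_of_all _ h)

/-- Continuity in time splits into two parts: b moves uniformly in a, and the measure moves in `W2`
against a fixed bounded continuous function. The constant M is the same for all controls. -/
lemma CoeffBounds.driftBounds {T M ε L : ℝ} {K : Set (P2 U)} {b : ℝ → Vec m → U → Vec m}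
    (h : CoeffBounds T M b) (hbu : UnifContInTime T b) (hε : 0 < ε) {γ : ℝ → P2 U}
    (hγ : γ ∈ controls T ε L K) : DriftBounds T M (drift b γ) := by
  refine ⟨fun p u hu => ?_, fun u hu p => ?_, fun u hu p q => ?_⟩
  · have hW : Tendsto (fun v => W2 (γ v) (γ u)) (𝓝[Icc 0 T] u) (𝓝 0) :=
      squeeze_zero' (Eventually.of_forall fun _ => W2_nonneg _ _)
        (eventually_nhdsWithin_of_forall fun v hv => hγ.2 v hv u hu |>.trans_eq (by rw [abs_sub_comm]))
        ((tendsto_const_mul_abs_sub_rpow L hε u).mono_left nhdsWithin_le_nhds)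
    have h1 := tendsto_integral_vec_of_tendsto_W2 hW (h.cont u hu p) (h.bdd u hu p)
    have h2 : Tendsto (fun v => drift b γ v p - ∫ a, b u p a ∂(γ v).measure) (𝓝[Icc 0 T] u)
        (𝓝 0) := by
      rw [Metric.tendsto_nhds]
      intro η hη
      obtain ⟨δ, hδ, hb⟩ := hbu p (η / 2) (by positivity)
      have hnear : ∀ᶠ v in 𝓝[Icc 0 T] u, |v - u| < δ :=
        nhdsWithin_le_nhds (Metric.ball_mem_nhds u hδ)
      filter_upwards [hnear, self_mem_nhdsWithin] with v hv hvT
      rw [dist_zero_right]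
      exact (norm_integral_sub_le_of_forall (h.integrable hvT p _) (h.integrable hu p _)
        fun a => (hb v hvT u hu hv a).le).trans_lt (by linarith)
    have := h2.add h1
    simp only [sub_add_cancel, zero_add] at this
    exact this
  · have := (γ u).isProb
    simpa [drift] using
      norm_integral_le_of_norm_le_const (μ := (γ u).measure) (ae_of_all _ (h.bdd u hu p))
  · exact norm_integral_sub_le_of_forall (h.integrable hu p _) (h.integrable hu q _)
      fun a => h.lip u hu p q a

end Drift

/-! ### Davie solutions and controlled rough solutions are the same. -/

section Equivalence

variable {m d : ℕ} {U : Type*} [MetricSpace U] [MeasurableSpace U] {T κ M : ℝ} {ζ : ℝ → Vec d}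
  {Z : ℝ → ℝ → Matrix (Fin d) (Fin d) ℝ} {σ : ℝ → Vec m → Vec d →L[ℝ] Vec m}
  {b : ℝ → Vec m → U → Vec m} {γ : ℝ → P2 U} {y : Vec m} {x : ℝ → Vec m}

lemma sq_rpow_eq {τ κ : ℝ} (hτ : 0 ≤ τ) : (τ ^ κ) ^ 2 = τ ^ (2 * κ) := by
  rw [mul_comm, Real.rpow_mul hτ, Real.rpow_two]

lemma cube_rpow_eq {τ κ : ℝ} (hτ : 0 ≤ τ) : (τ ^ κ) ^ 3 = τ ^ (3 * κ) := by
  rw [mul_comm 3, Real.rpow_mul hτ]; norm_cast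

lemma holder1_comp_of_lipBounds {V : Type*} [NormedAddCommGroup V] [NormedSpace ℝ V]
    (h : RoughData T κ M ζ Z σ) {g : ℝ → Vec m → V} (hg : LipBounds T M g) {C : ℝ}
    (hx : ∀ s t, 0 ≤ s → s ≤ t → t ≤ T → ‖x t - x s‖ ≤ C * (t - s) ^ κ) :
    Holder1 T κ (fun s => g s (x s)) := by
  refine ⟨M * M + M * C, fun s t hs hst ht => ?_⟩
  have hM := hg.nonneg
  have h1 := h.two_thirds_le (sub_nonneg.2 hst) (by linarith)
  calc ‖delta1 (fun s => g s (x s)) s t‖ ≤ _ :=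
        hg.norm_sub_le ⟨hs.trans hst, ht⟩ ⟨hs, hst.trans ht⟩ (x t) (x s)
    _ ≤ M * (M * (t - s) ^ κ) + M * (C * (t - s) ^ κ) := by
        rw [abs_of_nonneg (sub_nonneg.2 hst)]
        exact add_le_add (by gcongr) (mul_le_mul_of_nonneg_left (hx s t hs hst ht) hM)
    _ = _ := by ring

lemma IsDavie.norm_remainder_sig_le (h : RoughData T κ M ζ Z σ) {f : ℝ → Vec m → Vec m}
    (hf : DriftBounds T M f) (hx : IsDavie T κ M f ζ Z σ x) {s t : ℝ} (hs : 0 ≤ s) (hst : s ≤ t)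
    (ht : t ≤ T) :
    ‖σ t (x t) - σ s (x s) - gub σ s (x s) (delta1 ζ s t)‖
      ≤ (M ^ 2 + 19 * M ^ 7) * ((t - s) ^ κ) ^ 2 := by
  have hM := h.one_le
  have h1 := h.smooth.norm_remainder_le ⟨hs, hst.trans ht⟩ ⟨hs.trans hst, ht⟩ (x s) (x t)
    (delta1 ζ s t)
  have h2 : ‖x t - x s‖ ≤ _ := hx.norm_sub_le h hf hs hst ht
  have h3 := hx.norm_sub_sig_le h hf hs hst ht
  have h4 := h.le_sq (sub_nonneg.2 hst) (by linarith)
  rw [abs_of_nonneg (sub_nonneg.2 hst)] at h1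
  have hξ : 0 ≤ (t - s) ^ κ := Real.rpow_nonneg (sub_nonneg.2 hst) _
  set ξ := (t - s) ^ κ
  refine h1.trans ?_
  calc _ ≤ M * (M * ξ ^ 2) + M * (4 * M ^ 3 * ξ) ^ 2 + M * (3 * M ^ 2 * ξ ^ 2) := by gcongr
    _ = M ^ 2 * ξ ^ 2 + 16 * M ^ 7 * ξ ^ 2 + 3 * M ^ 3 * ξ ^ 2 := by ring
    _ ≤ M ^ 2 * ξ ^ 2 + 16 * M ^ 7 * ξ ^ 2 + 3 * M ^ 7 * ξ ^ 2 := by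
        gcongr
        · norm_num
    _ = _ := by ring

lemma IsDavie.isControlled_sig (h : RoughData T κ M ζ Z σ) {f : ℝ → Vec m → Vec m}
    (hf : DriftBounds T M f) (hx : IsDavie T κ M f ζ Z σ x) :
    IsControlled T κ ζ (fun s => σ s (x s)) (fun s => gub σ s (x s)) := by
  have hxh : ∀ s t, 0 ≤ s → s ≤ t → t ≤ T → ‖x t - x s‖ ≤ 4 * M ^ 3 * (t - s) ^ κ :=
    fun s t hs hst ht => hx.norm_sub_le h hf hs hst ht
  refine ⟨holder1_comp_of_lipBounds h h.sig hxh, holder1_comp_of_lipBounds h h.gub hxh,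
    M ^ 2 + 19 * M ^ 7, fun s t hs hst ht => ?_⟩
  rw [← sq_rpow_eq (sub_nonneg.2 hst)]
  exact hx.norm_remainder_sig_le h hf hs hst ht

lemma IsDavie.isControlled (h : RoughData T κ M ζ Z σ) {f : ℝ → Vec m → Vec m}
    (hf : DriftBounds T M f) (hx : IsDavie T κ M f ζ Z σ x) :
    IsControlled T κ ζ x (fun s => σ s (x s)) := by
  have hxh : ∀ s t, 0 ≤ s → s ≤ t → t ≤ T → ‖x t - x s‖ ≤ 4 * M ^ 3 * (t - s) ^ κ :=
    fun s t hs hst ht => hx.norm_sub_le h hf hs hst ht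
  refine ⟨⟨_, hxh⟩, holder1_comp_of_lipBounds h h.sig hxh, 3 * M ^ 2, fun s t hs hst ht => ?_⟩
  rw [← sq_rpow_eq (sub_nonneg.2 hst)]
  exact hx.norm_sub_sig_le h hf hs hst ht

/-- The sewing term of the rough integral is the integrated remainder of the solution: its order is
the Davie estimate, and its increment is minus the defect of the rough germ. -/
lemma IsDavie.isSewing (h : RoughData T κ M ζ Z σ) {f : ℝ → Vec m → Vec m}
    (hf : DriftBounds T M f) (hx : IsDavie T κ M f ζ Z σ x) :
    IsSewing T (3 * κ)
      (fun s u t => remainder ζ (fun s => σ s (x s)) (fun s => gub σ s (x s)) s u (delta1 ζ u t)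
        + contract (delta1 (fun s => gub σ s (x s)) s u) (Z u t))
      (fun s t => x t - x s - (∫ u in s..t, f u (x u)) - roughGerm ζ Z σ s t (x s)) := by
  have hc := hx.continuousOn h hf
  refine ⟨⟨5 * M ^ 5, fun s t hs hst ht => ?_⟩, fun s u t hs hsu hut ht => ?_⟩
  · rw [← cube_rpow_eq (sub_nonneg.2 (hst : s ≤ t))]
    exact hx.norm_integrated_le h hf hs hst ht
  · have d1 := h.delta2_roughGerm hs hsu hut ht (x s) (x u)
    have adj := intervalIntegral.integral_add_adjacent_intervals
      (hf.intervalIntegrable_comp hc hs hsu (hut.trans ht))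
      (hf.intervalIntegrable_comp hc (hs.trans hsu) hut ht)
    have e : delta2 (fun s t => x t - x s - (∫ u in s..t, f u (x u))
          - roughGerm ζ Z σ s t (x s)) s u t
        = -(roughGerm ζ Z σ s t (x s) - roughGerm ζ Z σ s u (x s) - roughGerm ζ Z σ u t (x u)) := by
      simp only [delta2]
      rw [← adj]
      abel
    rw [e, d1, neg_neg]
    rfl

/-- The rough integral is taken to be the path increment minus the drift, so the equation holds
trivially. The content is that this is a rough integral, which is `IsDavie.isSewing`. -/
lemma IsDavie.isSolution (h : RoughData T κ M ζ Z σ) (hf : DriftBounds T M (drift b γ))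
    (hx : IsDavie T κ M (drift b γ) ζ Z σ x) (h0 : x 0 = y) :
    IsSolution T κ ζ Z b σ y γ x := by
  refine ⟨h0, hx.isControlled h hf, fun s t => x t - x s - ∫ u in s..t, drift b γ u (x u),
    ⟨hx.isControlled_sig h hf, _, hx.isSewing h hf, fun s t hs hst ht => ?_⟩,
    fun s t hs hst ht => (add_sub_cancel _ _).symm⟩
  change x t - x s - (∫ u in s..t, drift b γ u (x u)) = roughGerm ζ Z σ s t (x s)
        + (x t - x s - (∫ u in s..t, drift b γ u (x u)) - roughGerm ζ Z σ s t (x s))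
  exact (add_sub_cancel _ _).symm

/-- Conversely, the order 3κ of the sewing term is enough: freezing the drift at time s adds an
error of order 1 + κ ≥ 3κ. -/
lemma IsSolution.exists_isDavie (h : RoughData T κ M ζ Z σ) (hf : DriftBounds T M (drift b γ))
    (hx : IsSolution T κ ζ Z b σ y γ x) : ∃ Γ, IsDavie T κ Γ (drift b γ) ζ Z σ x := by
  have hM := h.one_le
  obtain ⟨C, hC⟩ := hx.controlled.path
  obtain ⟨I, ⟨-, Q, ⟨⟨C', hC'⟩, -⟩, hI⟩, heq⟩ := hx.equation
  have hxh : ∀ s t, 0 ≤ s → s ≤ t → t ≤ T → ‖x t - x s‖ ≤ |C| * (t - s) ^ κ :=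
    fun s t hs hst ht => (hC s t hs hst ht).trans
      (mul_le_mul_of_nonneg_right (le_abs_self C) (Real.rpow_nonneg (sub_nonneg.2 hst) _))
  refine ⟨C' + M * |C| * M, fun s t hs hst ht => ?_⟩
  have h1 := hf.norm_integral_freeze_le (by linarith) (abs_nonneg C) h.kappa_pos hxh hs hst ht
  have h2 := hC' s t hs hst ht
  have h3 := h.le_sq (sub_nonneg.2 hst) (by linarith)
  rw [← cube_rpow_eq (sub_nonneg.2 hst)] at h2
  have hξ : 0 ≤ (t - s) ^ κ := Real.rpow_nonneg (sub_nonneg.2 hst) _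
  set ξ := (t - s) ^ κ
  have e : x t - x s - germ (drift b γ) ζ Z σ s t (x s)
      = Q s t + ((∫ u in s..t, drift b γ u (x u)) - ∫ u in s..t, drift b γ u (x s)) := by
    have e1 : x t - x s = (∫ u in s..t, drift b γ u (x u)) + I s t := heq s t hs hst ht
    have e2 : I s t = σ s (x s) (delta1 ζ s t) + contract (gub σ s (x s)) (Z s t) + Q s t :=
      hI s t hs hst ht
    rw [e1, e2, germ, roughGerm]
    abel
  rw [e]
  calc _ ≤ C' * ξ ^ 3 + M * |C| * ξ * (M * ξ ^ 2) := by
        refine (norm_add_le _ _).trans (add_le_add h2 (h1.trans ?_))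
        gcongr
    _ = _ := by ring

end Equivalence

/-! ### Rounding times down to a grid. -/

section Grid

lemma floor_mul_le {η s : ℝ} (hη : 0 < η) (hs : 0 ≤ s) : ⌊s / η⌋₊ * η ≤ s :=
  (le_div_iff₀ hη).1 (Nat.floor_le (div_nonneg hs hη.le))

lemma sub_lt_floor_mul {η : ℝ} (hη : 0 < η) (s : ℝ) : s - η < ⌊s / η⌋₊ * η := by
  have h1 := Nat.lt_floor_add_one (s / η)
  rw [div_lt_iff₀ hη] at h1
  linarith

lemma floor_mul_nonneg {η : ℝ} (hη : 0 < η) (s : ℝ) : 0 ≤ ⌊s / η⌋₊ * η :=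
  mul_nonneg (Nat.cast_nonneg _) hη.le

lemma tendsto_floor_mul {η : ℕ → ℝ} (hη : ∀ n, 0 < η n) (hlim : Tendsto η atTop (𝓝 0)) {s : ℝ}
    (hs : 0 ≤ s) : Tendsto (fun n => ⌊s / η n⌋₊ * η n) atTop (𝓝 s) :=
  tendsto_of_tendsto_of_tendsto_of_le_of_le (by simpa using hlim.const_sub s)
    tendsto_const_nhds (fun n => (sub_lt_floor_mul (hη n) s).le) (fun n => floor_mul_le (hη n) hs)

lemma tendsto_div_add_one (T : ℝ) : Tendsto (fun n : ℕ => T / ((n : ℝ) + 1)) atTop (𝓝 0) := by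
  simpa [div_eq_mul_inv] using (tendsto_one_div_add_atTop_nhds_zero_nat (𝕜 := ℝ)).const_mul T

end Grid

/-! ### Compactness of the set of controls. -/

section Controls

variable {U : Type*} [MetricSpace U] [MeasurableSpace U] [BorelSpace U]
  [SecondCountableTopology U] {T ε L : ℝ} {K : Set (P2 U)}

lemma controls_nonempty (hK : K.Nonempty) (hL : 0 ≤ L) : (controls T ε L K).Nonempty := by
  obtain ⟨μ, hμ⟩ := hK
  refine ⟨fun _ => μ, fun _ _ => hμ, fun s _ t _ => ?_⟩
  rw [W2_self]
  exact mul_nonneg hL (Real.rpow_nonneg (abs_nonneg _) _)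

/-- Limits of controls along an ultrafilter, pointwise for `W2`. -/
lemma exists_ultrafilter_limit (hK : IsCompact K) {γs : ℕ → ℝ → P2 U}
    (hγs : ∀ n, γs n ∈ controls T ε L K) (𝒰 : Ultrafilter ℕ) :
    ∃ γ ∈ controls T ε L K, ∀ t ∈ Icc 0 T, Tendsto (fun n => W2 (γs n t) (γ t)) 𝒰 (𝓝 0) := by
  have lim : ∀ t, ∃ μ, t ∈ Icc 0 T → μ ∈ K ∧ Tendsto (fun n => W2 (γs n t) μ) 𝒰 (𝓝 0) := by
    intro t
    by_cases ht : t ∈ Icc 0 T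
    · obtain ⟨μ, hμ, hlim⟩ := hK.ultrafilter_le_nhds (𝒰.map fun n => γs n t) (by
        rw [Ultrafilter.coe_map, le_principal_iff, mem_map]
        exact univ_mem' fun n => (hγs n).1 t ht)
      exact ⟨μ, fun _ => ⟨hμ, tendsto_W2_of_tendsto hlim⟩⟩
    · exact ⟨γs 0 0, fun h => absurd h ht⟩
  choose γ hγ using lim
  refine ⟨γ, ⟨fun t ht => (hγ t ht).1, fun s hs t ht => ?_⟩, fun t ht => (hγ t ht).2⟩
  -- The Hölder bound passes to the limit by the triangle inequality through γs n s and γs n t.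
  have h1 : ∀ n, W2 (γ s) (γ t) ≤ W2 (γs n s) (γ s) + L * |t - s| ^ ε + W2 (γs n t) (γ t) := by
    intro n
    have a := W2_triangle (γ s) (γs n s) (γ t)
    have b := W2_triangle (γs n s) (γs n t) (γ t)
    have c := (hγs n).2 s hs t ht
    rw [W2_comm (γ s) (γs n s)] at a
    linarith
  have h2 : Tendsto (fun n => W2 (γs n s) (γ s) + L * |t - s| ^ ε + W2 (γs n t) (γ t)) 𝒰
      (𝓝 (0 + L * |t - s| ^ ε + 0)) := ((hγ s hs).2.add_const _).add (hγ t ht).2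
  rw [zero_add, add_zero] at h2
  exact ge_of_tendsto' h2 h1

/-- Sequential compactness of the set of controls for pointwise `W2`-convergence. -/
lemma exists_subseq_tendsto_W2 (hT : 0 < T) (hε : 0 < ε) (hL : 0 ≤ L) (hK : IsCompact K)
    {γs : ℕ → ℝ → P2 U} (hγs : ∀ n, γs n ∈ controls T ε L K) :
    ∃ γ ∈ controls T ε L K, ∃ φ : ℕ → ℕ, Tendsto φ atTop atTop ∧
      ∀ t ∈ Icc 0 T, Tendsto (fun j => W2 (γs (φ j) t) (γ t)) atTop (𝓝 0) := by
  obtain ⟨γ, hγ, hlim⟩ := exists_ultrafilter_limit hK hγs (hyperfilter ℕ)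
  -- An actual sequence is needed later for dominated convergence. At stage j the ultrafilter
  -- provides one index, at least j, that is good at all grid points i * η j at once (i from 0 to j
  -- + 1). The common Hölder modulus then reaches every other time.
  let η : ℕ → ℝ := fun j => T / ((j : ℝ) + 1)
  have hη : ∀ j, 0 < η j := fun j => by positivity
  have hηlim : Tendsto η atTop (𝓝 0) := tendsto_div_add_one T
  have hgrid : ∀ j : ℕ, ∃ n, j ≤ n ∧ ∀ i ∈ Finset.range (j + 2), i * η j ≤ T →
      W2 (γs n (i * η j)) (γ (i * η j)) < 1 / ((j : ℝ) + 1) := by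
    intro j
    have h1 : ∀ᶠ n in (hyperfilter ℕ : Filter ℕ), ∀ i ∈ Finset.range (j + 2), i * η j ≤ T →
        W2 (γs n (i * η j)) (γ (i * η j)) < 1 / ((j : ℝ) + 1) := by
      rw [eventually_all_finset]
      intro i _
      by_cases hi : i * η j ≤ T
      · filter_upwards [(hlim (i * η j) ⟨by positivity, hi⟩).eventually_lt_const
          (show (0 : ℝ) < 1 / ((j : ℝ) + 1) by positivity)] with n hn _ using hn
      · exact Eventually.of_forall fun n h => absurd h hi
    have h2 : ∀ᶠ n in (hyperfilter ℕ : Filter ℕ), j ≤ n :=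
      Nat.hyperfilter_le_atTop (eventually_ge_atTop j)
    exact (h2.and h1).exists
  choose φ hφ hW using hgrid
  refine ⟨γ, hγ, φ, tendsto_atTop_mono hφ tendsto_id, fun t ht => ?_⟩
  have hbound : ∀ j, W2 (γs (φ j) t) (γ t)
      ≤ L * (η j) ^ ε + 1 / ((j : ℝ) + 1) + L * (η j) ^ ε := by
    intro j
    set i := ⌊t / η j⌋₊ with hi
    have hle : i * η j ≤ t := floor_mul_le (hη j) ht.1
    have hge : t - η j < i * η j := sub_lt_floor_mul (hη j) t
    have hiT : (i : ℝ) * η j ∈ Icc 0 T := ⟨floor_mul_nonneg (hη j) t, hle.trans ht.2⟩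
    have hij : i ∈ Finset.range (j + 2) := by
      rw [Finset.mem_range]
      have : i ≤ j + 1 := by
        refine Nat.floor_le_of_le ?_
        rw [div_le_iff₀ (hη j)]
        simp only [η]
        push_cast
        rw [mul_div_cancel₀ _ (by positivity)]
        exact ht.2
      omega
    have hpow : L * |t - i * η j| ^ ε ≤ L * (η j) ^ ε := by
      refine mul_le_mul_of_nonneg_left (Real.rpow_le_rpow (abs_nonneg _) ?_ hε.le) hL
      rw [abs_of_nonneg (by linarith)]
      linarith
    have a := W2_triangle (γs (φ j) t) (γs (φ j) (i * η j)) (γ t)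
    have b := W2_triangle (γs (φ j) (i * η j)) (γ (i * η j)) (γ t)
    have c := ((hγs (φ j)).2 _ hiT t ht).trans hpow
    have e := (hγ.2 _ hiT t ht).trans hpow
    rw [W2_comm (γs (φ j) t) (γs (φ j) (i * η j))] at a
    have := hW j i hij hiT.2
    linarith
  refine squeeze_zero (fun _ => W2_nonneg _ _) hbound ?_
  have p : Tendsto (fun j => L * (η j) ^ ε) atTop (𝓝 0) := by
    simpa [Real.zero_rpow hε.ne'] using (hηlim.rpow_const (p := ε) (Or.inr hε.le)).const_mul L
  simpa using (p.add tendsto_one_div_add_atTop_nhds_zero_nat).add p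

end Controls

/-! ### Continuous dependence of the solution on the control. -/

section Stability

variable {m d : ℕ} {U : Type*} [MetricSpace U] [MeasurableSpace U] [BorelSpace U]
  [SecondCountableTopology U] {T κ M ε L : ℝ} {ζ : ℝ → Vec d}
  {Z : ℝ → ℝ → Matrix (Fin d) (Fin d) ℝ} {σ : ℝ → Vec m → Vec d →L[ℝ] Vec m}
  {b : ℝ → Vec m → U → Vec m} {K : Set (P2 U)} {γ : ℝ → P2 U} {y : Vec m} {x : ℝ → Vec m}
  {f : ℝ → Vec m → Vec m}

lemma IsDavie.congr {Γ : ℝ} {x' : ℝ → Vec m} (hx : IsDavie T κ Γ f ζ Z σ x)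
    (h : EqOn x x' (Icc 0 T)) : IsDavie T κ Γ f ζ Z σ x' := fun s t hs hst ht => by
  rw [← h ⟨hs, hst.trans ht⟩, ← h ⟨hs.trans hst, ht⟩]
  exact hx s t hs hst ht

/-- The radius does not depend on the drift, so the solutions for all controls stay in one compact
ball. -/
lemma IsDavie.mem_closedBall {Γ : ℝ} (hx : IsDavie T κ Γ f ζ Z σ x) (h : RoughData T κ M ζ Z σ)
    (hf : DriftBounds T M f) (hΓ : 0 ≤ Γ) {t : ℝ} (ht : t ∈ Icc 0 T) :
    x t ∈ Metric.closedBall (x 0) (3 * M ^ 3 * M + Γ * M ^ 3) := by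
  have hM := h.one_le
  have h1 := hx 0 t le_rfl ht.1 ht.2
  have h2 := h.norm_germ_le hf le_rfl ht.1 ht.2 (x 0)
  rw [sub_zero] at h1 h2
  have h3 := h.rpow_kappa_le ht.1 ht.2
  have h4 : 0 ≤ t ^ κ := Real.rpow_nonneg ht.1 _
  rw [mem_closedBall_iff_norm]
  calc ‖x t - x 0‖ = ‖germ f ζ Z σ 0 t (x 0) + (x t - x 0 - germ f ζ Z σ 0 t (x 0))‖ := by
        congr 1; abel
    _ ≤ _ := norm_add_le _ _
    _ ≤ _ := add_le_add (h2.trans (by gcongr)) (h1.trans (by gcongr))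

lemma exists_isSolution (h : RoughData T κ M ζ Z σ) (hT : 0 < T)
    (hf : DriftBounds T M (drift b γ)) (y : Vec m) : ∃ x, IsSolution T κ ζ Z b σ y γ x := by
  obtain ⟨x, h0, hx⟩ := h.exists_isDavie hT hf y
  exact ⟨x, IsDavie.isSolution (h.mono (le_max_left M (eulerConst κ M ^ 3)))
    (hf.mono (le_max_left _ _)) (hx.mono (le_max_right _ _)) h0⟩

lemma isSolution_solution (h : RoughData T κ M ζ Z σ) (hT : 0 < T)
    (hf : DriftBounds T M (drift b γ)) (y : Vec m) :
    IsSolution T κ ζ Z b σ y γ (solution T κ ζ Z b σ y γ) :=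
  Classical.epsilon_spec (exists_isSolution h hT hf y)

lemma IsDavie.eqOn_solution {Γ : ℝ} (hx : IsDavie T κ Γ (drift b γ) ζ Z σ x)
    (h : RoughData T κ M ζ Z σ) (hT : 0 < T) (hf : DriftBounds T M (drift b γ)) (h0 : x 0 = y) :
    EqOn x (solution T κ ζ Z b σ y γ) (Icc 0 T) := by
  have hs := isSolution_solution h hT hf y
  obtain ⟨Γ', hs'⟩ := hs.exists_isDavie h hf
  exact h.eqOn_of_isDavie hf hx hs' (h0.trans hs.initial.symm)

lemma IsSolution.eqOn_solution (hx : IsSolution T κ ζ Z b σ y γ x) (h : RoughData T κ M ζ Z σ)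
    (hT : 0 < T) (hf : DriftBounds T M (drift b γ)) :
    EqOn x (solution T κ ζ Z b σ y γ) (Icc 0 T) := by
  obtain ⟨Γ, hx'⟩ := hx.exists_isDavie h hf
  exact hx'.eqOn_solution h hT hf hx.initial

/-- By uniqueness the chosen solution coincides with a limit of Euler schemes and inherits its
constant, which is uniform over the controls. -/
lemma isDavie_solution (h : RoughData T κ M ζ Z σ) (hT : 0 < T)
    (hf : DriftBounds T M (drift b γ)) (y : Vec m) :
    IsDavie T κ (eulerConst κ M ^ 3) (drift b γ) ζ Z σ (solution T κ ζ Z b σ y γ) := by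
  obtain ⟨x, h0, hx⟩ := h.exists_isDavie hT hf y
  exact hx.congr (hx.eqOn_solution h hT hf h0)

lemma continuousOn_solution (h : RoughData T κ M ζ Z σ) (hT : 0 < T)
    (hf : DriftBounds T M (drift b γ)) (y : Vec m) :
    ContinuousOn (solution T κ ζ Z b σ y γ) (Icc 0 T) :=
  ((isDavie_solution h hT hf y).mono (le_max_right M _)).continuousOn
    (h.mono (le_max_left _ _)) (hf.mono (le_max_left _ _))

lemma CoeffBounds.tendsto_integral_drift (hb : CoeffBounds T M b) {γs : ℕ → ℝ → P2 U}
    (hfs : ∀ n, DriftBounds T M (drift b (γs n)))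
    (hW : ∀ t ∈ Icc 0 T, Tendsto (fun n => W2 (γs n t) (γ t)) atTop (𝓝 0)) {s t : ℝ}
    (hs : 0 ≤ s) (hst : s ≤ t) (ht : t ≤ T) (p : Vec m) :
    Tendsto (fun n => ∫ u in s..t, drift b (γs n) u p) atTop (𝓝 (∫ u in s..t, drift b γ u p)) := by
  have hmem : ∀ u ∈ uIoc s t, u ∈ Icc 0 T := fun u hu => by
    rw [uIoc_of_le hst] at hu
    exact ⟨hs.trans hu.1.le, hu.2.trans ht⟩
  refine intervalIntegral.tendsto_integral_filter_of_dominated_convergence (fun _ => M)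
    (Eventually.of_forall fun n => ?_)
    (Eventually.of_forall fun n => ae_of_all _ fun u hu => (hfs n).bdd u (hmem u hu) p)
    intervalIntegrable_const (ae_of_all _ fun u hu => ?_)
  · exact (intervalIntegrable_iff.1
      ((hfs n).intervalIntegrable p hs hst ht)).aestronglyMeasurable
  · exact tendsto_integral_vec_of_tendsto_W2 (hW u (hmem u hu)) (hb.cont u (hmem u hu) p)
      (hb.bdd u (hmem u hu) p)

/-- Stability of solutions under pointwise `W2`-convergence of the controls. -/
lemma tendsto_solution (h : RoughData T κ M ζ Z σ) (hb : CoeffBounds T M b) (hT : 0 < T)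
    {γs : ℕ → ℝ → P2 U} (hfs : ∀ n, DriftBounds T M (drift b (γs n)))
    (hf : DriftBounds T M (drift b γ))
    (hW : ∀ t ∈ Icc 0 T, Tendsto (fun n => W2 (γs n t) (γ t)) atTop (𝓝 0)) (y : Vec m) {t : ℝ}
    (ht : t ∈ Icc 0 T) :
    Tendsto (fun n => solution T κ ζ Z b σ y (γs n) t) atTop (𝓝 (solution T κ ζ Z b σ y γ t)) := by
  -- Along any ultrafilter finer than `atTop` the bounded solutions have a pointwise limit X.
  -- Uniqueness will identify X, so the whole sequence converges without extraction.
  rw [tendsto_iff_ultrafilter]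
  intro 𝒰 h𝒰
  have hM := h.one_le
  have hΓ : 0 ≤ eulerConst κ M ^ 3 := pow_nonneg (zero_le_one.trans h.one_le_eulerConst) _
  set xs : ℕ → ℝ → Vec m := fun n => solution T κ ζ Z b σ y (γs n) with hxs
  have hx0 : ∀ n, xs n 0 = y := fun n => (isSolution_solution h hT (hfs n) y).initial
  have hD : ∀ n, IsDavie T κ (eulerConst κ M ^ 3) (drift b (γs n)) ζ Z σ (xs n) :=
    fun n => isDavie_solution h hT (hfs n) y
  have lim : ∀ t, ∃ z, t ∈ Icc 0 T → Tendsto (fun n => xs n t) 𝒰 (𝓝 z) := by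
    intro t
    by_cases ht : t ∈ Icc 0 T
    · obtain ⟨z, -, hz⟩ := (isCompact_closedBall y
        (3 * M ^ 3 * M + eulerConst κ M ^ 3 * M ^ 3)).ultrafilter_le_nhds (𝒰.map fun n => xs n t)
        (by
          rw [Ultrafilter.coe_map, le_principal_iff, mem_map]
          refine univ_mem' fun n => ?_
          have := (hD n).mem_closedBall h (hfs n) hΓ ht
          rwa [hx0] at this)
      exact ⟨z, fun _ => hz⟩
    · exact ⟨0, fun h => absurd h ht⟩
  choose X hX using lim
  have hX0 : X 0 = y := by
    have h1 := hX 0 ⟨le_rfl, hT.le⟩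
    simp only [hx0] at h1
    exact tendsto_nhds_unique h1 tendsto_const_nhds
  have hXD : IsDavie T κ (eulerConst κ M ^ 3) (drift b γ) ζ Z σ X := by
    intro s t hs hst ht
    have sT : s ∈ Icc 0 T := ⟨hs, hst.trans ht⟩
    have tT : t ∈ Icc 0 T := ⟨hs.trans hst, ht⟩
    have l1 : Tendsto (fun n => ∫ u in s..t, drift b (γs n) u (X s)) 𝒰
        (𝓝 (∫ u in s..t, drift b γ u (X s))) :=
      (hb.tendsto_integral_drift hfs hW hs hst ht (X s)).mono_left h𝒰
    -- The moving base point is replaced by its limit using the uniform Lipschitz constant.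
    -- Dominated convergence, which needs a countably generated filter, is used at a fixed point and
    -- then restricted to 𝒰.
    have l2 : Tendsto (fun n => (∫ u in s..t, drift b (γs n) u (xs n s))
        - ∫ u in s..t, drift b (γs n) u (X s)) 𝒰 (𝓝 0) := by
      refine squeeze_zero_norm (a := fun n => M * ‖xs n s - X s‖ * |t - s|) (fun n => ?_) ?_
      · rw [← intervalIntegral.integral_sub ((hfs n).intervalIntegrable _ hs hst ht)
          ((hfs n).intervalIntegrable _ hs hst ht)]
        refine intervalIntegral.norm_integral_le_of_norm_le_const fun u hu => ?_
        rw [uIoc_of_le hst] at hu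
        exact (hfs n).lip u ⟨hs.trans hu.1.le, hu.2.trans ht⟩ _ _
      · have : Tendsto (fun n => ‖xs n s - X s‖) 𝒰 (𝓝 0) :=
          tendsto_iff_norm_sub_tendsto_zero.1 (hX s sT)
        simpa using (this.const_mul M).mul_const |t - s|
    have l3 : Tendsto (fun n => ∫ u in s..t, drift b (γs n) u (xs n s)) 𝒰
        (𝓝 (∫ u in s..t, drift b γ u (X s))) := by
      simpa using l2.add l1
    have lg : Tendsto (fun n => germ (drift b (γs n)) ζ Z σ s t (xs n s)) 𝒰
        (𝓝 (germ (drift b γ) ζ Z σ s t (X s))) :=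
      l3.add (h.tendsto_roughGerm (fun _ => hs) (fun _ => le_rfl) hst (fun _ => hst)
        (fun _ => le_rfl) ht tendsto_const_nhds tendsto_const_nhds (hX s sT))
    exact le_of_tendsto' (((hX t tT).sub (hX s sT)).sub lg).norm fun n => hD n s t hs hst ht
  rw [← hXD.eqOn_solution h hT hf hX0 ht]
  exact hX t ht

end Stability

/-! ### Measurability and continuity of the rewards. -/

section Reward

variable {m d : ℕ} {U : Type*} [MetricSpace U] [MeasurableSpace U] [BorelSpace U]
  [SecondCountableTopology U] {T κ M ε L : ℝ} {ζ : ℝ → Vec d}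
  {Z : ℝ → ℝ → Matrix (Fin d) (Fin d) ℝ} {σ : ℝ → Vec m → Vec d →L[ℝ] Vec m}
  {b : ℝ → Vec m → U → Vec m} {K : Set (P2 U)} {γ : ℝ → P2 U} {y : Vec m} {x : ℝ → Vec m}
  {F : ℝ → Vec m → P2 U → ℝ} {G : Vec m → ℝ}

/-- The space variable is moved first, uniformly over K, and the measure afterwards at the fixed
limit point p. In this order the Lipschitz constant in μ may depend on x. -/
lemma IsRunningReward.tendsto (hF : IsRunningReward T K F) {s : ℝ} (hs : s ∈ Icc 0 T)
    {ι : Type*} {l : Filter ι} {p' : ι → Vec m} {μs : ι → P2 U} {p : Vec m} {μ : P2 U}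
    (hp : Tendsto p' l (𝓝 p)) (hW : Tendsto (fun i => W2 (μs i) μ) l (𝓝 0))
    (hμs : ∀ i, μs i ∈ K) (hμ : μ ∈ K) :
    Tendsto (fun i => F s (p' i) (μs i)) l (𝓝 (F s p μ)) := by
  obtain ⟨C, hC⟩ := hF.lip_space s hs
  obtain ⟨C', hC'⟩ := hF.lip_control s hs p
  rw [tendsto_iff_norm_sub_tendsto_zero]
  have hp' : Tendsto (fun i => ‖p' i - p‖) l (𝓝 0) := tendsto_iff_norm_sub_tendsto_zero.1 hp
  refine squeeze_zero (g := fun i => C * ‖p' i - p‖ + C' * W2 (μs i) μ) (fun _ => norm_nonneg _)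
    (fun i => ?_) (by simpa using (hp'.const_mul C).add (hW.const_mul C'))
  rw [Real.norm_eq_abs]
  have h1 := hC _ (hμs i) (p' i) p
  have h2 := hC' _ (hμs i) _ hμ
  calc _ ≤ |F s (p' i) (μs i) - F s p (μs i)| + |F s p (μs i) - F s p μ| := abs_sub_le _ _ _
    _ ≤ _ := add_le_add h1 h2

lemma tendsto_W2_of_mem_controls (hε : 0 < ε) (hγ : γ ∈ controls T ε L K) {t : ℝ}
    (ht : t ∈ Icc 0 T) {ι : Type*} {l : Filter ι} {s : ι → ℝ} (hs : ∀ i, s i ∈ Icc 0 T)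
    (hlim : Tendsto s l (𝓝 t)) : Tendsto (fun i => W2 (γ (s i)) (γ t)) l (𝓝 0) :=
  squeeze_zero (fun _ => W2_nonneg _ _)
    (fun i => (hγ.2 _ (hs i) t ht).trans_eq (by rw [abs_sub_comm, Function.comp_apply]))
    ((tendsto_const_mul_abs_sub_rpow L hε t).comp hlim)

/-- On each cell of the grid the state and the control are frozen, so measurability in s for fixed
arguments suffices. -/
lemma IsRunningReward.aestronglyMeasurable_step (hF : IsRunningReward T K F)
    (hγ : ∀ t ∈ Icc 0 T, γ t ∈ K) {η : ℝ} (hη : 0 < η) :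
    AEStronglyMeasurable (fun s => F s (x (⌊s / η⌋₊ * η)) (γ (⌊s / η⌋₊ * η)))
      (volume.restrict (Icc 0 T)) := by
  have hcover : Icc 0 T = ⋃ i : ℕ, Icc 0 T ∩ {s | ⌊s / η⌋₊ = i} := by
    ext s
    simp
  have hmeas : ∀ i : ℕ, MeasurableSet (Icc 0 T ∩ {s : ℝ | ⌊s / η⌋₊ = i}) := fun i =>
    measurableSet_Icc.inter ((Nat.measurable_floor.comp (measurable_id.div_const η))
      (measurableSet_singleton i))
  rw [hcover, aestronglyMeasurable_iUnion_iff]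
  intro i
  by_cases hi : i * η ≤ T
  · refine ((hF.meas (x (i * η)) (γ (i * η)) (hγ _ ⟨by positivity, hi⟩)).mono_measure
      (Measure.restrict_mono inter_subset_left le_rfl)).congr ?_
    filter_upwards [ae_restrict_mem (hmeas i)] with s hs
    rw [show ⌊s / η⌋₊ = i from hs.2]
  · have : Icc 0 T ∩ {s : ℝ | ⌊s / η⌋₊ = i} = ∅ := by
      refine eq_empty_of_forall_notMem fun s hs => hi ?_
      have := floor_mul_le hη hs.1.1
      rw [show ⌊s / η⌋₊ = i from hs.2] at this
      exact this.trans hs.1.2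
    rw [this, Measure.restrict_empty]
    exact aestronglyMeasurable_zero_measure _

/-- Pointwise limit of the step versions: the first argument s of F is kept, and only the times
inside x and γ are rounded. -/
lemma IsRunningReward.aestronglyMeasurable (hF : IsRunningReward T K F) (hε : 0 < ε)
    (hγ : γ ∈ controls T ε L K) (hx : ContinuousOn x (Icc 0 T)) :
    AEStronglyMeasurable (fun s => F s (x s) (γ s)) (volume.restrict (Icc 0 T)) := by
  let η : ℕ → ℝ := fun n => 1 / ((n : ℝ) + 1)
  have hη : ∀ n, 0 < η n := fun n => by positivity
  refine aestronglyMeasurable_of_tendsto_ae atTop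
    (fun n => hF.aestronglyMeasurable_step (x := x) hγ.1 (hη n)) ?_
  filter_upwards [ae_restrict_mem measurableSet_Icc] with s hs
  have hmem : ∀ n, (⌊s / η n⌋₊ * η n : ℝ) ∈ Icc 0 T := fun n =>
    ⟨floor_mul_nonneg (hη n) s, (floor_mul_le (hη n) hs.1).trans hs.2⟩
  have hlim := tendsto_floor_mul hη (tendsto_div_add_one 1) hs.1
  refine hF.tendsto hs ?_ (tendsto_W2_of_mem_controls hε hγ hs hmem hlim)
    (fun n => hγ.1 _ (hmem n)) (hγ.1 s hs)
  exact (hx s hs).tendsto.comp (tendsto_nhdsWithin_iff.2 ⟨hlim, Eventually.of_forall hmem⟩)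

lemma IsRunningReward.intervalIntegrable (hF : IsRunningReward T K F) (hT : 0 ≤ T) (hε : 0 < ε)
    (hγ : γ ∈ controls T ε L K) (hx : ContinuousOn x (Icc 0 T)) :
    IntervalIntegrable (fun s => F s (x s) (γ s)) volume 0 T := by
  obtain ⟨C, hC⟩ := hF.bdd
  rw [intervalIntegrable_iff_integrableOn_Icc_of_le hT]
  refine Integrable.of_bound (hF.aestronglyMeasurable hε hγ hx) C ?_
  filter_upwards [ae_restrict_mem measurableSet_Icc] with s hs
  exact hC s hs _ _ (hγ.1 s hs)

lemma exists_objective_le (hF : IsRunningReward T K F) (hG : IsTerminalReward G) (hT : 0 ≤ T) :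
    ∃ C, ∀ γ ∈ controls T ε L K, objective T κ ζ Z b σ F G y γ ≤ C := by
  obtain ⟨C, hC⟩ := hF.bdd
  obtain ⟨C', hC'⟩ := hG.bdd
  refine ⟨C * |T - 0| + C', fun γ hγ => add_le_add ((le_abs_self _).trans ?_)
    ((le_abs_self _).trans (hC' _))⟩
  rw [← Real.norm_eq_abs]
  refine intervalIntegral.norm_integral_le_of_norm_le_const fun s hs => ?_
  rw [uIoc_of_le hT] at hs
  exact hC s ⟨hs.1.le, hs.2⟩ _ _ (hγ.1 s ⟨hs.1.le, hs.2⟩)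

lemma tendsto_objective (h : RoughData T κ M ζ Z σ) (hb : CoeffBounds T M b)
    (hbu : UnifContInTime T b) (hT : 0 < T) (hε : 0 < ε) (hF : IsRunningReward T K F)
    (hG : IsTerminalReward G) {γs : ℕ → ℝ → P2 U} (hγs : ∀ n, γs n ∈ controls T ε L K)
    (hγ : γ ∈ controls T ε L K)
    (hW : ∀ t ∈ Icc 0 T, Tendsto (fun n => W2 (γs n t) (γ t)) atTop (𝓝 0)) :
    Tendsto (fun n => objective T κ ζ Z b σ F G y (γs n)) atTop
      (𝓝 (objective T κ ζ Z b σ F G y γ)) := by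
  have hfs := fun n => hb.driftBounds hbu hε (hγs n)
  have hf := hb.driftBounds hbu hε hγ
  have hsol : ∀ t ∈ Icc 0 T, _ := fun t ht => tendsto_solution h hb hT hfs hf hW y ht
  obtain ⟨C, hC⟩ := hF.bdd
  have hmem : ∀ s ∈ uIoc 0 T, s ∈ Icc 0 T := fun s hs => by
    rw [uIoc_of_le hT.le] at hs
    exact ⟨hs.1.le, hs.2⟩
  refine Tendsto.add ?_ ((hG.cont.tendsto _).comp (hsol T ⟨hT.le, le_rfl⟩))
  refine intervalIntegral.tendsto_integral_filter_of_dominated_convergence (fun _ => C)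
    (Eventually.of_forall fun n => ?_)
    (Eventually.of_forall fun n => ae_of_all _ fun s hs =>
      hC s (hmem s hs) _ _ ((hγs n).1 s (hmem s hs)))
    intervalIntegrable_const (ae_of_all _ fun s hs => ?_)
  · exact (intervalIntegrable_iff.1 (hF.intervalIntegrable hT.le hε (hγs n)
      (continuousOn_solution h hT (hfs n) y))).aestronglyMeasurable
  · exact hF.tendsto (hmem s hs) (hsol s (hmem s hs)) (hW s (hmem s hs))
      (fun n => (hγs n).1 s (hmem s hs)) (hγ.1 s (hmem s hs))

end Reward

end RoughControl

/-! ### The direct method. -/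

open RoughControl in
theorem mainTheorem5 {m d k : ℕ} {U : Type*} [MetricSpace U] [MeasurableSpace U] [BorelSpace U]
    -- the control space: a subset of `ℝᵏ`, with a metric inducing its topology
    (ι : U → Vec k) (hι : Topology.IsEmbedding ι)
    (T : ℝ) (hT : 0 < T)
    -- the driving rough path
    (α κ : ℝ) (hκ : 1 / 3 < κ) (hκα : κ < α) (hκ2 : κ ≤ 1 / 2)
    (ζ : ℝ → Vec d) (Z : ℝ → ℝ → Matrix (Fin d) (Fin d) ℝ)
    (hζ : IsGeometricRoughPath T α ζ Z)
    -- the coefficients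
    (b : ℝ → Vec m → U → Vec m) (hb : IsCb011 T ι b) (hbu : UnifContInTime T b)
    (σ : ℝ → Vec m → Vec d →L[ℝ] Vec m) (hσ : IsCb13 T σ)
    -- the controls
    (K : Set (P2 U)) (hK : IsCompact K) (hKne : K.Nonempty)
    (ε L : ℝ) (hε : 0 < ε) (hL : 0 < L)
    -- the rewards
    (F : ℝ → Vec m → P2 U → ℝ) (hF : IsRunningReward T K F)
    (G : Vec m → ℝ) (hG : IsTerminalReward G)
    (y : Vec m) :
    -- every `J_T(γ)` is well defined: the equation has one and only one solution on `[0,T]`,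
    -- and the running reward along it is integrable
    (∀ γ ∈ controls T ε L K,
      IsSolution T κ ζ Z b σ y γ (solution T κ ζ Z b σ y γ) ∧
      (∀ x, IsSolution T κ ζ Z b σ y γ x →
        Set.EqOn x (solution T κ ζ Z b σ y γ) (Set.Icc 0 T)) ∧
      IntervalIntegrable (fun s => F s (solution T κ ζ Z b σ y γ s) (γ s)) volume 0 T) ∧
    -- the value is a finite supremum, and it is attained
    IsLUB (objective T κ ζ Z b σ F G y '' controls T ε L K)
      (value T κ ζ Z b σ F G ε L K y) ∧
    ∃ γ' ∈ controls T ε L K,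
      objective T κ ζ Z b σ F G y γ' = value T κ ζ Z b σ F G ε L K y := by

  -- The embedding into ℝᵏ makes U second countable, as the countable partitions and the
  -- measurability of the distance on U × U require.
  have := hι.secondCountableTopology
  obtain ⟨M₁, h⟩ := exists_roughData hζ hκ hκα hκ2 hσ
  obtain ⟨M₂, hb⟩ := hb.exists_coeffBounds
  replace h := h.mono (le_max_left M₁ M₂)
  replace hb := hb.mono (le_max_right M₁ M₂)
  have hf : ∀ γ ∈ controls T ε L K, DriftBounds T (max M₁ M₂) (drift b γ) :=
    fun γ hγ => hb.driftBounds hbu hε hγ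
  have hne : (objective T κ ζ Z b σ F G y '' controls T ε L K).Nonempty :=
    (controls_nonempty hKne hL.le).image _
  have hbdd : BddAbove (objective T κ ζ Z b σ F G y '' controls T ε L K) := by
    obtain ⟨C, hC⟩ := exists_objective_le (κ := κ) (ζ := ζ) (Z := Z) (σ := σ) (b := b) (y := y)
      (ε := ε) (L := L) hF hG hT.le
    exact ⟨C, Set.forall_mem_image.2 hC⟩
  refine ⟨fun γ hγ => ⟨isSolution_solution h hT (hf γ hγ) y,
    fun x hx => hx.eqOn_solution h hT (hf γ hγ),
    hF.intervalIntegrable hT.le hε hγ (continuousOn_solution h hT (hf γ hγ) y)⟩,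
    isLUB_csSup hne hbdd, ?_⟩
  -- A maximising sequence: a limit of its controls along φ has as objective the limit of the
  -- values, which is the supremum.
  obtain ⟨J, -, hJ, hmem⟩ := exists_seq_tendsto_sSup hne hbdd
  choose γs hγs hval using hmem
  obtain ⟨γ, hγ, φ, hφ, hW⟩ := exists_subseq_tendsto_W2 hT hε hL.le hK hγs
  refine ⟨γ, hγ, ?_⟩
  have h1 := tendsto_objective (y := y) h hb hbu hT hε hF hG (fun j => hγs (φ j)) hγ hW
  simp only [hval] at h1
  exact tendsto_nhds_unique h1 (hJ.comp hφ)
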